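/- A ribbon graph is a finite directed graph $G$ (multiple edges allowed) together with a cyclic ordering of the out-edges of each vertex; $e^+$ denotes the edge following $e$ in the cyclic order at its tail. A divisor-and-rotor configuration on $G$ is a pair $(x,\varrho)$ with $x\in\mathbb{Z}^{V(G)}$ and $\varrho$ a function assigning to each vertex $v$ an out-edge of $v$. An unconstrained routing at $v$ replaces $\varrho(v)$ by $\varrho(v)^+$ and moves one chip from $v$ to the head $v'$ of $\varrho(v)^+$, i.e. replaces $x$ by $x-\mathbf{1}_v+\mathbf{1}_{v'}$ (without any requirement on $x(v)$). Write $(x_1,\varrho_1)\sim(x_2,\varrho_2)$ (linear equivalence) if $(x_2,\varrho_2)$ can be reached from $(x_1,\varrho_1)$ by a finite sequence of unconstrained routings. Proposition. The following problem can be decided in time polynomial in the length of the input (by a deterministic Turing machine): given a strongly connected loopless ribbon graph $G$ and two divisor-and-rotor configurations $(x_1,\varrho_1)$, $(x_2,\varrho_2)$ on $G$, does $(x_1,\varrho_1)\sim(x_2,\varrho_2)$ hold? Here multiple edges are given compactly: the vertices are $0,\dots,n-1$, the cyclic order of the out-edges of a vertex $u$ is given by a list of pairs $(v,m)$, each standing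 for $m$ consecutive parallel edges from $u$ to $v$, each rotor is given by its position among the out-edges of its vertex as so listed, and all integers (vertex names, multiplicities $m$, positions, and the entries of $x_1,x_2$) are written in binary. -/

import Mathlib

/-! ### Ribbon graphs and the rotor-routing game -/

/-- A directed multigraph with vertices `V` and edges `E`, together with a cyclic ordering of the
out-edges of every vertex: `next e` is the edge following `e` in the cyclic order at its tail. -/
structure RibbonGraph (V E : Type) where
  tail : E → V
  head : E → V
  next : Equiv.Perm E
  sameCycle_iff : ∀ e f : E, next.SameCycle e f ↔ tail e = tail f

namespace RibbonGraph

variable {V E : Type}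

/-- There are no loops (multiple edges are allowed). -/
def Loopless (G : RibbonGraph V E) : Prop :=
  ∀ e : E, G.tail e ≠ G.head e

/-- Every vertex can be reached from every vertex by a directed path. -/
def StronglyConnected (G : RibbonGraph V E) : Prop :=
  ∀ u v : V, Relation.ReflTransGen (fun a b => ∃ e : E, G.tail e = a ∧ G.head e = b) u v

/-- A divisor-and-rotor configuration: an integer number of chips on every vertex, and
for every vertex an out-edge of that vertex, its rotor. -/
@[ext]
structure DRC (G : RibbonGraph V E) where
  chips : V → ℤ
  rotor : V → E
  tail_rotor : ∀ v : V, G.tail (rotor v) = v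

theorem tail_next (G : RibbonGraph V E) (e : E) : G.tail (G.next e) = G.tail e :=
  ((G.sameCycle_iff e (G.next e)).1 (Equiv.Perm.SameCycle.refl _ _).apply_right).symm

/-- The (not necessarily legal) routing at `v`: the rotor at `v` advances to the next edge, and
one chip is moved from `v` to the head of this edge. -/
def DRC.route [DecidableEq V] {G : RibbonGraph V E} (c : G.DRC) (v : V) : G.DRC where
  chips := c.chips - Pi.single v 1 + Pi.single (G.head (G.next (c.rotor v))) 1
  rotor := Function.update c.rotor v (G.next (c.rotor v))
  tail_rotor u := by
    by_cases h : u = v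
    · subst h
      simp [tail_next, c.tail_rotor]
    · simp [h, c.tail_rotor]

/-- Linear equivalence of divisor-and-rotor configurations: the second can be reached from the
first by a finite sequence of unconstrained routings. -/
def DRC.LinEquiv [DecidableEq V] {G : RibbonGraph V E} (c₁ c₂ : G.DRC) : Prop :=
  Relation.ReflTransGen (fun c c' : G.DRC => ∃ v : V, c' = c.route v) c₁ c₂

end RibbonGraph

/-! ### Compact descriptions -/

/-- A compact description of a ribbon graph on the vertices `0, …, n - 1`. The cyclic order of the
out-edges of `u` is described by a list of runs `(v, m)`, each standing for `m` consecutive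
parallel edges from `u` to `v`. -/
structure CompactRibbonGraph where
  n : ℕ
  runs : Fin n → List (Fin n × ℕ)

namespace CompactRibbonGraph

variable (D : CompactRibbonGraph)

/-- The heads of the out-edges of `u`, in the order in which the runs list them. -/
def outHeads (u : Fin D.n) : List (Fin D.n) :=
  (D.runs u).flatMap fun p => List.replicate p.2 p.1

/-- An edge is given by its tail and its position among the out-edges of the tail. -/
abbrev Edge : Type := Σ u : Fin D.n, Fin (D.outHeads u).length

/-- The permutation that sends the `i`-th out-edge of a vertex to the `(i + 1)`-st one, and
the last one to the first one. -/
def nextEdge : Equiv.Perm D.Edge :=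
  Equiv.sigmaCongrRight fun u => finRotate (D.outHeads u).length

theorem nextEdge_sameCycle_iff (e f : D.Edge) :
    D.nextEdge.SameCycle e f ↔ e.1 = f.1 := by
  have hpow : ∀ (k : ℕ) (u : Fin D.n) (i : Fin (D.outHeads u).length),
      (D.nextEdge ^ k) ⟨u, i⟩ = ⟨u, (finRotate (D.outHeads u).length ^ k) i⟩ := by
    intro k u i
    induction k with
    | zero => rfl
    | succ k ih => rw [pow_succ', pow_succ', Equiv.Perm.mul_apply, ih]; rfl
  have hrot : ∀ (m : ℕ) (i j : Fin m), ∃ k : ℕ, (finRotate m ^ k) i = j := by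
    intro m i j
    rcases m with _ | m
    · exact i.elim0
    have h : ∀ k : ℕ, (finRotate (m + 1) ^ k) i = i + (Fin.ofNat (m + 1) k) := by
      intro k
      induction k with
      | zero => simp
      | succ k ih =>
        rw [pow_succ', Equiv.Perm.mul_apply, ih, finRotate_apply, add_assoc]
        congr 1
        ext
        simp [Fin.val_add]
    refine ⟨(j - i).val, ?_⟩
    rw [h]
    simp
  constructor
  · rintro ⟨k, rfl⟩
    have h1 : ∀ a : D.Edge, (D.nextEdge a).1 = a.1 := fun _ => rfl
    have h2 : ∀ (k : ℕ) (a : D.Edge), ((D.nextEdge ^ k) a).1 = a.1 := by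
      rintro k ⟨u, i⟩
      rw [hpow]
    rcases k with k | k
    · simp [h2]
    · rw [zpow_negSucc]
      conv_lhs => rw [← Equiv.apply_symm_apply (D.nextEdge ^ (k + 1)) e]
      exact h2 _ _
  · obtain ⟨u, i⟩ := e
    obtain ⟨v, j⟩ := f
    rintro (rfl : u = v)
    obtain ⟨k, hk⟩ := hrot _ i j
    exact ⟨k, by rw [zpow_natCast, hpow, hk]⟩

/-- The ribbon graph described by `D`. -/
def toRibbonGraph : RibbonGraph (Fin D.n) D.Edge where
  tail e := e.1
  head e := (D.outHeads e.1).get e.2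
  next := D.nextEdge
  sameCycle_iff := D.nextEdge_sameCycle_iff

end CompactRibbonGraph

/-- An input of the decision problem: a compactly described strongly connected ribbon graph
without loops, and two divisor-and-rotor configurations on it. -/
structure LinEquivInput where
  graph : CompactRibbonGraph
  loopless : graph.toRibbonGraph.Loopless
  stronglyConnected : graph.toRibbonGraph.StronglyConnected
  config₁ : graph.toRibbonGraph.DRC
  config₂ : graph.toRibbonGraph.DRC

/-! ### Encoding of the inputs as words over a finite alphabet -/

/-- The input alphabet. -/
inductive InputSymbol : Type
  | bit (b : Bool)
  | minus
  | comma
  | semicolon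
  | bar
  deriving DecidableEq, Fintype

namespace InputSymbol

/-- A natural number in binary (least significant bit first), terminated by a comma. -/
def encodeNat (m : ℕ) : List InputSymbol :=
  (Nat.bits m).map bit ++ [comma]

/-- An integer: a minus sign if it is negative, and its absolute value in binary. -/
def encodeInt (x : ℤ) : List InputSymbol :=
  (if x < 0 then [minus] else []) ++ encodeNat x.natAbs

/-- For every vertex the list of its runs, with the multiplicities in binary. -/
def encodeGraph (D : CompactRibbonGraph) : List InputSymbol :=
  ((List.finRange D.n).flatMap fun u =>
    ((D.runs u).flatMap fun p => encodeNat p.1 ++ encodeNat p.2) ++ [semicolon]) ++ [bar]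

/-- For every vertex its number of chips and the position of its rotor, both in binary. -/
def encodeDRC {D : CompactRibbonGraph} (c : D.toRibbonGraph.DRC) : List InputSymbol :=
  ((List.finRange D.n).flatMap fun u =>
    encodeInt (c.chips u) ++ encodeNat (c.rotor u).2) ++ [bar]

/-- The word that encodes an input of the decision problem. -/
def encodeInput (I : LinEquivInput) : List InputSymbol :=
  encodeGraph I.graph ++ encodeDRC I.config₁ ++ encodeDRC I.config₂

end InputSymbol

/-! ### Polynomial time decidability -/

/-- The property `P` of the elements of `α`, given as words over the alphabet `Γ` by `encode`, is
decided by a Turing machine that halts, with the correct truth value as its output, after a number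
of steps that is bounded by a polynomial in the length of the input word. -/
def DecidableInPolyTime {α Γ : Type} (encode : α → List Γ) (P : α → Prop) : Prop :=
  ∃ f : α → Bool, (∀ a, f a = true ↔ P a) ∧
    Nonempty (Turing.TM2ComputableInPolyTime encode Computability.encodeBool f)

/-! ### Structured programs for stack machines -/

namespace PolyTime

open Turing

/-! Turn all rotors back: subtract from the chips the effect of sending one chip along each out-edge
up to and including the current rotor. A routing leaves this `potential` unchanged unless the rotor
completes a turn, in which case the Laplacian column of the routed vertex is added. So linear
equivalence makes the potentials differ by `lap D.mult *ᵥ z` with `z` integral. Conversely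
(`linEquiv_iff`), routings can align the rotors, and a full turn at `v` adds the column of `v`.
Negative entries of `z` do no harm: strong connectivity gives a strictly positive kernel vector, a
large multiple of which can be added to `z`.

It remains to decide whether `L z = y` has an integral solution. Let `e` be the indicator of the
vertex 0. Then `A = L + e 1ᵀ` is nonsingular, and a division-free Faddeev–LeVerrier recursion gives
`B` and `D ≠ 0` with `A B = D I`. An integral `z` solves `L z = y` exactly if `y` has sum zero and
`A z = y + k e` for an integer `k`, which is then the sum of `z`. Multiplication by `B` turns this
into congruences `D ∣ (B y)_v + k (B e)_v` in the single unknown `k` (`exists_lap_mulVec_eq_iff`),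
and the Euclidean algorithm merges them one after the other (`congSolvable_iff`). The recursion
produces numbers of polynomially many bits (`esize_foldl_faddeevStep_le`), and the numbers in the
congruences never exceed `|D|`.

For the machine model, functions on binary trees are built from a few combinators with an explicit
time bound, and these are compiled through structured programs to a stack machine (`Code.runs_prog`,
`Runs.reachesIn`). The functions satisfying `PT` are closed under composition and under folds over
lists with intermediate results of polynomial size (`PT.foldl`). The decision procedure is a nest of
such folds, so its polynomial running time follows from closure properties and size bounds. -/

/-- The stacks of the machines. -/
inductive Stk : Type
  | inp
  | out
  | main
  | aux
  | buf
  | cnt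
  deriving DecidableEq

instance : Fintype Stk :=
  ⟨{.inp, .out, .main, .aux, .buf, .cnt}, fun k => by cases k <;> simp⟩

/-- The alphabets of the stacks. -/
abbrev Stk.Sym : Stk → Type
  | inp => InputSymbol
  | out => Bool
  | main => Bool
  | aux => Option Bool
  | buf => Bool
  | cnt => Unit

/-- The register that holds the symbol popped last. -/
inductive Reg : Type
  | empty
  | bit (b : Bool)
  | mark
  | sym (s : InputSymbol)
  deriving DecidableEq, Fintype

/-- The register contents after a pop. -/
def Reg.read : ∀ k : Stk, Option k.Sym → Reg
  | .inp, some s => sym s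
  | .out, some b => bit b
  | .main, some b => bit b
  | .aux, some (some b) => bit b
  | .aux, some none => mark
  | .buf, some b => bit b
  | .cnt, some _ => mark
  | _, none => empty

/-- Structured programs. -/
inductive Prog : Type
  | push (k : Stk) (f : Reg → k.Sym)
  | pop (k : Stk)
  | load (f : Reg → Reg)
  | seq (p q : Prog)
  | ite (c : Reg → Bool) (p q : Prog)
  | loop (c : Reg → Bool) (p : Prog)

infixr:65 " ;; " => Prog.seq

/-- The contents of the stacks. -/
abbrev Stacks : Type := ∀ k : Stk, List k.Sym

/-- `Runs p x t y`: the program `p` leads from `x` to `y` in at most `t` steps. -/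
inductive Runs : Prog → Reg × Stacks → ℕ → Reg × Stacks → Prop
  | push {k f r S} : Runs (.push k f) (r, S) 1 (r, Function.update S k (f r :: S k))
  | pop {k r S} : Runs (.pop k) (r, S) 1 (Reg.read k (S k).head?, Function.update S k (S k).tail)
  | load {f r S} : Runs (.load f) (r, S) 1 (f r, S)
  | seq {p q x t y u z} : Runs p x t y → Runs q y u z → Runs (p ;; q) x (t + u) z
  | ite_true {c p q x t y} : c x.1 = true → Runs p x t y → Runs (.ite c p q) x (t + 1) y
  | ite_false {c p q x t y} : c x.1 = false → Runs q x t y → Runs (.ite c p q) x (t + 1) y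
  | loop_true {c p x t y u z} : c x.1 = true → Runs p x t y → Runs (.loop c p) y u z →
      Runs (.loop c p) x (t + u + 1) z
  | loop_false {c p x} : c x.1 = false → Runs (.loop c p) x 1 x
  | mono {p x t u y} : Runs p x t y → t ≤ u → Runs p x u y

namespace Prog

/-- The labels of the machine that executes a program. -/
def Lbl : Prog → Type
  | push _ _ => Unit
  | pop _ => Unit
  | load _ => Unit
  | seq p q => Lbl p ⊕ Lbl q
  | ite _ p q => Option (Lbl p ⊕ Lbl q)
  | loop _ p => Option (Lbl p)

instance lblFintype : ∀ p : Prog, Fintype p.Lbl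
  | push _ _ => inferInstanceAs (Fintype Unit)
  | pop _ => inferInstanceAs (Fintype Unit)
  | load _ => inferInstanceAs (Fintype Unit)
  | seq p q => @instFintypeSum _ _ (lblFintype p) (lblFintype q)
  | ite _ p q => @instFintypeOption _ (@instFintypeSum _ _ (lblFintype p) (lblFintype q))
  | loop _ p => @instFintypeOption _ (lblFintype p)

/-- The label at which the execution starts. -/
def entry : ∀ p : Prog, p.Lbl
  | push _ _ => ()
  | pop _ => ()
  | load _ => ()
  | seq p _ => Sum.inl (entry p)
  | ite _ _ _ => none
  | loop _ _ => none

/-- The statements of a machine that executes a program and then continues at `e`. -/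
def compile {Λ : Type} : ∀ p : Prog, (p.Lbl → Λ) → Λ → p.Lbl → TM2.Stmt Stk.Sym Λ Reg
  | push k f, _, e, _ => .push k f (.goto fun _ => e)
  | pop k, _, e, _ => .pop k (fun _ s => Reg.read k s) (.goto fun _ => e)
  | load f, _, e, _ => .load f (.goto fun _ => e)
  | seq p q, emb, _, Sum.inl l => compile p (emb ∘ Sum.inl) (emb (Sum.inr q.entry)) l
  | seq _ q, emb, e, Sum.inr l => compile q (emb ∘ Sum.inr) e l
  | ite c p q, emb, _, none => .branch c (.goto fun _ => emb (some (Sum.inl p.entry)))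
      (.goto fun _ => emb (some (Sum.inr q.entry)))
  | ite _ p _, emb, e, some (Sum.inl l) => compile p (emb ∘ some ∘ Sum.inl) e l
  | ite _ _ q, emb, e, some (Sum.inr l) => compile q (emb ∘ some ∘ Sum.inr) e l
  | loop c p, emb, e, none => .branch c (.goto fun _ => emb (some p.entry)) (.goto fun _ => e)
  | loop _ p, emb, _, some l => compile p (emb ∘ some) (emb none) l

end Prog

/-- The configuration of a machine at the label `l`. -/
abbrev cfg {Λ : Type} (l : Λ) (x : Reg × Stacks) : TM2.Cfg Stk.Sym Λ Reg := ⟨some l, x.1, x.2⟩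

/-- Reachability in at most a given number of steps. -/
def ReachesIn {Λ : Type} (M : Λ → TM2.Stmt Stk.Sym Λ Reg) (a : TM2.Cfg Stk.Sym Λ Reg) (t : ℕ)
    (b : TM2.Cfg Stk.Sym Λ Reg) : Prop :=
  ∃ s ≤ t, (flip bind (TM2.step M))^[s] (some a) = some b

section

variable {Λ : Type} {M : Λ → TM2.Stmt Stk.Sym Λ Reg} {a b c : TM2.Cfg Stk.Sym Λ Reg} {t u : ℕ}

theorem ReachesIn.trans (h₁ : ReachesIn M a t b) (h₂ : ReachesIn M b u c) :
    ReachesIn M a (t + u) c := by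
  obtain ⟨s₁, hs₁, h₁⟩ := h₁
  obtain ⟨s₂, hs₂, h₂⟩ := h₂
  exact ⟨s₂ + s₁, by omega, by rw [Function.iterate_add_apply, h₁, h₂]⟩

theorem ReachesIn.mono (h : ReachesIn M a t b) (htu : t ≤ u) : ReachesIn M a u b := by
  obtain ⟨s, hs, h⟩ := h
  exact ⟨s, hs.trans htu, h⟩

theorem ReachesIn.single (h : TM2.step M a = some b) : ReachesIn M a 1 b :=
  ⟨1, le_rfl, by simpa [flip] using h⟩

end

/-- The label embedding and the exit label are arbitrary, so the induction hypotheses apply to a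
subprogram placed anywhere inside a larger machine. -/
theorem Runs.reachesIn {p : Prog} {x y : Reg × Stacks} {t : ℕ} (h : Runs p x t y) :
    ∀ {Λ : Type} (M : Λ → TM2.Stmt Stk.Sym Λ Reg) (emb : p.Lbl → Λ) (e : Λ),
      (∀ l, M (emb l) = p.compile emb e l) → ReachesIn M (cfg (emb p.entry) x) t (cfg e y) := by
  induction h with
  | push => exact fun M emb e hM => .single (by simp [cfg, hM, Prog.compile])
  | pop => exact fun M emb e hM => .single (by simp [cfg, hM, Prog.compile])
  | load => exact fun M emb e hM => .single (by simp [cfg, hM, Prog.compile])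
  | seq _ _ ih₁ ih₂ =>
    intro Λ M emb e hM
    exact (ih₁ M (emb ∘ Sum.inl) _ fun l => hM (Sum.inl l)).trans
      (ih₂ M (emb ∘ Sum.inr) e fun l => hM (Sum.inr l))
  | @ite_true c p q x t y hc _ ih =>
    intro Λ M emb e hM
    rw [add_comm]
    refine (ReachesIn.single (b := cfg (emb (some (Sum.inl p.entry))) x) ?_).trans
      (ih M (emb ∘ some ∘ Sum.inl) e fun l => hM (some (Sum.inl l)))
    rw [TM2.step, show M (emb (Prog.ite c p q).entry) = _ from hM none]
    simp [Prog.compile, hc]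
  | @ite_false c p q x t y hc _ ih =>
    intro Λ M emb e hM
    rw [add_comm]
    refine (ReachesIn.single (b := cfg (emb (some (Sum.inr q.entry))) x) ?_).trans
      (ih M (emb ∘ some ∘ Sum.inr) e fun l => hM (some (Sum.inr l)))
    rw [TM2.step, show M (emb (Prog.ite c p q).entry) = _ from hM none]
    simp [Prog.compile, hc]
  | @loop_true c p x t y u z hc _ _ ih₁ ih₂ =>
    intro Λ M emb e hM
    rw [add_comm]
    refine (ReachesIn.single (b := cfg (emb (some p.entry)) x) ?_).trans
      ((ih₁ M (emb ∘ some) _ fun l => hM (some l)).trans (ih₂ M emb e hM))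
    rw [TM2.step, show M (emb (Prog.loop c p).entry) = _ from hM none]
    simp [Prog.compile, hc]
  | @loop_false c p x hc =>
    intro Λ M emb e hM
    refine .single ?_
    rw [TM2.step, show M (emb (Prog.loop c p).entry) = _ from hM none]
    simp [Prog.compile, hc]
  | mono _ htu ih => exact fun M emb e hM => (ih M emb e hM).mono htu

/-- The stacks with the given contents. -/
def stk (i : List InputSymbol) (o m : List Bool) (a : List (Option Bool)) (b : List Bool)
    (c : List Unit) : Stacks
  | .inp => i
  | .out => o
  | .main => m
  | .aux => a
  | .buf => b
  | .cnt => c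

section

variable {r : Reg} {i : List InputSymbol} {o m b : List Bool} {a : List (Option Bool)}
  {c : List Unit}

theorem update_stk_inp (l) : Function.update (stk i o m a b c) .inp l = stk l o m a b c := by
  funext k; cases k <;> rfl

theorem update_stk_out (l) : Function.update (stk i o m a b c) .out l = stk i l m a b c := by
  funext k; cases k <;> rfl

theorem update_stk_main (l) : Function.update (stk i o m a b c) .main l = stk i o l a b c := by
  funext k; cases k <;> rfl

theorem update_stk_aux (l) : Function.update (stk i o m a b c) .aux l = stk i o m l b c := by
  funext k; cases k <;> rfl

theorem update_stk_buf (l) : Function.update (stk i o m a b c) .buf l = stk i o m a l c := by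
  funext k; cases k <;> rfl

theorem update_stk_cnt (l) : Function.update (stk i o m a b c) .cnt l = stk i o m a b l := by
  funext k; cases k <;> rfl

theorem Runs.push_out {f} :
    Runs (.push .out f) (r, stk i o m a b c) 1 (r, stk i (f r :: o) m a b c) := by
  have h := Runs.push (k := .out) (r := r) (f := f) (S := stk i o m a b c)
  rwa [update_stk_out] at h

theorem Runs.push_main {f} :
    Runs (.push .main f) (r, stk i o m a b c) 1 (r, stk i o (f r :: m) a b c) := by
  have h := Runs.push (k := .main) (r := r) (f := f) (S := stk i o m a b c)
  rwa [update_stk_main] at h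

theorem Runs.push_aux {f} :
    Runs (.push .aux f) (r, stk i o m a b c) 1 (r, stk i o m (f r :: a) b c) := by
  have h := Runs.push (k := .aux) (r := r) (f := f) (S := stk i o m a b c)
  rwa [update_stk_aux] at h

theorem Runs.push_buf {f} :
    Runs (.push .buf f) (r, stk i o m a b c) 1 (r, stk i o m a (f r :: b) c) := by
  have h := Runs.push (k := .buf) (r := r) (f := f) (S := stk i o m a b c)
  rwa [update_stk_buf] at h

theorem Runs.push_cnt {f} :
    Runs (.push .cnt f) (r, stk i o m a b c) 1 (r, stk i o m a b (f r :: c)) := by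
  have h := Runs.push (k := .cnt) (r := r) (f := f) (S := stk i o m a b c)
  rwa [update_stk_cnt] at h

theorem Runs.pop_inp :
    Runs (.pop .inp) (r, stk i o m a b c) 1 (Reg.read .inp i.head?, stk i.tail o m a b c) := by
  have h := Runs.pop (k := .inp) (r := r) (S := stk i o m a b c)
  rwa [update_stk_inp] at h

theorem Runs.pop_main :
    Runs (.pop .main) (r, stk i o m a b c) 1 (Reg.read .main m.head?, stk i o m.tail a b c) := by
  have h := Runs.pop (k := .main) (r := r) (S := stk i o m a b c)
  rwa [update_stk_main] at h

theorem Runs.pop_aux :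
    Runs (.pop .aux) (r, stk i o m a b c) 1 (Reg.read .aux a.head?, stk i o m a.tail b c) := by
  have h := Runs.pop (k := .aux) (r := r) (S := stk i o m a b c)
  rwa [update_stk_aux] at h

theorem Runs.pop_buf :
    Runs (.pop .buf) (r, stk i o m a b c) 1 (Reg.read .buf b.head?, stk i o m a b.tail c) := by
  have h := Runs.pop (k := .buf) (r := r) (S := stk i o m a b c)
  rwa [update_stk_buf] at h

theorem Runs.pop_cnt :
    Runs (.pop .cnt) (r, stk i o m a b c) 1 (Reg.read .cnt c.head?, stk i o m a b c.tail) := by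
  have h := Runs.pop (k := .cnt) (r := r) (S := stk i o m a b c)
  rwa [update_stk_cnt] at h

end

end PolyTime

/-! ### Functions on binary trees and the programs that compute them -/

namespace PolyTime

/-- Binary trees, the data of the programs. -/
inductive Tree : Type
  | nil
  | cons (a b : Tree)
  deriving DecidableEq

namespace Tree

/-- The prefix code of a tree. -/
def code : Tree → List Bool
  | nil => [false]
  | cons a b => true :: (a.code ++ b.code)

/-- The number of nodes of a tree. -/
def size : Tree → ℕ
  | nil => 1
  | cons a b => a.size + b.size + 1

@[simp] theorem length_code (x : Tree) : x.code.length = x.size := by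
  induction x with
  | nil => rfl
  | cons a b iha ihb => simp [code, size, iha, ihb]

theorem code_cons_append (a b : Tree) (m : List Bool) :
    (cons a b).code ++ m = true :: (a.code ++ (b.code ++ m)) := by
  simp [code]

theorem size_pos (x : Tree) : 0 < x.size := by
  cases x <;> simp [size]

/-- The first component. -/
def fst : Tree → Tree
  | nil => nil
  | cons a _ => a

/-- The second component. -/
def snd : Tree → Tree
  | nil => nil
  | cons _ b => b

/-- Apply a function as often as the list `n` is long. -/
def iterate (f : Tree → Tree) : Tree → Tree → Tree
  | nil, x => x
  | cons _ n, x => iterate f n (f x)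

/-- The time that an iteration takes. -/
def iterateTime (f : Tree → Tree) (t : Tree → ℕ) : Tree → Tree → ℕ
  | nil, x => x.size
  | cons h n, x => 20 * (cons h n).size + t x + iterateTime f t n (f x)

theorem size_iterate_le (f : Tree → Tree) (t : Tree → ℕ) (n x : Tree) :
    (iterate f n x).size ≤ iterateTime f t n x := by
  induction n generalizing x with
  | nil => exact le_rfl
  | cons h n _ ih => exact (ih (f x)).trans (Nat.le_add_left _ _)

end Tree

/-- Combinators for functions on trees. -/
inductive Code : Type
  | id
  | nil
  | fst
  | snd
  | pair (f g : Code)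
  | comp (f g : Code)
  | ite (c f g : Code)
  | iter (f : Code)

namespace Code

/-- The function that a combinator denotes. -/
def eval : Code → Tree → Tree
  | id, x => x
  | nil, _ => .nil
  | fst, x => x.fst
  | snd, x => x.snd
  | pair f g, x => .cons (f.eval x) (g.eval x)
  | comp f g, x => f.eval (g.eval x)
  | ite c f g, x => if c.eval x = .nil then f.eval x else g.eval x
  | iter _, .nil => .nil
  | iter f, .cons n x => Tree.iterate f.eval n x

/-- A bound for the time that the evaluation of a combinator takes. -/
def time : Code → Tree → ℕ
  | id, x => x.size
  | nil, x => 14 * x.size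
  | fst, x => 20 * x.size
  | snd, x => 20 * x.size
  | pair f g, x => 26 * x.size + f.time x + g.time x
  | comp f g, x => f.time (g.eval x) + g.time x
  | ite c f g, x => 30 * x.size + c.time x + 18 * (c.eval x).size +
      if c.eval x = .nil then f.time x else g.time x
  | iter _, .nil => 20
  | iter f, .cons n x => 20 + Tree.iterateTime f.eval f.time n x

/-- Lets a time bound double as a bound on the output size, which is what keeps compositions
polynomial. -/
theorem size_eval_le (c : Code) (x : Tree) : (c.eval x).size ≤ c.time x := by
  induction c generalizing x with
  | id => exact le_rfl
  | nil => have := x.size_pos; simp only [eval, time, Tree.size]; omega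
  | fst => cases x <;> simp only [eval, time, Tree.size, Tree.fst] <;> omega
  | snd => cases x <;> simp only [eval, time, Tree.size, Tree.snd] <;> omega
  | pair f g ihf ihg =>
    have := x.size_pos
    have := ihf x
    have := ihg x
    simp only [eval, time, Tree.size]
    omega
  | comp f g ihf ihg => exact (ihf _).trans (Nat.le_add_right _ _)
  | ite c f g ihc ihf ihg =>
    have := ihf x
    have := ihg x
    simp only [eval, time]
    split_ifs <;> omega
  | iter f ih =>
    cases x with
    | nil => simp [eval, time, Tree.size]
    | cons n x => exact (Tree.size_iterate_le _ _ _ _).trans (Nat.le_add_left _ _)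

end Code

/-- The bit in the register. -/
def Reg.toBit : Reg → Bool
  | .bit b => b
  | _ => false

/-- The register holds a bit. -/
def Reg.isBit : Reg → Bool
  | .bit _ => true
  | _ => false

namespace Prog

/-- Do nothing. -/
def skip : Prog := load fun r => r

/-- Move the topmost tree from the main stack to the auxiliary stack, onto a marker. -/
def moveVal : Prog :=
  push .aux (fun _ => none) ;; load (fun _ => .mark) ;;
    loop (fun r => decide (r ≠ .empty)) (pop .main ;; push .aux (fun r => some r.toBit) ;;
      ite (fun r => r.toBit) (push .cnt fun _ => ()) (pop .cnt))

/-- Remove the symbols down to the topmost marker from the auxiliary stack, and run `p` for each. -/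
def drain (p : Prog) : Prog :=
  pop .aux ;; loop (fun r => r.isBit) (p ;; pop .aux)

/-- Move the tree that was moved last back to the main stack. -/
def restore : Prog := drain (push .main fun r => r.toBit)

/-- Remove the topmost tree from the main stack. -/
def drop : Prog := moveVal ;; drain skip

/-- Move the contents of the buffer to the auxiliary stack, onto a marker. -/
def refill : Prog :=
  push .aux (fun _ => none) ;; pop .buf ;;
    loop (fun r => r.isBit) (push .aux (fun r => some r.toBit) ;; pop .buf)

/-- Copy the topmost tree from the main stack to the auxiliary stack, onto a marker. -/
def save : Prog :=
  moveVal ;; drain (push .main (fun r => r.toBit) ;; push .buf (fun r => r.toBit)) ;; refill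

end Prog

/-! ### Running times of the elementary stack programs. -/

namespace Runs

variable {r : Reg} {i : List InputSymbol} {o m b : List Bool} {a : List (Option Bool)}
  {c : List Unit} {x : Tree}

theorem skip {S : Stacks} : Runs Prog.skip (r, S) 1 (r, S) := Runs.load

/-- A prefix code needs no end marker. The stack `cnt` holds one token for each subtree still to be
read after the current one: a node adds a token, a leaf removes one. Popping from the empty counter
puts `.empty` into the register, and this ends the loop exactly at the end of the tree. -/
theorem moveVal :
    Runs Prog.moveVal (r, stk i o (x.code ++ m) a b []) (5 * x.size + 3)
      (.empty, stk i o m (x.code.reverse.map some ++ none :: a) b []) := by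
  -- Continuation form: given a run of the same loop from the state after `x`, there is one from the
  -- state before `x`. The two subtrees of a node can thus be read in one loop.
  have key : ∀ (x : Tree) {r m a c t y}, r ≠ Reg.empty →
      Runs (.loop (fun r => decide (r ≠ .empty)) (.pop .main ;; .push .aux (fun r => some r.toBit) ;;
        .ite (fun r => r.toBit) (.push .cnt fun _ => ()) (.pop .cnt)))
        (Reg.read .cnt c.head?, stk i o m (x.code.reverse.map some ++ a) b c.tail) t y →
      Runs (.loop (fun r => decide (r ≠ .empty)) (.pop .main ;; .push .aux (fun r => some r.toBit) ;;
        .ite (fun r => r.toBit) (.push .cnt fun _ => ()) (.pop .cnt)))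
        (r, stk i o (x.code ++ m) a b c) (t + 5 * x.size) y := by
    intro x
    induction x with
    | nil =>
      intro r m a c t y hr h
      refine ((Runs.loop_true (by simpa using hr)
        (Runs.pop_main.seq (Runs.push_aux.seq (.ite_false ?_ Runs.pop_cnt))) h).mono ?_)
      · rfl
      · simp only [Tree.size]; omega
    | cons x y ihx ihy =>
      intro r m a c t z hr h
      have h1 := ihy (r := .mark) (m := m) (a := (x.code.reverse.map some ++ some true :: a))
        (c := c) (t := t) (y := z) (by simp) (by simpa [Tree.code] using h)
      have h2 := ihx (r := .bit true) (m := y.code ++ m) (a := some true :: a) (c := () :: c)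
        (by simp) h1
      rw [Tree.code_cons_append]
      refine ((Runs.loop_true (by simpa using hr)
        (Runs.pop_main.seq (Runs.push_aux.seq (.ite_true ?_ Runs.push_cnt))) h2).mono ?_)
      · rfl
      · simp only [Tree.size]; omega
  refine (Runs.push_aux.seq (Runs.load.seq (key x (by simp) (Runs.loop_false ?_)))).mono ?_
  · rfl
  · omega

/-- The action of `p` on `main` and `buf` is abstracted to `F`, so that `restore`, `drop` and `save`
are instances. -/
theorem drain {p : Prog} {t : ℕ} (F : Bool → List Bool × List Bool → List Bool × List Bool)
    (h : ∀ v m a b, Runs p (.bit v, stk i o m a b c) t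
      (.bit v, stk i o (F v (m, b)).1 a (F v (m, b)).2 c)) (l : List Bool) :
    Runs (Prog.drain p) (r, stk i o m (l.map some ++ none :: a) b c) ((t + 2) * l.length + 2)
      (.mark, stk i o (l.foldl (fun s v => F v s) (m, b)).1 a
        (l.foldl (fun s v => F v s) (m, b)).2 c) := by
  have key : ∀ (l : List Bool) (m b : List Bool),
      Runs (.loop (fun r => r.isBit) (p ;; .pop .aux))
        (Reg.read .aux (l.map some ++ none :: a).head?,
          stk i o m (l.map some ++ none :: a).tail b c) ((t + 2) * l.length + 1)
        (.mark, stk i o (l.foldl (fun s v => F v s) (m, b)).1 a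
          (l.foldl (fun s v => F v s) (m, b)).2 c) := by
    intro l
    induction l with
    | nil => exact fun m b => (Runs.loop_false rfl).mono (by simp)
    | cons v l ih =>
      intro m b
      refine (Runs.loop_true rfl ((h v m _ b).seq Runs.pop_aux) (ih _ _)).mono ?_
      simp only [List.length_cons]
      ring_nf
      omega
  refine (Runs.pop_aux.seq (key l m b)).mono ?_
  omega

theorem restore (l : List Bool) :
    Runs Prog.restore (r, stk i o m (l.reverse.map some ++ none :: a) b c) (3 * l.length + 2)
      (.mark, stk i o (l ++ m) a b c) := by
  have h := Runs.drain (r := r) (i := i) (o := o) (m := m) (b := b) (c := c) (a := a)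
    (p := .push .main fun r => r.toBit) (t := 1) (fun v s => (v :: s.1, s.2))
    (fun v m a b => Runs.push_main) l.reverse
  have key : ∀ (l m b : List Bool),
      l.foldl (fun (s : List Bool × List Bool) v => (v :: s.1, s.2)) (m, b) = (l.reverse ++ m, b) := by
    intro l
    induction l with
    | nil => simp
    | cons v l ih => simp [ih]
  rw [key] at h
  simpa [Prog.restore] using h

theorem drop :
    Runs Prog.drop (r, stk i o (x.code ++ m) a b []) (8 * x.size + 5)
      (.mark, stk i o m a b []) := by
  have h := Runs.drain (r := .empty) (i := i) (o := o) (m := m) (b := b) (c := []) (a := a)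
    (p := .skip) (t := 1) (fun v s => s) (fun v m a b => Runs.skip) x.code.reverse
  simp only [List.foldl_const] at h
  have : ∀ (n : ℕ) (s : List Bool × List Bool), (fun s => s)^[n] s = s :=
    fun n s => congrFun (Function.iterate_id n) s
  rw [this] at h
  refine (Runs.moveVal.seq h).mono ?_
  simp
  omega

theorem refill :
    Runs Prog.refill (r, stk i o m a b c) (3 * b.length + 3)
      (.empty, stk i o m (b.reverse.map some ++ none :: a) [] c) := by
  have key : ∀ (b : List Bool) (a : List (Option Bool)),
      Runs (.loop (fun r => r.isBit) (.push .aux (fun r => some r.toBit) ;; .pop .buf))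
        (Reg.read .buf b.head?, stk i o m a b.tail c) (3 * b.length + 1)
        (.empty, stk i o m (b.reverse.map some ++ a) [] c) := by
    intro b
    induction b with
    | nil => exact fun a => (Runs.loop_false rfl).mono (by simp)
    | cons v b ih =>
      intro a
      have h := ih (some v :: a)
      rw [show b.reverse.map some ++ some v :: a = (v :: b).reverse.map some ++ a by simp] at h
      refine (Runs.loop_true rfl (Runs.push_aux.seq Runs.pop_buf) h).mono ?_
      simp only [List.length_cons]
      omega
  refine (Runs.push_aux.seq (Runs.pop_buf.seq (key b _))).mono ?_
  omega

theorem save :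
    Runs Prog.save (r, stk i o (x.code ++ m) a [] []) (12 * x.size + 8)
      (.empty, stk i o (x.code ++ m) (x.code.reverse.map some ++ none :: a) [] []) := by
  have h := Runs.drain (r := .empty) (i := i) (o := o) (m := m) (b := []) (c := []) (a := a)
    (p := .push .main (fun r => r.toBit) ;; .push .buf (fun r => r.toBit)) (t := 2)
    (fun v s => (v :: s.1, v :: s.2)) (fun v m a b => Runs.push_main.seq Runs.push_buf)
    x.code.reverse
  have key : ∀ (l m b : List Bool),
      l.foldl (fun (s : List Bool × List Bool) v => (v :: s.1, v :: s.2)) (m, b) =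
        (l.reverse ++ m, l.reverse ++ b) := by
    intro l
    induction l with
    | nil => simp
    | cons v l ih => simp [ih]
  rw [key] at h
  simp only [List.reverse_reverse, List.append_nil] at h
  refine (Runs.moveVal.seq (h.seq Runs.refill)).mono ?_
  simp
  omega

end Runs

/-! ### Compilation of the combinators to stack programs. -/

namespace Code

/-- The program that replaces the topmost tree on the main stack by its image. -/
def prog : Code → Prog
  | id => .skip
  | nil => .drop ;; .push .main fun _ => false
  | fst => .pop .main ;; .ite (fun r => r.toBit) (.moveVal ;; .drop ;; .restore)
      (.push .main fun _ => false)
  | snd => .pop .main ;; .ite (fun r => r.toBit) .drop (.push .main fun _ => false)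
  | pair f g => .save ;; g.prog ;; .restore ;; f.prog ;; .push .main fun _ => true
  | comp f g => g.prog ;; f.prog
  | ite c f g => .save ;; c.prog ;; .pop .main ;;
      .ite (fun r => r.toBit) (.drop ;; .drop ;; .restore ;; g.prog) (.restore ;; f.prog)
  | iter f => .pop .main ;; .ite (fun r => r.toBit)
      (.pop .main ;; .loop (fun r => r.toBit)
        (.drop ;; .moveVal ;; f.prog ;; .restore ;; .pop .main))
      (.push .main fun _ => false)

/-- Everything below the topmost tree of `main`, and all of `aux`, is left untouched, so `aux` can
serve as a call stack for saved arguments. The buffer and the counter are empty between subprograms.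
-/
theorem runs_prog (c : Code) : ∀ (x : Tree) {r i o m a}, ∃ r',
    Runs c.prog (r, stk i o (x.code ++ m) a [] []) (c.time x)
      (r', stk i o ((c.eval x).code ++ m) a [] []) := by
  induction c with
  | id => exact fun x r i o m a => ⟨r, Runs.skip.mono x.size_pos⟩
  | nil =>
    intro x r i o m a
    refine ⟨_, (Runs.drop.seq Runs.push_main).mono ?_⟩
    have := x.size_pos
    simp only [time]
    omega
  | fst =>
    intro x r i o m a
    cases x with
    | nil =>
      exact ⟨_, (Runs.pop_main.seq (.ite_false rfl Runs.push_main)).mono (by simp [time, Tree.size])⟩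
    | cons x y =>
      rw [Tree.code_cons_append]
      refine ⟨_, (Runs.pop_main.seq (.ite_true rfl (Runs.moveVal.seq (Runs.drop.seq
        (Runs.restore _))))).mono ?_⟩
      simp only [time, Tree.size, Tree.length_code]
      omega
  | snd =>
    intro x r i o m a
    cases x with
    | nil =>
      exact ⟨_, (Runs.pop_main.seq (.ite_false rfl Runs.push_main)).mono (by simp [time, Tree.size])⟩
    | cons x y =>
      rw [Tree.code_cons_append]
      refine ⟨_, (Runs.pop_main.seq (.ite_true rfl Runs.drop)).mono ?_⟩
      simp only [time, Tree.size]
      omega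
  | pair f g ihf ihg =>
    intro x r i o m a
    obtain ⟨r₁, h₁⟩ := ihg x (r := .empty) (i := i) (o := o) (m := m)
      (a := x.code.reverse.map some ++ none :: a)
    obtain ⟨r₂, h₂⟩ := ihf x (r := .mark) (i := i) (o := o) (m := (g.eval x).code ++ m) (a := a)
    refine ⟨r₂, ?_⟩
    have := x.size_pos
    have h := (Runs.save (r := r).seq (h₁.seq ((Runs.restore _).seq
      (h₂.seq (Runs.push_main (f := fun _ => true))))))
    rw [eval, Tree.code_cons_append]
    exact h.mono (by simp only [time, Tree.length_code]; omega)
  | comp f g ihf ihg =>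
    intro x r i o m a
    obtain ⟨r₁, h₁⟩ := ihg x (r := r) (i := i) (o := o) (m := m) (a := a)
    obtain ⟨r₂, h₂⟩ := ihf (g.eval x) (r := r₁) (i := i) (o := o) (m := m) (a := a)
    exact ⟨r₂, (h₁.seq h₂).mono (by simp only [time]; omega)⟩
  | ite c f g ihc ihf ihg =>
    intro x r i o m a
    have hx := x.size_pos
    obtain ⟨r₁, h₁⟩ := ihc x (r := .empty) (i := i) (o := o) (m := m)
      (a := x.code.reverse.map some ++ none :: a)
    by_cases hc : c.eval x = .nil
    · obtain ⟨r₂, h₂⟩ := ihf x (r := .mark) (i := i) (o := o) (m := m) (a := a)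
      refine ⟨r₂, ?_⟩
      simp only [eval, hc, if_true]
      simp only [hc] at h₁
      refine (Runs.save.seq (h₁.seq (Runs.pop_main.seq
        (.ite_false rfl ((Runs.restore _).seq h₂))))).mono ?_
      simp only [time, hc, if_true, Tree.length_code]
      omega
    · obtain ⟨u, v, huv⟩ : ∃ u v, c.eval x = .cons u v := by
        cases h : c.eval x with
        | nil => exact absurd h hc
        | cons u v => exact ⟨u, v, rfl⟩
      obtain ⟨r₂, h₂⟩ := ihg x (r := .mark) (i := i) (o := o) (m := m) (a := a)
      refine ⟨r₂, ?_⟩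
      simp only [eval, hc, if_false]
      simp only [huv] at h₁
      rw [Tree.code_cons_append] at h₁
      refine (Runs.save.seq (h₁.seq (Runs.pop_main.seq (.ite_true rfl
        (Runs.drop.seq (Runs.drop.seq ((Runs.restore _).seq h₂))))))).mono ?_
      simp only [time, huv, Tree.size, Tree.length_code, reduceCtorEq, if_false]
      omega
  | iter f ih =>
    intro x r i o m a
    cases x with
    | nil =>
      exact ⟨_, (Runs.pop_main.seq (.ite_false rfl Runs.push_main)).mono (by simp [time])⟩
    | cons n x =>
      -- The loop is entered with the first bit of the counter list in the register: `true` means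
      -- that the list is nonempty. Its head is dropped and its tail is parked on `aux` while `f`
      -- runs.
      have key : ∀ (n x : Tree), ∃ r', Runs (.loop (fun r => r.toBit)
          (.drop ;; .moveVal ;; f.prog ;; .restore ;; .pop .main))
          (Reg.read .main (n.code ++ (x.code ++ m)).head?,
            stk i o (n.code ++ (x.code ++ m)).tail a [] []) (Tree.iterateTime f.eval f.time n x)
          (r', stk i o ((Tree.iterate f.eval n x).code ++ m) a [] []) := by
        intro n
        induction n with
        | nil => exact fun x => ⟨_, (Runs.loop_false rfl).mono x.size_pos⟩
        | cons h n _ ihn =>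
          intro x
          obtain ⟨r₁, h₁⟩ := ih x (r := .empty) (i := i) (o := o) (m := m)
            (a := n.code.reverse.map some ++ none :: a)
          obtain ⟨r₂, h₂⟩ := ihn (f.eval x)
          rw [Tree.code_cons_append]
          refine ⟨r₂, (Runs.loop_true rfl (Runs.drop.seq (Runs.moveVal.seq
            (h₁.seq ((Runs.restore _).seq Runs.pop_main)))) h₂).mono ?_⟩
          simp only [Tree.iterateTime, Tree.size, Tree.length_code]
          omega
      obtain ⟨r', h⟩ := key n x
      rw [Tree.code_cons_append]
      refine ⟨r', (Runs.pop_main.seq (.ite_true rfl (Runs.pop_main.seq h))).mono ?_⟩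
      simp only [time]
      omega

end Code

end PolyTime

/-! ### Functions computable in polynomial time -/

namespace PolyTime

open Polynomial

/-- An encoding by binary trees. -/
class Enc (α : Type) where
  enc : α → Tree

open Enc

/-- The size of the encoding. -/
def esize {α : Type} [Enc α] (a : α) : ℕ := (enc a).size

/-- A function that some combinator computes in polynomial time. -/
def PT {α β : Type} [Enc α] [Enc β] (f : α → β) : Prop :=
  ∃ (c : Code) (p : ℕ[X]), ∀ a, c.eval (enc a) = enc (f a) ∧ c.time (enc a) ≤ p.eval (esize a)

theorem eval_mono (p : ℕ[X]) {m n : ℕ} (h : m ≤ n) : p.eval m ≤ p.eval n := by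
  rw [Polynomial.eval_eq_sum, Polynomial.eval_eq_sum]
  exact Finset.sum_le_sum fun i _ => Nat.mul_le_mul_left _ (Nat.pow_le_pow_left h i)

section Instances

variable {α β : Type} [Enc α] [Enc β]

instance : Enc Unit := ⟨fun _ => .nil⟩

instance : Enc Bool := ⟨fun b => if b then .cons .nil .nil else .nil⟩

instance : Enc (α × β) := ⟨fun x => .cons (enc x.1) (enc x.2)⟩

/-- The encoding of a list. -/
def encList : List α → Tree
  | [] => .nil
  | a :: l => .cons (enc a) (encList l)

instance : Enc (List α) := ⟨encList⟩

/-- Pairing each digit with its complement makes every digit cost six nodes, so the size depends on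
the number of digits only and is monotone in the number. -/
instance : Enc ℕ := ⟨fun n => enc (n.bits.map fun b => (b, !b))⟩

instance : Enc ℤ := ⟨fun z => enc (z.toNat, (-z).toNat)⟩

instance : Enc InputSymbol where
  enc
    | .bit false => .nil
    | .bit true => .cons .nil .nil
    | .minus => .cons .nil (.cons .nil .nil)
    | .comma => .cons .nil (.cons .nil (.cons .nil .nil))
    | .semicolon => .cons .nil (.cons .nil (.cons .nil (.cons .nil .nil)))
    | .bar => .cons .nil (.cons .nil (.cons .nil (.cons .nil (.cons .nil .nil))))

theorem enc_false : enc false = Tree.nil := rfl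
theorem enc_true : enc true = Tree.cons .nil .nil := rfl
theorem enc_mk (a : α) (b : β) : enc (a, b) = .cons (enc a) (enc b) := rfl
theorem enc_nil : enc ([] : List α) = .nil := rfl
theorem enc_cons (a : α) (l : List α) : enc (a :: l) = .cons (enc a) (enc l) := rfl
theorem enc_nat (n : ℕ) : enc n = enc (n.bits.map fun b => (b, !b)) := rfl
theorem enc_int (z : ℤ) : enc z = enc (z.toNat, (-z).toNat) := rfl

theorem esize_pos (a : α) : 0 < esize a := Tree.size_pos _
theorem esize_false : esize false = 1 := rfl
theorem esize_true : esize true = 3 := rfl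
theorem esize_mk (a : α) (b : β) : esize (a, b) = esize a + esize b + 1 := rfl
theorem esize_prod (x : α × β) : esize x = esize x.1 + esize x.2 + 1 := rfl
theorem esize_nil : esize ([] : List α) = 1 := rfl
theorem esize_cons (a : α) (l : List α) : esize (a :: l) = esize a + esize l + 1 := rfl

end Instances

/-! ### Input and output of the machine. -/

namespace Prog

/-- Push the symbols of a list onto the buffer. -/
def putList : List Bool → Prog
  | [] => skip
  | v :: l => push .buf (fun _ => v) ;; putList l

/-- Push the code of the symbol in the register onto the buffer. -/
def putSym : List InputSymbol → Prog
  | [] => skip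
  | s :: l => ite (fun r => decide (r = .sym s)) (putList (true :: (enc s).code)) (putSym l)

/-- Turn the input into a tree. -/
def loadInput : Prog :=
  (pop .inp ;; loop (fun r => decide (r ≠ .empty))
    (putSym [.bit false, .bit true, .minus, .comma, .semicolon, .bar] ;; pop .inp)) ;;
  push .buf (fun _ => false) ;; pop .buf ;;
  loop (fun r => r.isBit) (push .main (fun r => r.toBit) ;; pop .buf)

/-- Turn a tree that encodes a truth value into the output. -/
def storeOutput : Prog :=
  pop .main ;; push .out (fun r => r.toBit) ;; ite (fun r => r.toBit) (pop .main ;; pop .main) skip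

end Prog

theorem length_code_sym_le (s : InputSymbol) : (enc s).code.length ≤ 11 := by
  rcases s with (_ | _) | _ | _ | _ | _ <;> decide

theorem esize_symbols_le (l : List InputSymbol) : esize l ≤ 12 * l.length + 1 := by
  induction l with
  | nil => exact le_rfl
  | cons s l ih =>
    have := length_code_sym_le s
    rw [Tree.length_code] at this
    rw [esize_cons, esize, List.length_cons]
    omega

namespace Runs

variable {r : Reg} {i : List InputSymbol} {o m b : List Bool} {a : List (Option Bool)}
  {c : List Unit}

theorem putList (l : List Bool) :
    Runs (Prog.putList l) (r, stk i o m a b c) (l.length + 1)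
      (r, stk i o m a (l.reverse ++ b) c) := by
  induction l generalizing b with
  | nil => exact Runs.skip.mono (by simp)
  | cons v l ih =>
    refine (Runs.push_buf.seq ?_).mono (t := 1 + (l.length + 1)) (by simp; omega)
    simpa using ih (b := v :: b)

theorem putSym {s : InputSymbol} {l : List InputSymbol} (hs : s ∈ l) :
    Runs (Prog.putSym l) (.sym s, stk i o m a b c) (l.length + 13)
      (.sym s, stk i o m a ((true :: (enc s).code).reverse ++ b) c) := by
  induction l with
  | nil => simp at hs
  | cons u l ih =>
    by_cases h : s = u
    · subst h
      refine (Runs.ite_true (by simp) (Runs.putList _)).mono ?_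
      have := length_code_sym_le s
      simp only [List.length_cons]
      omega
    · refine (Runs.ite_false (by simpa using h) (ih ?_)).mono ?_
      · simpa [h] using hs
      · simp only [List.length_cons]
        omega

/-- The code of a list consists of `true` followed by the code of the entry, for each entry, and a
final `false`. It can therefore be written symbol by symbol; the buffer reverses it once and the
transfer to `main` reverses it back. -/
theorem loadInput (l : List InputSymbol) :
    Runs Prog.loadInput (r, stk l [] [] [] [] []) (60 * l.length + 20)
      (.empty, stk [] [] (enc l).code [] [] []) := by
  have key : ∀ (l : List InputSymbol) (b : List Bool), ∃ b',
      b'.reverse ++ [false] = b.reverse ++ (enc l).code ∧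
      Runs (.loop (fun r => decide (r ≠ .empty))
        (Prog.putSym [.bit false, .bit true, .minus, .comma, .semicolon, .bar] ;; .pop .inp))
        (Reg.read .inp l.head?, stk l.tail [] [] [] b []) (21 * l.length + 1)
        (.empty, stk [] [] [] [] b' []) := by
    intro l
    induction l with
    | nil => exact fun b => ⟨b, rfl, Runs.loop_false rfl⟩
    | cons s l ih =>
      intro b
      obtain ⟨b', hb', h⟩ := ih ((true :: (enc s).code).reverse ++ b)
      refine ⟨b', ?_, (Runs.loop_true rfl ((Runs.putSym ?_).seq Runs.pop_inp) h).mono ?_⟩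
      · rw [hb', enc_cons, Tree.code]
        simp
      · rcases s with (_ | _) | _ | _ | _ | _ <;> simp
      · simp only [List.length_cons, List.length_nil]
        omega
  have key' : ∀ (b m : List Bool),
      Runs (.loop (fun r => r.isBit) (.push .main (fun r => r.toBit) ;; .pop .buf))
        (Reg.read .buf b.head?, stk [] [] m [] b.tail []) (3 * b.length + 1)
        (.empty, stk [] [] (b.reverse ++ m) [] [] []) := by
    intro b
    induction b with
    | nil => exact fun m => Runs.loop_false rfl
    | cons v b ih =>
      intro m
      have h := ih (v :: m)
      rw [show b.reverse ++ v :: m = (v :: b).reverse ++ m by simp] at h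
      refine (Runs.loop_true rfl (Runs.push_main.seq Runs.pop_buf) h).mono ?_
      simp only [List.length_cons]
      omega
  obtain ⟨b', hb', h⟩ := key l []
  have h' := key' (false :: b') []
  have e : (false :: b').reverse ++ [] = (enc l).code := by simpa using hb'
  have hlen : b'.length + 1 = esize l := by
    rw [esize, ← Tree.length_code, ← e]
    simp
  have := esize_symbols_le l
  rw [e] at h'
  refine ((Runs.pop_inp.seq h).seq (Runs.push_buf.seq (Runs.pop_buf.seq h'))).mono ?_
  simp only [List.length_cons]
  omega

theorem storeOutput (v : Bool) : ∃ r',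
    Runs Prog.storeOutput (r, stk [] [] (enc v).code [] [] []) 6
      (r', stk [] [v] [] [] [] []) := by
  cases v
  · exact ⟨_, (Runs.pop_main.seq (Runs.push_out.seq (.ite_false rfl Runs.skip))).mono (by simp)⟩
  · exact ⟨_, (Runs.pop_main.seq (Runs.push_out.seq (.ite_true rfl
      (Runs.pop_main.seq Runs.pop_main)))).mono (by simp)⟩

end Runs

/-- The machine that executes a program. -/
def Prog.machine (p : Prog) : Turing.FinTM2 where
  K := Stk
  k₀ := .inp
  k₁ := .out
  Γ := Stk.Sym
  Λ := Option p.Lbl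
  main := some p.entry
  ΛFin := inferInstance
  σ := Reg
  initialState := .empty
  σFin := inferInstance
  Γk₀Fin := inferInstanceAs (Fintype InputSymbol)
  m
    | none => .load (fun _ => .empty) .halt
    | some l => p.compile some none l

/-- A truth value that is computable in polynomial time on trees is so on Turing machines. -/
theorem PT.tm2ComputableInPolyTime {α : Type} [Enc α] {e : α → List InputSymbol}
    (he : ∀ a, enc a = enc (e a)) {f : α → Bool} (hf : PT f) :
    Nonempty (Turing.TM2ComputableInPolyTime e Computability.encodeBool f) := by
  obtain ⟨c, p, hc⟩ := hf
  let P : Prog := .loadInput ;; c.prog ;; .storeOutput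
  -- Loading takes `60 * length + 20` steps, the output 6 and halting 1. The tree of a word has at
  -- most `12 * length + 1` nodes, whence the argument of `p`.
  have key : ∀ a, ∃ s ≤ (60 * X + 27 + p.comp (12 * X + 1)).eval (e a).length,
      (flip bind (Turing.TM2.step P.machine.m))^[s] (some (Turing.initList P.machine (e a))) =
        some (Turing.haltList P.machine [f a]) := by
    intro a
    obtain ⟨h₁, h₂⟩ := hc a
    obtain ⟨r₁, hr₁⟩ := c.runs_prog (enc a) (r := .empty) (i := []) (o := []) (m := []) (a := [])
    rw [List.append_nil, List.append_nil, h₁] at hr₁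
    obtain ⟨r₂, hr₂⟩ := Runs.storeOutput (r := r₁) (f a)
    have h := Runs.loadInput (r := .empty) (e a)
    rw [← he] at h
    have hP : Runs P _ _ _ := h.seq (hr₁.seq hr₂)
    have h := (hP.reachesIn P.machine.m some none fun l => rfl).trans
      (ReachesIn.single (b := ⟨none, .empty, stk [] [f a] [] [] [] []⟩) rfl)
    have e₁ : Turing.initList P.machine (e a) =
        cfg (some P.entry) (.empty, stk (e a) [] [] [] [] []) := by
      refine congrArg (Turing.TM2.Cfg.mk (some (some P.entry)) Reg.empty) (funext fun k => ?_)
      cases k <;> rfl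
    have e₂ : Turing.haltList P.machine [f a] = ⟨none, .empty, stk [] [f a] [] [] [] []⟩ := by
      refine congrArg (Turing.TM2.Cfg.mk none Reg.empty) (funext fun k => ?_)
      cases k <;> rfl
    obtain ⟨s, hs, h⟩ := h
    refine ⟨s, hs.trans ?_, ?_⟩
    · have hsize : esize a ≤ 12 * (e a).length + 1 := by
        rw [esize, he]
        exact esize_symbols_le _
      have := h₂.trans (eval_mono p hsize)
      simp only [eval_add, eval_mul, eval_ofNat, eval_X, eval_comp, eval_one]
      omega
    · rw [e₁, e₂]
      exact h
  choose s hs h using key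
  exact ⟨{
    tm := P.machine
    inputAlphabet := Equiv.refl InputSymbol
    outputAlphabet := Equiv.refl Bool
    time := 60 * X + 27 + p.comp (12 * X + 1)
    outputsFun := fun a => {
      steps := s a
      evals_in_steps := (congrArg (fun l : List InputSymbol =>
        (flip bind (Turing.TM2.step P.machine.m))^[s a] (some (Turing.initList P.machine l)))
          (List.map_id (e a))).trans (h a)
      steps_le_m := hs a } }⟩

end PolyTime

namespace PolyTime

open Polynomial
open Enc

attribute [fun_prop] PT

namespace Code

/-- The constant functions. -/
def const : Tree → Code
  | .nil => nil
  | .cons a b => pair (const a) (const b)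

theorem eval_const (t x : Tree) : (const t).eval x = t := by
  induction t with
  | nil => rfl
  | cons a b iha ihb => simp [const, eval, iha, ihb]

theorem time_const (t x : Tree) : (const t).time x ≤ 40 * t.size * x.size := by
  induction t with
  | nil => simp only [const, time, Tree.size]; omega
  | cons a b iha ihb =>
    simp only [const, time, Tree.size]
    nlinarith

end Code

/-! ### Closure properties of polynomial-time functions. -/

section Basic

variable {α β γ σ : Type} [Enc α] [Enc β] [Enc γ] [Enc σ]

theorem PT.esize_le {f : α → β} (hf : PT f) : ∃ p : ℕ[X], ∀ a, esize (f a) ≤ p.eval (esize a) := by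
  obtain ⟨c, p, h⟩ := hf
  refine ⟨p, fun a => ?_⟩
  rw [esize, ← (h a).1]
  exact (c.size_eval_le _).trans (h a).2

theorem PT.of_eq {f g : α → β} (hf : PT f) (h : ∀ a, g a = f a) : PT g := by
  rwa [show g = f from funext h]

theorem PT.of_enc_eq {f : α → β} {g : α → γ} (hf : PT f) (h : ∀ a, enc (g a) = enc (f a)) :
    PT g := by
  obtain ⟨c, p, hc⟩ := hf
  exact ⟨c, p, fun a => by rw [h]; exact hc a⟩

@[fun_prop]
theorem PT.id : PT (fun a : α => a) :=
  ⟨.id, X, fun a => ⟨rfl, by rw [eval_X]; exact le_rfl⟩⟩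

@[fun_prop]
theorem PT.const (b : β) : PT (fun _ : α => b) := by
  refine ⟨.const (enc b), (40 * (enc b).size : ℕ[X]) * X, fun a => ⟨Code.eval_const _ _, ?_⟩⟩
  simpa [esize] using Code.time_const (enc b) (enc a)

@[fun_prop]
theorem PT.comp {f : β → γ} {g : α → β} (hf : PT f) (hg : PT g) : PT (fun a => f (g a)) := by
  obtain ⟨q, hq⟩ := hg.esize_le
  obtain ⟨c, p, hc⟩ := hf
  obtain ⟨d, r, hd⟩ := hg
  refine ⟨.comp c d, p.comp q + r, fun a => ⟨?_, ?_⟩⟩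
  · rw [Code.eval, (hd a).1, (hc _).1]
  · rw [Code.time, (hd a).1, eval_add, eval_comp]
    exact Nat.add_le_add ((hc _).2.trans (eval_mono p (hq a))) (hd a).2

theorem PT.of_enc_eq_id {g : α → β} (h : ∀ a, enc (g a) = enc a) : PT g := PT.of_enc_eq PT.id h

@[fun_prop]
theorem PT.prodMk {f : α → β} {g : α → γ} (hf : PT f) (hg : PT g) : PT (fun a => (f a, g a)) := by
  obtain ⟨c, p, hc⟩ := hf
  obtain ⟨d, q, hd⟩ := hg
  refine ⟨.pair c d, 26 * X + p + q, fun a => ⟨?_, ?_⟩⟩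
  · rw [Code.eval, (hc a).1, (hd a).1]; rfl
  · simp only [Code.time, eval_add, eval_mul, eval_ofNat, eval_X]
    exact Nat.add_le_add (Nat.add_le_add le_rfl (hc a).2) (hd a).2

@[fun_prop]
theorem PT.fst {f : α → β × γ} (hf : PT f) : PT (fun a => (f a).1) :=
  PT.comp (f := Prod.fst) ⟨.fst, 20 * X, fun a => ⟨rfl, by simp [Code.time, esize]⟩⟩ hf

@[fun_prop]
theorem PT.snd {f : α → β × γ} (hf : PT f) : PT (fun a => (f a).2) :=
  PT.comp (f := Prod.snd) ⟨.snd, 20 * X, fun a => ⟨rfl, by simp [Code.time, esize]⟩⟩ hf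

theorem PT.cond {c : α → Bool} {f g : α → β} (hc : PT c) (hf : PT f) (hg : PT g) :
    PT (fun a => if c a = true then f a else g a) := by
  obtain ⟨q, hq⟩ := hc.esize_le
  obtain ⟨c', p, hc⟩ := hc
  obtain ⟨d, r, hd⟩ := hf
  obtain ⟨e, s, he⟩ := hg
  refine ⟨.ite c' e d, 30 * X + p + 18 * q + (r + s), fun a => ⟨?_, ?_⟩⟩
  · rw [Code.eval, (hc a).1, (hd a).1, (he a).1]
    dsimp only
    by_cases h : c a = true
    · rw [if_pos h, h, enc_true, if_neg (by simp)]
    · rw [if_neg h, Bool.eq_false_iff.2 h, enc_false, if_pos rfl]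
  · have h1 := hq a
    have h2 := (hc a).2
    have h3 := (hd a).2
    have h4 := (he a).2
    simp only [Code.time, eval_add, eval_mul, eval_ofNat, eval_X, (hc a).1]
    simp only [esize] at *
    split_ifs <;> omega

@[fun_prop]
theorem PT.ite {P : α → Prop} [DecidablePred P] {f g : α → β} (hc : PT fun a => decide (P a))
    (hf : PT f) (hg : PT g) : PT (fun a => if P a then f a else g a) :=
  (hc.cond hf hg).of_eq fun a => by simp

@[fun_prop]
theorem PT.and {c d : α → Bool} (hc : PT c) (hd : PT d) : PT fun a => c a && d a :=
  (hc.cond hd (PT.const false)).of_eq fun a => by cases c a <;> simp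

@[fun_prop]
theorem PT.or {c d : α → Bool} (hc : PT c) (hd : PT d) : PT fun a => c a || d a :=
  (hc.cond (PT.const true) hd).of_eq fun a => by cases c a <;> simp

@[fun_prop]
theorem PT.not {c : α → Bool} (hc : PT c) : PT fun a => !c a :=
  (hc.cond (PT.const false) (PT.const true)).of_eq fun a => by cases c a <;> simp

@[fun_prop]
theorem PT.xor {c d : α → Bool} (hc : PT c) (hd : PT d) : PT fun a => Bool.xor (c a) (d a) :=
  (hc.cond hd.not hd).of_eq fun a => by cases c a <;> simp

@[fun_prop]
theorem PT.listCons {f : α → β} {l : α → List β} (hf : PT f) (hl : PT l) :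
    PT fun a => f a :: l a :=
  PT.of_enc_eq (PT.prodMk hf hl) fun _ => rfl

@[fun_prop]
theorem PT.tail {l : α → List β} (hl : PT l) : PT fun a => (l a).tail := by
  refine PT.comp (f := List.tail) ⟨.snd, 20 * X, fun l => ⟨?_, by simp [Code.time, esize]⟩⟩ hl
  cases l <;> rfl

@[fun_prop]
theorem PT.isEmpty {l : α → List β} (hl : PT l) : PT fun a => (l a).isEmpty := by
  refine PT.comp (f := List.isEmpty) (β := List β) ?_ hl
  refine ⟨.ite .id (.const (enc true)) .nil, 250 * X, fun l => ⟨?_, ?_⟩⟩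
  · rw [Code.eval, Code.eval_const]
    cases l <;> rfl
  · have h := Code.time_const (enc true) (enc l)
    simp only [Code.time, Code.eval, eval_mul, eval_ofNat, eval_X, esize]
    simp only [enc_true, Tree.size] at h ⊢
    have h' : ∀ (P : Prop) [Decidable P] (m n : ℕ), (if P then m else n) ≤ m + n := by
      intro P _ m n
      split_ifs <;> omega
    refine (Nat.add_le_add_left (h' _ _ _) _).trans ?_
    omega

@[fun_prop]
theorem PT.headD {l : α → List β} {d : α → β} (hl : PT l) (hd : PT d) :
    PT fun a => (l a).headD (d a) := by
  have h : PT (fun x : List β × β => x.1.headD x.2) := by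
    refine ⟨.ite .fst .snd (.comp .fst .fst), 1000 * X, fun x => ⟨?_, ?_⟩⟩
    · rcases x with ⟨_ | ⟨a, l⟩, d⟩ <;> rfl
    · rcases x with ⟨l, d⟩
      simp only [Code.time, Code.eval, eval_mul, eval_ofNat, eval_X, esize]
      have := (enc d).size_pos
      simp only [enc_mk, Tree.size, Tree.fst]
      split_ifs <;> omega
  exact PT.comp (f := fun x : List β × β => x.1.headD x.2) h (PT.prodMk hl hd)

theorem length_lt_esize (l : List α) : l.length < esize l := by
  induction l with
  | nil => simp [esize_nil]
  | cons a l ih =>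
    rw [List.length_cons, esize_cons]
    omega

theorem esize_le_of_mem {a : α} {l : List α} (h : a ∈ l) : esize a ≤ esize l := by
  induction l with
  | nil => simp at h
  | cons b l ih =>
    rw [esize_cons]
    rcases List.mem_cons.1 h with rfl | h
    · omega
    · have := ih h
      omega

theorem esize_append (l₁ l₂ : List α) : esize (l₁ ++ l₂) + 1 = esize l₁ + esize l₂ := by
  induction l₁ with
  | nil => rw [esize_nil, List.nil_append]; omega
  | cons a l ih =>
    rw [List.cons_append, esize_cons, esize_cons]
    omega

theorem esize_le_of_prefix {l₁ l₂ : List α} (h : l₁ <+: l₂) : esize l₁ ≤ esize l₂ := by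
  obtain ⟨l, rfl⟩ := h
  have := esize_append l₁ l
  have := esize_pos l
  omega

/-- Folding over a list takes polynomial time if the intermediate results have polynomial size. -/
theorem PT.foldl {l : γ → List α} {init : γ → σ} {step : γ → σ → α → σ}
    (hs : PT fun p : γ × σ × α => step p.1 p.2.1 p.2.2) (hi : PT init) (hl : PT l)
    (hb : ∃ q : ℕ[X], ∀ c l', l' <+: l c → esize (l'.foldl (step c) (init c)) ≤ q.eval (esize c)) :
    PT fun c => (l c).foldl (step c) (init c) := by
  obtain ⟨q, hq⟩ := hb
  obtain ⟨pl, hpl⟩ := hl.esize_le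
  obtain ⟨cs, ps, hcs⟩ := hs
  obtain ⟨ci, pi, hci⟩ := hi
  obtain ⟨cl, ql, hcl⟩ := hl
  -- The iterated state is the remaining list together with `c` and `s`. A second copy of the list
  -- serves as the iteration counter.
  let body : Code := .pair (.comp .snd .fst) (.pair (.comp .fst .snd)
    (.comp cs (.pair (.comp .fst .snd) (.pair (.comp .snd .snd) (.comp .fst .fst)))))
  have hbody : ∀ (c : γ) (s : σ) (a : α) (l : List α),
      body.eval (.cons (enc (a :: l)) (.cons (enc c) (enc s))) =
        .cons (enc l) (.cons (enc c) (enc (step c s a))) := by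
    intro c s a l
    simp only [body, Code.eval, Tree.fst, Tree.snd, enc_cons]
    rw [← enc_mk s a, ← enc_mk c (s, a), (hcs _).1]
  have htime : ∀ (c : γ) (s : σ) (a : α) (l : List α),
      body.time (.cons (enc (a :: l)) (.cons (enc c) (enc s))) ≤
        1000 * (esize (a :: l) + esize c + esize s) +
          ps.eval (esize (a :: l) + esize c + esize s) := by
    intro c s a l
    simp only [body, Code.eval, Code.time, Tree.fst, Tree.snd, enc_cons]
    rw [← enc_mk s a, ← enc_mk c (s, a)]
    have h := (hcs (c, s, a)).2.trans (eval_mono ps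
      (n := esize (a :: l) + esize c + esize s) ?_)
    · have := esize_pos l
      simp only [esize, enc_cons, Tree.size] at *
      omega
    · have := esize_pos l
      simp only [esize_mk, esize_cons]
      omega
  have heval : ∀ (c : γ) (l : List α) (s : σ),
      Tree.iterate body.eval (enc l) (.cons (enc l) (.cons (enc c) (enc s))) =
        .cons .nil (.cons (enc c) (enc (l.foldl (step c) s))) := by
    intro c l
    induction l with
    | nil => intro s; rfl
    | cons a l ih =>
      intro s
      rw [enc_cons, Tree.iterate, ← enc_cons, hbody, ih, List.foldl_cons]
  have hit : ∀ (c : γ) (B : ℕ) (l : List α) (s : σ), (∀ l', l' <+: l →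
      esize (l'.foldl (step c) s) ≤ B) →
      Tree.iterateTime body.eval body.time (enc l) (.cons (enc l) (.cons (enc c) (enc s))) ≤
        (l.length + 1) * (1020 * (esize l + esize c + B) + ps.eval (esize l + esize c + B)) := by
    intro c B l
    induction l with
    | nil =>
      intro s h
      have := h [] (List.prefix_refl _)
      simp only [List.foldl_nil, esize] at this
      simp only [enc_nil, Tree.iterateTime, Tree.size, esize, List.length_nil]
      omega
    | cons a l ih =>
      intro s h
      have hB := h [] (List.nil_prefix)
      rw [List.foldl_nil] at hB
      have h1 := ih (step c s a) fun l' hl' => by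
        simpa using h (a :: l') (by simpa using hl')
      have h2 := htime c s a l
      have h3 := eval_mono ps (show esize (a :: l) + esize c + esize s ≤
        esize (a :: l) + esize c + B by omega)
      have h4 := eval_mono ps (show esize l + esize c + B ≤
        esize (a :: l) + esize c + B by rw [esize_cons]; omega)
      have h5 : (l.length + 1) * (1020 * (esize l + esize c + B) +
          ps.eval (esize l + esize c + B)) ≤ (l.length + 1) *
          (1020 * (esize (a :: l) + esize c + B) + ps.eval (esize (a :: l) + esize c + B)) := by
        refine Nat.mul_le_mul_left _ ?_
        have : esize l ≤ esize (a :: l) := by rw [esize_cons]; omega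
        omega
      rw [enc_cons, Tree.iterateTime, ← enc_cons, hbody, List.length_cons]
      have h6 : (enc (a :: l)).size = esize (a :: l) := rfl
      rw [add_mul, one_mul, h6]
      omega
  refine ⟨.comp (.comp .snd .snd) (.comp (.iter body) (.pair cl (.pair cl (.pair .id ci)))),
    79 * X + ql + ql + pi + 20 + 21 * (pl + 1) * (1020 * (pl + X + q) + ps.comp (pl + X + q)) +
      40 * (2 + X + q), fun c => ⟨?_, ?_⟩⟩
  · simp only [Code.eval, (hcl c).1, (hci c).1, heval]
    rfl
  · have h1 := hit c (q.eval (esize c)) (l c) (init c) (hq c)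
    have h2 := hpl c
    have h3 := eval_mono ps (show esize (l c) + esize c + q.eval (esize c) ≤
      pl.eval (esize c) + esize c + q.eval (esize c) by omega)
    have h4 := length_lt_esize (l c)
    have h5 : ((l c).length + 1) * (1020 * (esize (l c) + esize c + q.eval (esize c)) +
        ps.eval (esize (l c) + esize c + q.eval (esize c))) ≤
        (pl.eval (esize c) + 1) * (1020 * (pl.eval (esize c) + esize c + q.eval (esize c)) +
        ps.eval (pl.eval (esize c) + esize c + q.eval (esize c))) :=
      Nat.mul_le_mul (by omega) (by omega)
    have h6 := hq c (l c) (List.prefix_refl _)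
    have h7 := (hcl c).2
    have h8 := (hci c).2
    simp only [Code.time, Code.eval, (hcl c).1, (hci c).1, heval, Tree.snd, eval_add, eval_mul,
      eval_ofNat, eval_X, eval_one, eval_comp]
    simp only [Tree.size]
    simp only [esize] at *
    nlinarith

/-- Folding over a list takes polynomial time if every step adds a polynomial number of nodes. -/
theorem PT.foldl_of_le_add {l : γ → List α} {init : γ → σ} {step : γ → σ → α → σ}
    (hs : PT fun p : γ × σ × α => step p.1 p.2.1 p.2.2) (hi : PT init) (hl : PT l)
    (hb : ∃ q : ℕ[X], ∀ c s a, esize (step c s a) ≤ esize s + q.eval (esize c + esize a)) :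
    PT fun c => (l c).foldl (step c) (init c) := by
  refine PT.foldl hs hi hl ?_
  obtain ⟨q, hq⟩ := hb
  obtain ⟨pl, hpl⟩ := hl.esize_le
  obtain ⟨pi, hpi⟩ := hi.esize_le
  refine ⟨pi + pl * q.comp (X + pl), fun c l' hl' => ?_⟩
  have key : ∀ (M : ℕ) (l' : List α) (s : σ), (∀ a ∈ l', esize a ≤ M) →
      esize (l'.foldl (step c) s) ≤ esize s + l'.length * q.eval (esize c + M) := by
    intro M l'
    induction l' with
    | nil => simp
    | cons a l' ih =>
      intro s h
      have h1 := ih (step c s a) fun b hb => h b (List.mem_cons_of_mem _ hb)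
      have h2 := hq c s a
      have h3 := eval_mono q (Nat.add_le_add_left (h a List.mem_cons_self) (esize c))
      rw [List.foldl_cons, List.length_cons, add_mul, one_mul]
      omega
  have h1 := key (pl.eval (esize c)) l' (init c) fun a ha =>
    (esize_le_of_mem (hl'.subset ha)).trans (hpl c)
  have h2 := hpi c
  have h3 : l'.length ≤ pl.eval (esize c) :=
    ((length_lt_esize l').le.trans (esize_le_of_prefix hl')).trans (hpl c)
  have h4 := Nat.mul_le_mul_right (q.eval (esize c + pl.eval (esize c))) h3
  simp only [eval_add, eval_mul, eval_comp, eval_X]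
  omega

@[fun_prop]
theorem PT.reverse {l : γ → List α} (hl : PT l) : PT fun c => (l c).reverse := by
  refine (PT.foldl_of_le_add (step := fun _ s a => a :: s) (init := fun _ => []) (by fun_prop)
    (by fun_prop) hl ⟨X + 1, fun c s a => ?_⟩).of_eq fun c => ?_
  · simp only [esize_cons, eval_add, eval_X, eval_one]
    omega
  · simp

theorem PT.foldr_of_le_add {l : γ → List α} {init : γ → σ} {step : γ → α → σ → σ}
    (hs : PT fun p : γ × σ × α => step p.1 p.2.2 p.2.1) (hi : PT init) (hl : PT l)
    (hb : ∃ q : ℕ[X], ∀ c a s, esize (step c a s) ≤ esize s + q.eval (esize c + esize a)) :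
    PT fun c => (l c).foldr (step c) (init c) := by
  refine (PT.foldl_of_le_add (step := fun c s a => step c a s) hs hi hl.reverse ?_).of_eq
    fun c => ?_
  · obtain ⟨q, hq⟩ := hb
    exact ⟨q, fun c s a => hq c a s⟩
  · simp

@[fun_prop]
theorem PT.map {l : γ → List α} {f : γ → α → β} (hf : PT fun p : γ × α => f p.1 p.2) (hl : PT l) :
    PT fun c => (l c).map (f c) := by
  obtain ⟨q, hq⟩ := hf.esize_le
  refine (PT.foldr_of_le_add (step := fun c a s => f c a :: s) (init := fun _ => []) ?_
    (by fun_prop) hl ⟨q.comp (X + 1) + 1, fun c a s => ?_⟩).of_eq fun c => ?_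
  · exact PT.listCons (PT.comp (f := fun p : γ × α => f p.1 p.2)
      (g := fun p : γ × List β × α => (p.1, p.2.2)) hf (by fun_prop)) (by fun_prop)
  · have := hq (c, a)
    simp only [esize_cons, eval_add, eval_X, eval_one, eval_comp]
    simp only [esize_mk] at this
    omega
  · induction l c with
    | nil => rfl
    | cons a l ih => rw [List.map_cons, List.foldr_cons, ih]

@[fun_prop]
theorem PT.append {l₁ l₂ : γ → List α} (h₁ : PT l₁) (h₂ : PT l₂) : PT fun c => l₁ c ++ l₂ c := by
  refine (PT.foldr_of_le_add (l := l₁) (init := l₂) (step := fun _ a s => a :: s) (by fun_prop)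
    h₂ h₁ ⟨X + 1, fun c a s => ?_⟩).of_eq fun c => ?_
  · simp only [esize_cons, eval_add, eval_X, eval_one]
    omega
  · induction l₁ c with
    | nil => rfl
    | cons a l ih => rw [List.cons_append, List.foldr_cons, ih]

end Basic

end PolyTime

/-! ### Arithmetic in polynomial time -/

namespace PolyTime

open Polynomial
open Enc

section Nat

set_option linter.unusedSimpArgs false

variable {α β γ σ : Type} [Enc α] [Enc β] [Enc γ] [Enc σ]

theorem esize_nat (n : ℕ) : esize n = 6 * n.size + 1 := by
  rw [← Nat.size_eq_bits_len, esize, enc_nat]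
  induction n.bits with
  | nil => rfl
  | cons b l ih =>
    rw [List.map_cons, enc_cons, Tree.size, ih, enc_mk, Tree.size, List.length_cons]
    cases b <;> simp only [Bool.not_false, Bool.not_true, enc_true, enc_false, Tree.size] <;> omega

theorem esize_nat_le {n k : ℕ} (h : n < 2 ^ k) : esize n ≤ 6 * k + 1 := by
  have := Nat.size_le.2 h
  rw [esize_nat]
  omega

theorem esize_nat_mono {m n : ℕ} (h : m ≤ n) : esize m ≤ esize n := by
  have := Nat.size_le_size h
  rw [esize_nat, esize_nat]
  omega

theorem lt_two_pow_esize (n : ℕ) : n < 2 ^ esize n :=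
  (Nat.lt_size_self n).trans_le (Nat.pow_le_pow_right (by norm_num) (by rw [esize_nat]; omega))

theorem size_add_le (m n : ℕ) : (m + n).size ≤ m.size + n.size + 1 := by
  rw [Nat.size_le, pow_succ, pow_add]
  have h1 := Nat.lt_size_self m
  have h2 := Nat.lt_size_self n
  have h3 := Nat.one_le_two_pow (n := m.size)
  have h4 := Nat.one_le_two_pow (n := n.size)
  nlinarith

theorem esize_add_le (m n : ℕ) : esize (m + n) ≤ esize m + esize n + 6 := by
  have := size_add_le m n
  simp only [esize_nat]
  omega

theorem size_bit_le (b : Bool) (n : ℕ) : (Nat.bit b n).size ≤ n.size + 1 := by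
  rw [Nat.size_le, pow_succ]
  have := Nat.lt_size_self n
  rw [Nat.bit_val]
  cases b <;> simp <;> omega

theorem esize_bit_le (b : Bool) (n : ℕ) : esize (Nat.bit b n) ≤ esize n + 6 := by
  have := size_bit_le b n
  simp only [esize_nat]
  omega

theorem esize_bool_le (b : Bool) : esize b ≤ 3 := by
  cases b
  · rw [esize_false]; omega
  · rw [esize_true]

@[fun_prop]
theorem PT.bits {n : α → ℕ} (hn : PT n) : PT fun a => (n a).bits := by
  refine PT.comp (f := fun m : ℕ => m.bits) ?_ hn
  have h : PT (fun m : ℕ => m.bits.map fun b => (b, !b)) := PT.of_enc_eq_id fun _ => rfl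
  refine (PT.map (l := fun m : ℕ => m.bits.map fun b => (b, !b)) (f := fun _ p => p.1)
    (by fun_prop) h).of_eq fun m => ?_
  simp [Function.comp_def]

@[fun_prop]
theorem PT.natBit {b : α → Bool} {n : α → ℕ} (hb : PT b) (hn : PT n) :
    PT fun a => Nat.bit (b a) (n a) := by
  -- Putting the digit 0 before the number 0 must give the empty digit list, since `Nat.bits` has no
  -- leading zeros.
  have h : PT fun a => if (!b a && (n a).bits.isEmpty) = true then [] else
      (b a, !b a) :: (n a).bits.map fun b => (b, !b) := by
    refine PT.cond (by fun_prop) (by fun_prop) (PT.listCons (by fun_prop) ?_)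
    exact PT.comp (f := fun m : ℕ => m.bits.map fun b => (b, !b)) (PT.of_enc_eq_id fun _ => rfl) hn
  refine PT.of_enc_eq h fun a => ?_
  rw [enc_nat]
  congr 1
  cases hb : b a with
  | true => simp
  | false =>
    by_cases h0 : n a = 0
    · simp [h0]
    · rw [Nat.bits_append_bit _ _ (fun h => absurd h h0)]
      have : (n a).bits ≠ [] := fun h => h0 (by
        have := Nat.size_eq_bits_len (n a)
        rw [h, List.length_nil] at this
        exact Nat.size_eq_zero.1 this.symm)
      simp [this]

@[fun_prop]
theorem PT.decide_eq_zero {n : α → ℕ} (hn : PT n) : PT fun a => decide (n a = 0) := by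
  refine (PT.isEmpty (PT.bits hn)).of_eq fun a => ?_
  rw [Bool.eq_iff_iff, List.isEmpty_iff, decide_eq_true_iff, ← Nat.size_eq_zero,
    ← Nat.size_eq_bits_len, List.length_eq_zero_iff]

@[fun_prop]
theorem PT.div2 {n : α → ℕ} (hn : PT n) : PT fun a => (n a).div2 := by
  refine PT.comp (f := Nat.div2) ?_ hn
  have h : PT (fun m : ℕ => m.bits.map fun b => (b, !b)) := PT.of_enc_eq_id fun _ => rfl
  refine PT.of_enc_eq (PT.tail h) fun m => ?_
  rw [enc_nat, Nat.div2_bits_eq_tail, List.map_tail]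

@[fun_prop]
theorem PT.bodd {n : α → ℕ} (hn : PT n) : PT fun a => (n a).bodd := by
  refine (PT.headD (PT.bits hn) (PT.const false)).of_eq fun a => ?_
  rw [Nat.bodd_eq_bits_head]
  cases (n a).bits <;> rfl

theorem esize_div2_le (n : ℕ) : esize n.div2 ≤ esize n :=
  esize_nat_mono (by rw [Nat.div2_val]; omega)

/-- The number with the given binary digits, the most significant one last, before those of `m`. -/
def prependBits (l : List Bool) (m : ℕ) : ℕ := l.foldl (fun m b => Nat.bit b m) m

@[fun_prop]
theorem PT.prependBits {l : α → List Bool} {n : α → ℕ} (hl : PT l) (hn : PT n) :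
    PT fun a => prependBits (l a) (n a) := by
  refine PT.foldl_of_le_add (l := l) (init := n) (step := fun _ m b => Nat.bit b m) (by fun_prop)
    hn hl ⟨6, fun c s a => ?_⟩
  have := esize_bit_le a s
  simpa using this

/-- One step of the addition algorithm: the summands, the carry and the digits found so far. -/
def addStep (s : ℕ × ℕ × Bool × List Bool) : ℕ × ℕ × Bool × List Bool :=
  (s.1.div2, s.2.1.div2, (s.1.bodd && s.2.1.bodd) || (s.2.2.1 && (s.1.bodd || s.2.1.bodd)),
    Bool.xor (Bool.xor s.1.bodd s.2.1.bodd) s.2.2.1 :: s.2.2.2)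

theorem nat_eq (n : ℕ) : n = 2 * n.div2 + n.bodd.toNat := by
  have := Nat.bodd_add_div2 n
  omega

/-- The number whose low digits are those already found and whose high part is the sum still to be
done, carry included, is invariant. That high part is halved in every step, so it vanishes after
enough steps. -/
theorem foldl_addStep (l : List Bool) (s : ℕ × ℕ × Bool × List Bool) :
    let t := l.foldl (fun s _ => addStep s) s
    prependBits t.2.2.2 (t.1 + t.2.1 + t.2.2.1.toNat) =
      prependBits s.2.2.2 (s.1 + s.2.1 + s.2.2.1.toNat) ∧
    t.1 + t.2.1 + t.2.2.1.toNat = (s.1 + s.2.1 + s.2.2.1.toNat) / 2 ^ l.length := by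
  induction l generalizing s with
  | nil => simp
  | cons b l ih =>
    obtain ⟨m, n, c, o⟩ := s
    have hm := nat_eq m
    have hn := nat_eq n
    have key : (addStep (m, n, c, o)).1 + (addStep (m, n, c, o)).2.1 +
        (addStep (m, n, c, o)).2.2.1.toNat = (m + n + c.toNat) / 2 := by
      simp only [addStep]
      cases hmb : m.bodd <;> cases hnb : n.bodd <;> cases c <;>
        simp only [hmb, hnb, Bool.toNat_true, Bool.toNat_false, Bool.and_true, Bool.and_false,
          Bool.or_true, Bool.or_false, Bool.true_and, Bool.false_and, Bool.true_or] at * <;> omega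
    have key' : Nat.bit (Bool.xor (Bool.xor m.bodd n.bodd) c) ((m + n + c.toNat) / 2) =
        m + n + c.toNat := by
      rw [Nat.bit_val]
      cases hmb : m.bodd <;> cases hnb : n.bodd <;> cases c <;>
        simp only [hmb, hnb, Bool.toNat_true, Bool.toNat_false, Bool.xor_true, Bool.xor_false,
          Bool.not_true, Bool.not_false] at * <;> omega
    obtain ⟨h1, h2⟩ := ih (addStep (m, n, c, o))
    rw [key] at h1 h2
    refine ⟨h1.trans ?_, h2.trans ?_⟩
    · rw [prependBits, addStep, List.foldl_cons, key', prependBits]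
    · rw [List.length_cons, Nat.div_div_eq_div_mul, pow_succ']

@[fun_prop]
theorem PT.natAdd {m n : α → ℕ} (hm : PT m) (hn : PT n) : PT fun a => m a + n a := by
  -- The list is only a clock. Its length, one more than the two digit counts together, suffices for
  -- the sum.
  have h : PT fun a => ((m a).bits ++ ((n a).bits ++ [false])).foldl (fun s _ => addStep s)
      (m a, n a, false, []) := by
    refine PT.foldl_of_le_add (l := fun a => (m a).bits ++ ((n a).bits ++ [false]))
      (init := fun a => (m a, n a, false, [])) (step := fun _ s _ => addStep s) ?_
      (by fun_prop) (by fun_prop) ⟨20, fun c s a => ?_⟩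
    · unfold addStep
      fun_prop
    · have h1 := esize_div2_le s.1
      have h2 := esize_div2_le s.2.1
      have h3 := esize_bool_le ((s.1.bodd && s.2.1.bodd) || (s.2.2.1 && (s.1.bodd || s.2.1.bodd)))
      have h4 := esize_bool_le (Bool.xor (Bool.xor s.1.bodd s.2.1.bodd) s.2.2.1)
      simp only [addStep, esize_prod, esize_cons, eval_ofNat]
      omega
  refine (PT.prependBits (l := fun a => _) (n := fun _ => 0) (PT.snd (PT.snd (PT.snd h)))
    (by fun_prop)).of_eq fun a => ?_
  obtain ⟨h1, h2⟩ := foldl_addStep ((m a).bits ++ ((n a).bits ++ [false])) (m a, n a, false, [])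
  simp only [Bool.toNat_false, add_zero] at h1 h2
  rw [Nat.div_eq_of_lt] at h2
  · rw [h2] at h1
    exact h1.symm
  · simp only [List.length_append, List.length_cons, List.length_nil, Nat.size_eq_bits_len]
    have := Nat.size_le.1 (size_add_le (m a) (n a))
    simpa [add_assoc] using this

/-- One step of the subtraction algorithm: the numbers, the borrow and the digits found so far. -/
def subStep (s : ℕ × ℕ × Bool × List Bool) : ℕ × ℕ × Bool × List Bool :=
  (s.1.div2, s.2.1.div2, (!s.1.bodd && (s.2.1.bodd || s.2.2.1)) || (s.2.1.bodd && s.2.2.1),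
    Bool.xor (Bool.xor s.1.bodd s.2.1.bodd) s.2.2.1 :: s.2.2.2)

/-- The intermediate difference may be negative, so the invariant is stated over the integers. Once
both numbers are used up, the borrow shows the sign of the difference. -/
theorem foldl_subStep (l : List Bool) (s : ℕ × ℕ × Bool × List Bool) :
    let t := l.foldl (fun s _ => subStep s) s
    t.1 = s.1 / 2 ^ l.length ∧ t.2.1 = s.2.1 / 2 ^ l.length ∧
    ((t.1 : ℤ) - t.2.1 - (t.2.2.1.toNat : ℤ)) * 2 ^ t.2.2.2.length + prependBits t.2.2.2 0 =
      (s.1 - s.2.1 - (s.2.2.1.toNat : ℤ)) * 2 ^ s.2.2.2.length + prependBits s.2.2.2 0 := by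
  have hp : ∀ (l : List Bool) (m : ℕ), prependBits l m = m * 2 ^ l.length + prependBits l 0 := by
    intro l
    induction l with
    | nil => simp [prependBits]
    | cons b l ih =>
      intro m
      have h1 := ih (Nat.bit b m)
      have h2 := ih (Nat.bit b 0)
      simp only [prependBits, List.foldl_cons] at *
      rw [h1, h2, Nat.bit_val, Nat.bit_val, List.length_cons, pow_succ]
      ring
  induction l generalizing s with
  | nil => simp
  | cons b l ih =>
    obtain ⟨m, n, c, o⟩ := s
    have hm := nat_eq m
    have hn := nat_eq n
    obtain ⟨h1, h2, h3⟩ := ih (subStep (m, n, c, o))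
    refine ⟨h1.trans ?_, h2.trans ?_, h3.trans ?_⟩
    · rw [List.length_cons, pow_succ', ← Nat.div_div_eq_div_mul, ← Nat.div2_val]; rfl
    · rw [List.length_cons, pow_succ', ← Nat.div_div_eq_div_mul, ← Nat.div2_val]; rfl
    · simp only [subStep, List.length_cons, pow_succ]
      rw [show ∀ b, prependBits (b :: o) 0 = prependBits o (Nat.bit b 0) from fun _ => rfl, hp,
        Nat.bit_val]
      push_cast
      have key : ((m.div2 : ℤ) - n.div2 - (((!m.bodd && (n.bodd || c)) || (n.bodd && c)).toNat : ℤ))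
          * 2 + (Bool.xor (Bool.xor m.bodd n.bodd) c).toNat = m - n - c.toNat := by
        cases hmb : m.bodd <;> cases hnb : n.bodd <;> cases c <;>
        simp only [hmb, hnb, Bool.toNat_true, Bool.toNat_false, Bool.and_true, Bool.and_false,
          Bool.or_true, Bool.or_false, Bool.true_and, Bool.false_and, Bool.true_or, Bool.xor_true,
          Bool.xor_false, Bool.not_true, Bool.not_false] at * <;> omega
      rw [← key]
      ring

@[fun_prop]
theorem PT.natSub {m n : α → ℕ} (hm : PT m) (hn : PT n) : PT fun a => m a - n a := by
  have h : PT fun a => ((m a).bits ++ (n a).bits).foldl (fun s _ => subStep s)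
      (m a, n a, false, []) := by
    refine PT.foldl_of_le_add (l := fun a => (m a).bits ++ (n a).bits)
      (init := fun a => (m a, n a, false, [])) (step := fun _ s _ => subStep s) ?_
      (by fun_prop) (by fun_prop) ⟨20, fun c s a => ?_⟩
    · unfold subStep
      fun_prop
    · have h1 := esize_div2_le s.1
      have h2 := esize_div2_le s.2.1
      have h3 := esize_bool_le ((!s.1.bodd && (s.2.1.bodd || s.2.2.1)) || (s.2.1.bodd && s.2.2.1))
      have h4 := esize_bool_le (Bool.xor (Bool.xor s.1.bodd s.2.1.bodd) s.2.2.1)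
      simp only [subStep, esize_prod, esize_cons, eval_ofNat]
      omega
  refine (PT.cond (PT.fst (PT.snd (PT.snd h))) (PT.const 0)
    (PT.prependBits (n := fun _ => 0) (PT.snd (PT.snd (PT.snd h)))
    (by fun_prop))).of_eq fun a => ?_
  obtain ⟨h1, h2, h3⟩ := foldl_subStep ((m a).bits ++ (n a).bits) (m a, n a, false, [])
  set t := ((m a).bits ++ (n a).bits).foldl (fun s _ => subStep s) (m a, n a, false, [])
  have hlen : ((m a).bits ++ (n a).bits).length = (m a).size + (n a).size := by
    rw [List.length_append, Nat.size_eq_bits_len, Nat.size_eq_bits_len]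
  rw [hlen, Nat.div_eq_of_lt] at h1 h2
  · simp only [h1, h2, Bool.toNat_false, List.length_nil] at h3
    rw [show PolyTime.prependBits [] 0 = 0 from rfl] at h3
    have hlt : ∀ l : List Bool, PolyTime.prependBits l 0 < 2 ^ l.length := by
      have key : ∀ (l : List Bool) (m : ℕ), PolyTime.prependBits l m < (m + 1) * 2 ^ l.length := by
        intro l
        induction l with
        | nil => intro m; simp [PolyTime.prependBits]
        | cons b l ih =>
          intro m
          refine (ih (Nat.bit b m)).trans_le ?_
          rw [List.length_cons, pow_succ', ← mul_assoc]
          refine Nat.mul_le_mul_right _ ?_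
          rw [Nat.bit_val]
          cases b <;> simp <;> omega
      exact fun l => by simpa using key l 0
    have := hlt t.2.2.2
    zify at this
    -- The digits represent less than `2 ^ length`, so a final borrow means a negative difference,
    -- for which truncated subtraction gives 0.
    split_ifs with hc
    · rw [hc] at h3
      simp at h3
      omega
    · rw [Bool.not_eq_true] at hc
      rw [hc] at h3
      simp at h3
      omega
  · exact (Nat.lt_size_self _).trans_le (Nat.pow_le_pow_right (by norm_num) (by simp))
  · exact (Nat.lt_size_self _).trans_le (Nat.pow_le_pow_right (by norm_num) (by simp))

@[fun_prop]
theorem PT.decide_natLe {m n : α → ℕ} (hm : PT m) (hn : PT n) : PT fun a => decide (m a ≤ n a) :=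
  (PT.decide_eq_zero (PT.natSub hm hn)).of_eq fun a => by simp [Nat.sub_eq_zero_iff_le]

@[fun_prop]
theorem PT.decide_natEq {m n : α → ℕ} (hm : PT m) (hn : PT n) : PT fun a => decide (m a = n a) :=
  (PT.and (PT.decide_natLe hm hn) (PT.decide_natLe hn hm)).of_eq fun a => by
    rw [Bool.eq_iff_iff]
    simp [le_antisymm_iff]

-- Induction for Horner schemes: `Nat.bits` lists the least significant digit first, so `foldr`
-- consumes the most significant digit first.
omit [Enc σ] in
theorem foldr_bits {P : ℕ → σ → Prop} {f : Bool → σ → σ} {s : σ} (h0 : P 0 s)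
    (h : ∀ b n s, P n s → P (Nat.bit b n) (f b s)) (n : ℕ) : P n (n.bits.foldr f s) := by
  induction n using Nat.binaryRec' with
  | zero => simpa using h0
  | bit b n hb ih =>
    rw [Nat.bits_append_bit _ _ hb, List.foldr_cons]
    exact h b n _ ih

@[fun_prop]
theorem PT.natMul {m n : α → ℕ} (hm : PT m) (hn : PT n) : PT fun a => m a * n a := by
  have h : PT fun x : ℕ × ℕ => x.2.bits.foldr
      (fun b s => if b = true then Nat.bit false s + x.1 else Nat.bit false s) 0 := by
    refine PT.foldr_of_le_add (l := fun x : ℕ × ℕ => x.2.bits) (init := fun _ => 0)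
      (step := fun x b s => if b = true then Nat.bit false s + x.1 else Nat.bit false s) ?_
      (by fun_prop) (by fun_prop) ⟨X + 12, fun c b s => ?_⟩
    · exact PT.cond (by fun_prop) (by fun_prop) (by fun_prop)
    · have h1 := esize_bit_le false s
      have h2 := esize_add_le (Nat.bit false s) c.1
      simp only [eval_add, eval_X, eval_ofNat, esize_prod c]
      split_ifs <;> omega
  refine (PT.comp (g := fun a => (m a, n a)) h (by fun_prop)).of_eq fun a => ?_
  refine foldr_bits (P := fun k s => m a * k = s) (by simp) (fun b k s hs => ?_) (n a)
  subst hs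
  cases b <;> simp [Nat.bit_val] <;> ring

/-- One step of the long division by `d`. -/
def divStep (d : ℕ) (b : Bool) (s : ℕ × ℕ) : ℕ × ℕ :=
  if d ≤ Nat.bit b s.2 then (Nat.bit true s.1, Nat.bit b s.2 - d)
  else (Nat.bit false s.1, Nat.bit b s.2)

theorem PT.natDivMod {m n : α → ℕ} (hm : PT m) (hn : PT n) : PT fun a => (m a / n a, m a % n a) := by
  have h : PT fun x : ℕ × ℕ => x.1.bits.foldr (divStep x.2) (0, 0) := by
    refine PT.foldr_of_le_add (l := fun x : ℕ × ℕ => x.1.bits) (init := fun _ => (0, 0))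
      (step := fun x => divStep x.2) ?_ (by fun_prop) (by fun_prop) ⟨12, fun c b s => ?_⟩
    · unfold divStep
      fun_prop
    · have h1 := esize_bit_le b s.2
      have h2 := esize_bit_le true s.1
      have h3 := esize_bit_le false s.1
      have h4 := esize_nat_mono (Nat.sub_le (Nat.bit b s.2) c.2)
      simp only [divStep, eval_ofNat]
      split_ifs <;> simp only [esize_prod] <;> omega
  -- Division by 0 has quotient 0 and leaves the dividend as remainder; the long division needs a
  -- positive divisor.
  have h' : PT fun a => if n a = 0 then (0, m a) else (m a).bits.foldr (divStep (n a)) (0, 0) :=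
    PT.ite (by fun_prop) (by fun_prop)
      (PT.comp (f := fun x : ℕ × ℕ => x.1.bits.foldr (divStep x.2) (0, 0))
        (g := fun a => (m a, n a)) h (by fun_prop))
  refine h'.of_eq fun a => ?_
  split_ifs with h0
  · simp [h0]
  · have hpos : 0 < n a := Nat.pos_of_ne_zero h0
    have key : (fun k (s : ℕ × ℕ) => k = s.1 * n a + s.2 ∧ s.2 < n a) (m a)
        ((m a).bits.foldr (divStep (n a)) (0, 0)) := by
      refine foldr_bits (P := fun k (s : ℕ × ℕ) => k = s.1 * n a + s.2 ∧ s.2 < n a)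
        (by simpa using hpos) (fun b k s hs => ?_) (m a)
      obtain ⟨q, r⟩ := s
      obtain ⟨rfl, hr⟩ := hs
      simp only [divStep, Nat.bit_val] at *
      split_ifs with hle <;> cases b <;> simp at * <;> constructor <;> first | omega | (ring_nf at *; done) | (ring_nf at *; omega)
    set t := (m a).bits.foldr (divStep (n a)) (0, 0)
    obtain ⟨h1, h2⟩ := key
    ext
    · dsimp only
      rw [h1, mul_comm, Nat.mul_add_div hpos, Nat.div_eq_of_lt h2, add_zero]
    · dsimp only
      rw [h1, mul_comm, Nat.mul_add_mod, Nat.mod_eq_of_lt h2]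

@[fun_prop]
theorem PT.natDiv {m n : α → ℕ} (hm : PT m) (hn : PT n) : PT fun a => m a / n a :=
  PT.fst (PT.natDivMod hm hn)

@[fun_prop]
theorem PT.natMod {m n : α → ℕ} (hm : PT m) (hn : PT n) : PT fun a => m a % n a :=
  PT.snd (PT.natDivMod hm hn)

end Nat

end PolyTime

namespace PolyTime

open Polynomial
open Enc

/-! ### Integers, list access and ranges. -/

section Int

variable {α β γ σ : Type} [Enc α] [Enc β] [Enc γ] [Enc σ]

theorem esize_int (z : ℤ) : esize z = 6 * z.natAbs.size + 3 := by
  rw [esize, enc_int]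
  change esize (z.toNat, (-z).toNat) = _
  rw [esize_mk, esize_nat, esize_nat]
  rcases le_total 0 z with h | h
  · rw [show (-z).toNat = 0 by omega, show z.natAbs = z.toNat by omega, Nat.size_zero]
  · rw [show z.toNat = 0 by omega, show z.natAbs = (-z).toNat by omega, Nat.size_zero]
    omega

theorem esize_int_le {z : ℤ} {k : ℕ} (h : |z| < 2 ^ k) : esize z ≤ 6 * k + 3 := by
  have : z.natAbs.size ≤ k := Nat.size_le.2 (by zify; exact h)
  rw [esize_int]
  omega

theorem abs_lt_two_pow_esize (z : ℤ) : |z| < 2 ^ esize z := by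
  have h := Nat.size_le.1 (show z.natAbs.size ≤ esize z by rw [esize_int]; omega)
  zify at h
  exact h

theorem esize_int_add_le (x y : ℤ) : esize (x + y) ≤ esize x + esize y + 3 := by
  have h1 := size_add_le x.natAbs y.natAbs
  have h2 := Nat.size_le_size (Int.natAbs_add_le x y)
  simp only [esize_int]
  omega

theorem PT.natSub_cast {m n : α → ℕ} (hm : PT m) (hn : PT n) :
    PT fun a => ((m a : ℤ) - (n a : ℤ)) := by
  refine PT.of_enc_eq (PT.prodMk (PT.natSub hm hn) (PT.natSub hn hm)) fun a => ?_
  rw [enc_int, show ((m a : ℤ) - n a).toNat = m a - n a by omega,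
    show (-((m a : ℤ) - n a)).toNat = n a - m a by omega]

@[fun_prop]
theorem PT.natCast {n : α → ℕ} (hn : PT n) : PT fun a => (n a : ℤ) :=
  (PT.natSub_cast hn (PT.const 0)).of_eq fun a => by simp

theorem PT.parts {z : α → ℤ} (hz : PT z) : PT fun a => ((z a).toNat, (-z a).toNat) :=
  PT.comp (f := fun z : ℤ => (z.toNat, (-z).toNat)) (PT.of_enc_eq_id fun _ => rfl) hz

@[fun_prop]
theorem PT.toNat {z : α → ℤ} (hz : PT z) : PT fun a => (z a).toNat := PT.fst hz.parts

theorem PT.negToNat {z : α → ℤ} (hz : PT z) : PT fun a => (-z a).toNat := PT.snd hz.parts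

@[fun_prop]
theorem PT.natAbs {z : α → ℤ} (hz : PT z) : PT fun a => (z a).natAbs :=
  (PT.natAdd hz.toNat hz.negToNat).of_eq fun a => by omega

@[fun_prop]
theorem PT.neg {z : α → ℤ} (hz : PT z) : PT fun a => -z a :=
  (PT.natSub_cast hz.negToNat hz.toNat).of_eq fun a => by omega

@[fun_prop]
theorem PT.add {x y : α → ℤ} (hx : PT x) (hy : PT y) : PT fun a => x a + y a :=
  (PT.natSub_cast (PT.natAdd hx.toNat hy.toNat) (PT.natAdd hx.negToNat hy.negToNat)).of_eq
    fun a => by omega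

@[fun_prop]
theorem PT.sub {x y : α → ℤ} (hx : PT x) (hy : PT y) : PT fun a => x a - y a :=
  (PT.add hx hy.neg).of_eq fun _ => sub_eq_add_neg _ _

@[fun_prop]
theorem PT.mul {x y : α → ℤ} (hx : PT x) (hy : PT y) : PT fun a => x a * y a := by
  refine (PT.natSub_cast
    (PT.natAdd (PT.natMul hx.toNat hy.toNat) (PT.natMul hx.negToNat hy.negToNat))
    (PT.natAdd (PT.natMul hx.toNat hy.negToNat) (PT.natMul hx.negToNat hy.toNat))).of_eq
    fun a => ?_
  have hx := Int.toNat_sub_toNat_neg (x a)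
  have hy := Int.toNat_sub_toNat_neg (y a)
  conv_lhs => rw [← hx, ← hy]
  push_cast
  ring

@[fun_prop]
theorem PT.decide_intEq {x y : α → ℤ} (hx : PT x) (hy : PT y) : PT fun a => decide (x a = y a) :=
  (PT.decide_eq_zero (PT.natAbs (PT.sub hx hy))).of_eq fun a => by
    rw [Bool.eq_iff_iff]
    simp [sub_eq_zero]

@[fun_prop]
theorem PT.emod {z : α → ℤ} {d : α → ℕ} (hz : PT z) (hd : PT d) : PT fun a => z a % (d a : ℤ) := by
  -- With `z` written as the difference of its positive and negative parts, adding `d` keeps the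
  -- difference of their remainders nonnegative. Reduction modulo 0 returns `z`.
  have h : PT fun a => if d a = 0 then z a else
      ((((z a).toNat % d a + (d a - (-z a).toNat % d a)) % d a : ℕ) : ℤ) := by
    have := hz.negToNat
    fun_prop
  refine h.of_eq fun a => ?_
  split_ifs with h0
  · simp [h0]
  · have h1 : (-z a).toNat % d a ≤ d a := (Nat.mod_lt _ (Nat.pos_of_ne_zero h0)).le
    push_cast [h1]
    conv_lhs => rw [← Int.toNat_sub_toNat_neg (z a)]
    rw [Int.emod_eq_emod_iff_emod_sub_eq_zero]
    have e₁ := Int.emod_add_mul_ediv ((z a).toNat : ℤ) (d a)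
    have e₂ := Int.emod_add_mul_ediv ((-z a).toNat : ℤ) (d a)
    exact Int.emod_eq_zero_of_dvd ⟨((z a).toNat : ℤ) / d a - ((-z a).toNat : ℤ) / d a - 1, by
      linear_combination e₂ - e₁⟩

@[fun_prop]
theorem PT.listSum {l : α → List ℤ} (hl : PT l) : PT fun a => (l a).sum := by
  refine (PT.foldr_of_le_add (l := l) (init := fun _ => (0 : ℤ)) (step := fun _ x s => x + s)
    (by fun_prop) (by fun_prop) hl ⟨X + 3, fun c x s => ?_⟩).of_eq fun a => ?_
  · have := esize_int_add_le x s
    simp only [eval_add, eval_X, eval_ofNat]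
    omega
  · rw [List.sum]

@[fun_prop]
theorem PT.getD {l : α → List β} {i : α → ℕ} {d : α → β} (hl : PT l) (hi : PT i) (hd : PT d) :
    PT fun a => (l a).getD (i a) (d a) := by
  have h : PT fun a => (l a).foldl (fun (s : ℕ × β) b => (s.1 + 1, if s.1 = i a then b else s.2))
      (0, d a) := by
    have hs : PT fun p : α × (ℕ × β) × β =>
        (p.2.1.1 + 1, if p.2.1.1 = i p.1 then p.2.2 else p.2.1.2) := by
      have : PT fun p : α × (ℕ × β) × β => i p.1 := PT.comp hi (by fun_prop)
      fun_prop
    refine PT.foldl_of_le_add (init := fun a => (0, d a))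
      (step := fun a (s : ℕ × β) b => (s.1 + 1, if s.1 = i a then b else s.2)) hs (by fun_prop) hl
      ⟨X + 20, fun c s b => ?_⟩
    have := esize_add_le s.1 1
    have h1 : esize 1 = 7 := by rw [esize_nat]; rfl
    simp only [esize_prod, eval_add, eval_X, eval_ofNat]
    split_ifs <;> omega
  refine (PT.snd h).of_eq fun a => ?_
  have key : ∀ (l : List β) (k : ℕ) (d : β), (l.foldl (fun (s : ℕ × β) b =>
      (s.1 + 1, if s.1 = i a then b else s.2)) (k, d)).2 = if k ≤ i a then l.getD (i a - k) d else d := by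
    intro l
    induction l with
    | nil => simp
    | cons b l ih =>
      intro k d
      rw [List.foldl_cons, ih]
      dsimp only
      rcases lt_trichotomy k (i a) with h | h | h
      · rw [if_neg (show ¬k = i a by omega), if_pos (by omega), if_pos (by omega),
          show i a - k = i a - (k + 1) + 1 by omega, List.getD_cons_succ]
      · subst h
        simp
      · rw [if_neg (show ¬k = i a by omega), if_neg (by omega), if_neg (by omega)]
  rw [key, if_pos (Nat.zero_le _), Nat.sub_zero]

@[fun_prop]
theorem PT.length {l : α → List β} (hl : PT l) : PT fun a => (l a).length := by
  refine (PT.foldr_of_le_add (l := l) (init := fun _ => 0) (step := fun _ _ s => s + 1)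
    (by fun_prop) (by fun_prop) hl ⟨20, fun c x s => ?_⟩).of_eq fun a => ?_
  · have := esize_add_le s 1
    have h1 : esize 1 = 7 := by rw [esize_nat]; rfl
    simp only [eval_ofNat]
    omega
  · induction l a with
    | nil => rfl
    | cons b l ih => rw [List.length_cons, List.foldr_cons, ih]

-- The bound is the length of a list: for a bound given in binary the result could be exponentially
-- long.
@[fun_prop]
theorem PT.range {l : α → List β} (hl : PT l) : PT fun a => List.range (l a).length := by
  have key : ∀ l : List β, l.foldl (fun (s : List ℕ) _ => s ++ [s.length]) [] =
      List.range l.length := by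
    intro l
    induction l using List.reverseRecOn with
    | nil => rfl
    | append_singleton l b ih =>
      rw [List.foldl_append, ih, List.foldl_cons, List.foldl_nil, List.length_append,
        List.length_range, List.length_singleton, List.range_succ]
  have hsize : ∀ n k, n ≤ k → esize (List.range n) ≤ n * (6 * k + 2) + 1 := by
    intro n
    induction n with
    | zero => intro k _; rw [List.range_zero, esize_nil]; omega
    | succ n ih =>
      intro k hk
      have h1 := esize_append (List.range n) [n]
      have h2 := ih k (by omega)
      have h3 := esize_nat_le (Nat.lt_two_pow_self (n := n))
      rw [esize_cons, esize_nil] at h1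
      rw [List.range_succ, add_mul]
      omega
  obtain ⟨q, hq⟩ := hl.esize_le
  refine (PT.foldl (l := l) (init := fun _ => []) (step := fun _ (s : List ℕ) _ => s ++ [s.length])
    (by fun_prop) (by fun_prop) hl ⟨q * (6 * q + 2) + 1, fun c l' hl' => ?_⟩).of_eq
    fun a => (key _).symm
  have h1 : l'.length ≤ q.eval (esize c) :=
    ((length_lt_esize l').le.trans (esize_le_of_prefix hl')).trans (hq c)
  rw [key]
  refine (hsize _ _ h1).trans ?_
  simp only [eval_add, eval_mul, eval_ofNat, eval_one]
  gcongr

end Int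

end PolyTime

/-! ### Integral linear systems with a Laplacian matrix -/

namespace LaplacianSystem

open Matrix Polynomial

/-! ### A division-free Faddeev–LeVerrier recursion. -/

section Faddeev

variable {ι R : Type*} [Fintype ι] [DecidableEq ι] [CommRing R]

/-- The product rule in each term of the Leibniz formula, with the differentiated factors collected
by columns. -/
theorem derivative_det (M : Matrix ι ι R[X]) :
    derivative M.det = ∑ i, (M.updateCol i fun j => derivative (M j i)).det := by
  simp only [det_apply, map_sum, Units.smul_def, map_zsmul, derivative_prod_finset]
  rw [Finset.sum_comm]
  refine Finset.sum_congr rfl fun σ _ => ?_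
  rw [Finset.smul_sum]
  refine Finset.sum_congr rfl fun i _ => ?_
  congr 1
  rw [← Finset.mul_prod_erase _ _ (Finset.mem_univ i), updateCol_self, mul_comm]
  congr 1
  refine Finset.prod_congr rfl fun j hj => ?_
  rw [updateCol_ne (Finset.ne_of_mem_erase hj)]

/-- Differentiating column `i` of `X - A` leaves a unit vector, so the corresponding determinant is
the `i`-th diagonal entry of the adjugate. -/
theorem trace_adjugate_charmatrix (A : Matrix ι ι R) :
    trace (adjugate (charmatrix A)) = derivative A.charpoly := by
  rw [Matrix.charpoly, derivative_det, trace]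
  refine Finset.sum_congr rfl fun i _ => ?_
  rw [diag_apply, ← transpose_apply (adjugate _), adjugate_transpose, adjugate_apply,
    updateRow_transpose, det_transpose]
  congr 2
  funext j
  rw [charmatrix_apply, derivative_sub, derivative_C, sub_zero, diagonal_apply, Pi.single_apply]
  split_ifs <;> simp

/-- The matrices of a variant of the Faddeev–LeVerrier algorithm that avoids divisions. -/
def faddeev (A : Matrix ι ι R) : ℕ → Matrix ι ι R
  | 0 => 1
  | k + 1 => ((k + 1 : ℕ) : R) • (A * faddeev A k) - trace (A * faddeev A k) • 1

/-- The coefficients of the adjugate of the characteristic matrix. -/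
noncomputable def adjCoeff (A : Matrix ι ι R) (j : ℕ) : Matrix ι ι R :=
  (matPolyEquiv (adjugate (charmatrix A))).coeff j

/-- Compare the coefficients of `X ^ (j + 1)` in `(X - A) adj(X - A) = χ(X) I`. -/
theorem adjCoeff_recurrence (A : Matrix ι ι R) (j : ℕ) :
    adjCoeff A j = A * adjCoeff A (j + 1) + A.charpoly.coeff (j + 1) • 1 := by
  have h := congrArg matPolyEquiv (mul_adjugate (charmatrix A))
  rw [map_mul, matPolyEquiv_charmatrix] at h
  have h := congrArg (fun p => coeff p (j + 1)) h
  have h2 : (matPolyEquiv ((charmatrix A).det • (1 : Matrix ι ι R[X]))).coeff (j + 1) =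
      A.charpoly.coeff (j + 1) • 1 := by
    rw [matPolyEquiv_smul_one, coeff_map, Algebra.algebraMap_eq_smul_one, Matrix.charpoly]
  simp only [sub_mul, coeff_sub, coeff_X_mul, coeff_C_mul, h2] at h
  rw [adjCoeff, adjCoeff, ← h]
  abel

theorem mul_adjCoeff_zero (A : Matrix ι ι R) :
    A * adjCoeff A 0 = -(A.charpoly.coeff 0 • 1) := by
  have h := congrArg matPolyEquiv (mul_adjugate (charmatrix A))
  rw [map_mul, matPolyEquiv_charmatrix] at h
  have h := congrArg (fun p => coeff p 0) h
  have h2 : (matPolyEquiv ((charmatrix A).det • (1 : Matrix ι ι R[X]))).coeff 0 =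
      A.charpoly.coeff 0 • 1 := by
    rw [matPolyEquiv_smul_one, coeff_map, Algebra.algebraMap_eq_smul_one, Matrix.charpoly]
  simp only [sub_mul, coeff_sub, mul_coeff_zero, coeff_X_zero, coeff_C_zero, h2, zero_mul] at h
  rw [adjCoeff, ← h]
  abel

theorem trace_adjCoeff (A : Matrix ι ι R) (j : ℕ) :
    trace (adjCoeff A j) = A.charpoly.coeff (j + 1) * (j + 1) := by
  rw [← coeff_derivative, ← trace_adjugate_charmatrix, trace, trace, finsetSum_coeff]
  exact Finset.sum_congr rfl fun i _ => matPolyEquiv_coeff_apply _ _ _ _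

variable [Nontrivial R]

/-- Beyond the degree the coefficients vanish, and the recurrence carries this down to `card ι`
because `χ` has no coefficients above that index. -/
theorem adjCoeff_eq_zero (A : Matrix ι ι R) {j : ℕ} (hj : Fintype.card ι ≤ j) :
    adjCoeff A j = 0 := by
  have key : ∀ m j, Fintype.card ι ≤ j →
      (matPolyEquiv (adjugate (charmatrix A))).natDegree < m + j → adjCoeff A j = 0 := by
    intro m
    induction m with
    | zero => exact fun j _ h => coeff_eq_zero_of_natDegree_lt (by simpa using h)
    | succ m ih =>
      intro j hj h
      rw [adjCoeff_recurrence, ih (j + 1) (by omega) (by omega), coeff_eq_zero_of_natDegree_lt]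
      · simp
      · rw [charpoly_natDegree_eq_dim]
        omega
  exact key ((matPolyEquiv (adjugate (charmatrix A))).natDegree + 1) j hj (by omega)

theorem adjCoeff_last (A : Matrix ι ι R) {j : ℕ} (hj : j + 1 = Fintype.card ι) :
    adjCoeff A j = 1 := by
  have h := A.charpoly_monic.coeff_natDegree
  rw [charpoly_natDegree_eq_dim] at h
  rw [adjCoeff_recurrence, adjCoeff_eq_zero A hj.ge, hj, h]
  simp

-- Newton's identities: take traces in the recurrence and insert `trace_adjCoeff`.
omit [Nontrivial R] in
theorem trace_mul_adjCoeff (A : Matrix ι ι R) (j : ℕ) :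
    trace (A * adjCoeff A j) = (j - Fintype.card ι) * A.charpoly.coeff j := by
  cases j with
  | zero => rw [mul_adjCoeff_zero, trace_neg, trace_smul, trace_one]; simp; ring
  | succ j =>
    have h := congrArg trace (adjCoeff_recurrence A j)
    rw [trace_add, trace_smul, trace_one, trace_adjCoeff, smul_eq_mul] at h
    push_cast
    linear_combination -h

/-- With `c = χ.coeff (j + 1)`, the trace of `A * adjCoeff A (j + 1)` is `-(k + 1) * c`. The usual
recursion divides by `k + 1` to recover `c`; multiplying the other term by `k + 1` instead only
produces the factor `k!`. -/
theorem faddeev_eq (A : Matrix ι ι R) (k j : ℕ) (h : k + j + 1 = Fintype.card ι) :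
    faddeev A k = (k.factorial : R) • adjCoeff A j := by
  induction k generalizing j with
  | zero => rw [faddeev, adjCoeff_last A (by omega)]; simp
  | succ k ih =>
    have hk : (Fintype.card ι : R) = k + (j + 1 : ℕ) + 1 := by
      rw [← h]
      push_cast
      ring
    rw [faddeev, ih (j + 1) (by omega), mul_smul_comm, trace_smul, trace_mul_adjCoeff, hk,
      adjCoeff_recurrence A j, smul_add, smul_smul, smul_smul, ← Nat.cast_mul, Nat.factorial_succ,
      sub_eq_add_neg, ← neg_smul]
    congr 2
    push_cast
    simp only [smul_eq_mul]
    ring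

/-- By the constant term of the adjugate identity, both sides are the scalar matrix `-(k + 1)! *
χ(0)`. This gives an inverse up to a scalar. -/
theorem mul_faddeev (A : Matrix ι ι R) {k : ℕ} (h : k + 1 = Fintype.card ι) :
    A * (((k + 1 : ℕ) : R) • faddeev A k) = trace (A * faddeev A k) • 1 := by
  rw [faddeev_eq A k 0 (by omega), mul_smul_comm, mul_smul_comm, trace_smul, trace_mul_adjCoeff,
    mul_adjCoeff_zero, smul_neg, smul_neg, smul_smul, smul_smul, ← neg_smul, ← h]
  congr 1
  push_cast
  simp only [smul_eq_mul]
  ring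

omit [Nontrivial R] in
theorem trace_mul_faddeev_ne_zero [IsDomain R] [CharZero R] (A : Matrix ι ι R) (hA : A.det ≠ 0)
    {k : ℕ} (h : k + 1 = Fintype.card ι) : trace (A * faddeev A k) ≠ 0 := by
  rw [faddeev_eq A k 0 (by omega), mul_smul_comm, trace_smul, trace_mul_adjCoeff, ← h]
  have h1 : A.charpoly.coeff 0 ≠ 0 := by
    intro h0
    rw [det_eq_sign_charpoly_coeff, h0, mul_zero] at hA
    exact hA rfl
  have h2 : ((k + 1 : ℕ) : R) ≠ 0 := Nat.cast_ne_zero.2 (by omega)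
  have h3 : (k.factorial : R) ≠ 0 := Nat.cast_ne_zero.2 k.factorial_ne_zero
  rw [smul_eq_mul, Nat.cast_zero, zero_sub]
  exact mul_ne_zero h3 (mul_ne_zero (neg_ne_zero.2 h2) h1)

end Faddeev

end LaplacianSystem

namespace LaplacianSystem

open Matrix

/-! ### Kernel of the Laplacian and integral solvability. -/

section Laplacian

variable {ι : Type*} [Fintype ι] [DecidableEq ι]

/-- The Laplacian matrix of the weighted digraph with `m v u` edges from `u` to `v`. -/
def lap (m : ι → ι → ℤ) : Matrix ι ι ℤ :=
  fun v u => m v u - if v = u then ∑ w, m w u else 0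

variable {m : ι → ι → ℤ}

theorem lap_mulVec (z : ι → ℤ) (v : ι) :
    (lap m *ᵥ z) v = ∑ u, m v u * z u - (∑ w, m w v) * z v := by
  simp [lap, mulVec, dotProduct, sub_mul, Finset.sum_sub_distrib, ite_mul]

theorem sum_lap_mulVec (z : ι → ℤ) : ∑ v, (lap m *ᵥ z) v = 0 := by
  simp only [lap_mulVec, Finset.sum_sub_distrib]
  rw [Finset.sum_comm, sub_eq_zero]
  exact Finset.sum_congr rfl fun u _ => (Finset.sum_mul _ _ _).symm

/-- The triangle inequality makes all entries of `lap m *ᵥ |z|` nonnegative, and they sum to zero.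
-/
theorem lap_mulVec_abs (hm : ∀ v u, 0 ≤ m v u) {z : ι → ℤ} (hz : lap m *ᵥ z = 0) :
    lap m *ᵥ |z| = 0 := by
  have h : ∀ v ∈ Finset.univ, 0 ≤ (lap m *ᵥ |z|) v := by
    intro v _
    have h1 : ∑ u, m v u * z u = (∑ w, m w v) * z v := by
      have := congrFun hz v
      rw [lap_mulVec] at this
      exact sub_eq_zero.1 this
    have h2 := Finset.abs_sum_le_sum_abs (fun u => m v u * z u) Finset.univ
    rw [h1, abs_mul, abs_of_nonneg (Finset.sum_nonneg fun w _ => hm w v)] at h2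
    rw [lap_mulVec, sub_nonneg]
    refine h2.trans (Finset.sum_le_sum fun u _ => ?_)
    rw [abs_mul, abs_of_nonneg (hm v u), Pi.abs_apply]
  funext v
  exact (Finset.sum_eq_zero_iff_of_nonneg h).1 (sum_lap_mulVec _) v (Finset.mem_univ v)

omit [DecidableEq ι] in
theorem vecMulVec_one_mulVec (e z : ι → ℤ) : vecMulVec e 1 *ᵥ z = (∑ v, z v) • e := by
  funext v
  simp [mulVec, dotProduct, vecMulVec_apply, ← Finset.mul_sum, mul_comm]

variable (hm : ∀ v u, 0 ≤ m v u) (hc : ∀ u v, Relation.ReflTransGen (fun a b => 0 < m b a) u v)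
include hm hc

/-- Positivity spreads along edges: the weighted inflow at `b` equals the out-degree of `b` times `z
b`, and a positive predecessor makes it positive. -/
theorem pos_of_lap_mulVec_eq_zero {z : ι → ℤ} (hz : lap m *ᵥ z = 0) (h0 : ∀ v, 0 ≤ z v) {u : ι}
    (hu : 0 < z u) (v : ι) : 0 < z v := by
  induction hc u v with
  | refl => exact hu
  | @tail a b _ hab ih =>
    have h1 : ∑ u, m b u * z u = (∑ w, m w b) * z b := by
      have := congrFun hz b
      rw [lap_mulVec] at this
      exact sub_eq_zero.1 this
    have h2 := Finset.single_le_sum (f := fun u => m b u * z u)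
      (fun u _ => mul_nonneg (hm b u) (h0 u)) (Finset.mem_univ a)
    have h3 : 0 < m b a * z a := mul_pos hab ih
    rcases (h0 b).eq_or_lt with h | h
    · rw [← h, mul_zero] at h1
      omega
    · exact h

/-- The columns sum to zero, so the Laplacian is singular; the absolute value of a nonzero kernel
vector is in the kernel and positive throughout. -/
theorem exists_pos_lap_mulVec_eq_zero : ∃ z : ι → ℤ, lap m *ᵥ z = 0 ∧ ∀ v, 0 < z v := by
  rcases isEmpty_or_nonempty ι with h | h
  · exact ⟨0, mulVec_zero _, fun v => h.elim v⟩
  · have hdet : (lap m).det = 0 := by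
      refine exists_vecMul_eq_zero_iff.1 ⟨1, one_ne_zero, funext fun u => ?_⟩
      have := sum_lap_mulVec (m := m) (Pi.single u 1)
      simpa [vecMul, dotProduct] using this
    obtain ⟨z, hz, h⟩ := exists_mulVec_eq_zero_iff.2 hdet
    obtain ⟨u, hu⟩ := Function.ne_iff.1 hz
    exact ⟨|z|, lap_mulVec_abs hm h, pos_of_lap_mulVec_eq_zero hm hc (lap_mulVec_abs hm h)
      (fun v => abs_nonneg _) (u := u) (by simpa using hu)⟩

/-- If `z` is positive at `u`, then `z + |z|` is a nonnegative kernel vector that is positive at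
`u`, hence everywhere. Then `z` is positive everywhere and its sum is not zero. -/
theorem eq_zero_of_sum_eq_zero {z : ι → ℤ} (hz : lap m *ᵥ z = 0) (hs : ∑ v, z v = 0) : z = 0 := by
  have key : ∀ z : ι → ℤ, lap m *ᵥ z = 0 → ∑ v, z v = 0 → ∀ u, z u ≤ 0 := by
    intro z hz hs u
    by_contra! hu
    have h := pos_of_lap_mulVec_eq_zero hm hc (z := z + |z|)
      (by rw [mulVec_add, hz, lap_mulVec_abs hm hz, add_zero])
      (fun v => by have := neg_abs_le (z v); simp; omega) (u := u)
      (by have := abs_nonneg (z u); simp; omega)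
    have h' : ∀ v ∈ Finset.univ, 0 < z v := by
      intro v _
      by_contra! hv
      have := h v
      simp [abs_of_nonpos hv] at this
    exact (Finset.sum_pos h' ⟨u, Finset.mem_univ u⟩).ne' hs
  funext u
  refine le_antisymm (key z hz hs u) ?_
  have := key (-z) (by rw [mulVec_neg, hz, neg_zero]) (by simp [hs]) u
  simpa using this

variable {e : ι → ℤ} (he : Nonempty ι → ∑ v, e v = 1)
include he

-- Every column of `lap m + vecMulVec e 1` sums to 1.
omit hm hc in
theorem sum_add_vecMulVec_mulVec (z : ι → ℤ) :
    ∑ v, ((lap m + vecMulVec e 1) *ᵥ z) v = ∑ v, z v := by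
  rcases isEmpty_or_nonempty ι with h | h
  · simp
  · simp only [add_mulVec, Pi.add_apply, Finset.sum_add_distrib, sum_lap_mulVec, zero_add,
      vecMulVec_one_mulVec, Pi.smul_apply, ← Finset.smul_sum, he h]
    simp

theorem det_lap_add_vecMulVec_ne_zero : (lap m + vecMulVec e 1).det ≠ 0 := by
  intro hdet
  obtain ⟨z, hz, h⟩ := exists_mulVec_eq_zero_iff.2 hdet
  have hs : ∑ v, z v = 0 := by
    rw [← sum_add_vecMulVec_mulVec he (m := m) z, h]
    simp
  rw [add_mulVec, vecMulVec_one_mulVec, hs] at h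
  exact hz (eq_zero_of_sum_eq_zero hm hc (by simpa using h) hs)

/-- Solvability of a linear system with a Laplacian matrix in terms of divisibility. -/
theorem exists_lap_mulVec_eq_iff {B : Matrix ι ι ℤ} {D : ℤ}
    (hB : (lap m + vecMulVec e 1) * B = D • 1) (hD : D ≠ 0) (y : ι → ℤ) :
    (∃ z, lap m *ᵥ z = y) ↔
      ∑ v, y v = 0 ∧ ∃ k : ℤ, ∀ v, D ∣ (B *ᵥ y) v + k * (B *ᵥ e) v := by
  -- A right inverse up to a scalar is also a left one: multiply by the adjugate and cancel the
  -- nonzero determinant.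
  have hBA : B * (lap m + vecMulVec e 1) = D • 1 := by
    have h1 : (lap m + vecMulVec e 1) * (B * (lap m + vecMulVec e 1) - D • 1) = 0 := by
      rw [mul_sub, ← mul_assoc, hB, smul_mul, one_mul, Matrix.mul_smul, mul_one, sub_self]
    have h2 := congrArg (fun M => adjugate (lap m + vecMulVec e 1) * M) h1
    simp only [← mul_assoc, adjugate_mul, smul_mul, one_mul, mul_zero] at h2
    exact sub_eq_zero.1 ((smul_eq_zero.1 h2).resolve_left
      (det_lap_add_vecMulVec_ne_zero hm hc he))
  constructor
  · rintro ⟨z, rfl⟩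
    -- The unknown `k` stands for the sum of the solution, the coefficient with which `e` enters.
    refine ⟨sum_lap_mulVec z, ∑ v, z v, fun v => ⟨z v, ?_⟩⟩
    have h : (lap m + vecMulVec e 1) *ᵥ z = lap m *ᵥ z + (∑ v, z v) • e := by
      rw [add_mulVec, vecMulVec_one_mulVec]
    have h2 := congrArg (fun w => (B *ᵥ w) v) h
    simp only [mulVec_mulVec, hBA, mulVec_add, mulVec_smul, smul_mulVec, one_mulVec] at h2
    rw [mulVec_mulVec]
    simpa using h2.symm
  · rintro ⟨hy, k, hk⟩
    choose z hz using hk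
    have h : (lap m + vecMulVec e 1) *ᵥ z = y + k • e := by
      have h1 : B *ᵥ (y + k • e) = D • z := by
        funext v
        rw [mulVec_add, mulVec_smul]
        simpa using hz v
      have h2 := congrArg (fun w => (lap m + vecMulVec e 1) *ᵥ w) h1
      simp only [mulVec_mulVec, hB, mulVec_smul, smul_mulVec, one_mulVec] at h2
      exact (smul_right_injective _ hD h2).symm
    refine ⟨z, ?_⟩
    rcases isEmpty_or_nonempty ι with hι | hι
    · exact Subsingleton.elim _ _
    -- Unit column sums and the zero sum of `y` force the sum of `z` to be `k`, so the rank-one term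
    -- cancels.
    · have hs : ∑ v, z v = k := by
        rw [← sum_add_vecMulVec_mulVec he (m := m) z, h]
        simp [Finset.sum_add_distrib, hy, ← Finset.mul_sum, he hι]
      rw [add_mulVec, vecMulVec_one_mulVec, hs] at h
      simpa using h

end Laplacian

end LaplacianSystem

/-! ### Linear equivalence and the Laplacian -/

namespace CompactRibbonGraph

open LaplacianSystem Matrix

variable (D : CompactRibbonGraph)

/-- The number of out-edges. -/
def deg (u : Fin D.n) : ℕ := (D.outHeads u).length

/-- The effect on the chip at `v` of sending a chip from `u` along each of the first `j`
out-edges. -/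
def flow (u : Fin D.n) (j : ℕ) (v : Fin D.n) : ℤ :=
  ((D.outHeads u).take j).count v - if v = u then (j : ℤ) else 0

/-- The number of edges from `u` to `v`. -/
def mult (v u : Fin D.n) : ℤ := (D.outHeads u).count v

theorem mult_nonneg (v u : Fin D.n) : 0 ≤ D.mult v u := Int.natCast_nonneg _

theorem sum_mult (u : Fin D.n) : ∑ v, D.mult v u = D.deg u := by
  simp only [mult, deg]
  rw [← Nat.cast_sum, Nat.cast_inj]
  simpa using (Multiset.sum_count_eq_card (s := Finset.univ) (m := ((D.outHeads u : List (Fin D.n)) :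
    Multiset (Fin D.n))) (fun _ _ => Finset.mem_univ _))

theorem lap_mult (v u : Fin D.n) : lap D.mult v u = D.flow u (D.deg u) v := by
  rw [lap, sum_mult, flow, mult, deg, List.take_length]

theorem flow_zero (u v : Fin D.n) : D.flow u 0 v = 0 := by
  simp [flow]

theorem flow_succ (u : Fin D.n) {j : ℕ} (hj : j < (D.outHeads u).length) (v : Fin D.n) :
    D.flow u (j + 1) v = D.flow u j v + (Pi.single ((D.outHeads u)[j]) 1 - Pi.single u 1 :
      Fin D.n → ℤ) v := by
  rw [flow, flow, List.take_succ_eq_append_getElem hj, List.count_append, List.count_singleton]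
  simp only [Pi.sub_apply, Pi.single_apply, beq_iff_eq, eq_comm (a := v)]
  push_cast
  split_ifs <;> ring

variable {D}

theorem val_finRotate (m : ℕ) (i : Fin m) : (finRotate m i : ℕ) = (i + 1) % m := by
  cases m with
  | zero => exact i.elim0
  | succ m =>
    rw [finRotate_apply, Fin.val_add]
    simp

/-- The position of the rotor at a vertex. -/
def pos (c : D.toRibbonGraph.DRC) (v : Fin D.n) : ℕ := (c.rotor v).2

theorem rotor_eq (c : D.toRibbonGraph.DRC) (v : Fin D.n) :
    ∃ i : Fin (D.outHeads v).length, c.rotor v = ⟨v, i⟩ := by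
  have h := c.tail_rotor v
  generalize c.rotor v = e at h
  obtain ⟨u, i⟩ := e
  obtain rfl : u = v := h
  exact ⟨i, rfl⟩

theorem pos_lt (c : D.toRibbonGraph.DRC) (v : Fin D.n) : D.pos c v < D.deg v := by
  obtain ⟨i, hi⟩ := rotor_eq c v
  rw [pos, hi]
  exact i.2

theorem rotor_ext {c c' : D.toRibbonGraph.DRC} (h : ∀ v, pos c v = pos c' v) :
    c.rotor = c'.rotor := by
  funext v
  obtain ⟨i, hi⟩ := rotor_eq c v
  obtain ⟨j, hj⟩ := rotor_eq c' v
  have h := h v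
  rw [pos, pos, hi, hj] at h
  obtain rfl : i = j := Fin.ext h
  rw [hi, hj]

theorem rotor_route (c : D.toRibbonGraph.DRC) (v : Fin D.n) :
    (c.route v).rotor = Function.update c.rotor v (D.toRibbonGraph.next (c.rotor v)) := rfl

theorem pos_route (c : D.toRibbonGraph.DRC) (v w : Fin D.n) :
    pos (c.route v) w = if w = v then (pos c v + 1) % D.deg v else pos c w := by
  split_ifs with h
  · subst h
    obtain ⟨i, hi⟩ := rotor_eq c w
    rw [pos, pos, rotor_route, Function.update_self, hi]
    exact val_finRotate _ _
  · rw [pos, pos, rotor_route, Function.update_of_ne h]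

theorem chips_route (c : D.toRibbonGraph.DRC) (v : Fin D.n) :
    ∃ h : (pos c v + 1) % D.deg v < (D.outHeads v).length, (c.route v).chips =
      c.chips + (Pi.single ((D.outHeads v)[(pos c v + 1) % D.deg v]) 1 - Pi.single v 1) := by
  have hlt : (pos c v + 1) % D.deg v < (D.outHeads v).length :=
    Nat.mod_lt _ (Nat.zero_lt_of_lt (pos_lt c v))
  refine ⟨hlt, ?_⟩
  obtain ⟨i, hi⟩ := rotor_eq c v
  have h : D.toRibbonGraph.head (D.toRibbonGraph.next (c.rotor v)) =
      (D.outHeads v)[(pos c v + 1) % D.deg v] := by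
    simp only [pos, hi]
    change (D.outHeads v).get (finRotate _ i) = _
    rw [List.get_eq_getElem]
    congr 1
    refine (val_finRotate _ _).trans ?_
    rw [hi]
    rfl
  rw [RibbonGraph.DRC.route]
  dsimp only
  rw [h]
  abel

/-- The chips that are left when all rotors are turned back. -/
def potential (c : D.toRibbonGraph.DRC) (v : Fin D.n) : ℤ :=
  c.chips v - ∑ u, D.flow u (pos c u + 1) v

/-- The chip moves along the edge that the rotor reaches, and `flow` accounts for the same edge;
hence the `+ 1` in `potential`. Only when the rotor returns to position 0 is a full turn `flow v
(deg v)`, a Laplacian column, dropped from the sum. The quotient is 1 in that case and 0 otherwise.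
-/
theorem potential_route (c : D.toRibbonGraph.DRC) (v : Fin D.n) :
    potential (c.route v) = potential c +
      lap D.mult *ᵥ (((pos c v + 1) / D.deg v : ℕ) • Pi.single v 1) := by
  obtain ⟨hlt, h⟩ := chips_route c v
  have hp := pos_lt c v
  funext w
  have hsum : ∑ u, D.flow u (pos (c.route v) u + 1) w = ∑ u, D.flow u (pos c u + 1) w +
      (D.flow v ((pos c v + 1) % D.deg v + 1) w - D.flow v (pos c v + 1) w) := by
    rw [← Finset.add_sum_erase _ _ (Finset.mem_univ v),
      ← Finset.add_sum_erase Finset.univ (fun u => D.flow u (pos c u + 1) w) (Finset.mem_univ v),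
      pos_route, if_pos rfl, Finset.sum_congr rfl fun u hu => by
        rw [pos_route, if_neg (Finset.ne_of_mem_erase hu)]]
    ring
  have hchips := congrFun h w
  have hflow := D.flow_succ v hlt w
  rw [Pi.add_apply] at hchips
  generalize (Pi.single ((D.outHeads v)[(pos c v + 1) % D.deg v]'hlt) 1 - Pi.single v 1 :
    Fin D.n → ℤ) w = x at hchips hflow
  rw [potential, hchips, hsum, hflow, Pi.add_apply, mulVec_smul,
    Pi.smul_apply, mulVec_single_one, col_apply, lap_mult, potential]
  rcases Nat.lt_or_ge (pos c v + 1) (D.deg v) with h | h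
  · rw [Nat.div_eq_of_lt h, Nat.mod_eq_of_lt h]
    simp
  · have h : pos c v + 1 = D.deg v := le_antisymm hp h
    rw [h, Nat.div_self (by omega), Nat.mod_self, flow_zero]
    simp only [one_smul]
    ring

theorem potential_eq_of_linEquiv {c c' : D.toRibbonGraph.DRC} (h : c.LinEquiv c') :
    ∃ z, lap D.mult *ᵥ z = potential c' - potential c := by
  induction h with
  | refl => exact ⟨0, by simp⟩
  | @tail b _ _ hab ih =>
    obtain ⟨z, hz⟩ := ih
    obtain ⟨v, rfl⟩ := hab
    refine ⟨z + ((pos b v + 1) / D.deg v : ℕ) • Pi.single v 1, ?_⟩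
    rw [mulVec_add, hz, potential_route]
    abel

/-- For `j` routings at one vertex, the remainder is the final rotor position and the quotient
counts the completed turns. -/
theorem exists_linEquiv_route (c : D.toRibbonGraph.DRC) (v : Fin D.n) (j : ℕ) :
    ∃ c', c.LinEquiv c' ∧ (∀ w, pos c' w = if w = v then (pos c v + j) % D.deg v else pos c w) ∧
      potential c' = potential c +
        lap D.mult *ᵥ (((pos c v + j) / D.deg v : ℕ) • Pi.single v 1) := by
  induction j with
  | zero =>
    refine ⟨c, .refl, fun w => ?_, ?_⟩
    · split_ifs with h
      · rw [h, add_zero, Nat.mod_eq_of_lt (pos_lt c v)]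
      · rfl
    · rw [add_zero, Nat.div_eq_of_lt (pos_lt c v)]
      simp
  | succ j ih =>
    obtain ⟨c', h1, h2, h3⟩ := ih
    refine ⟨c'.route v, h1.tail ⟨v, rfl⟩, fun w => ?_, ?_⟩
    · rw [pos_route, h2 v, if_pos rfl, h2 w, Nat.mod_add_mod, add_assoc]
      split_ifs <;> rfl
    · rw [potential_route, h3, h2 v, if_pos rfl, add_assoc, ← mulVec_add, ← add_smul]
      congr 3
      have hd := Nat.zero_lt_of_lt (pos_lt c v)
      conv_rhs => rw [← add_assoc, ← Nat.div_add_mod (pos c v + j) (D.deg v), add_assoc,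
        Nat.mul_add_div hd]

theorem exists_linEquiv_pos (c : D.toRibbonGraph.DRC) (p : Fin D.n → ℕ) (hp : ∀ v, p v < D.deg v) :
    ∃ c', c.LinEquiv c' ∧ ∀ v, pos c' v = p v := by
  have key : ∀ s : Finset (Fin D.n), ∃ c', c.LinEquiv c' ∧ ∀ v ∈ s, pos c' v = p v := by
    intro s
    induction s using Finset.induction_on with
    | empty => exact ⟨c, .refl, by simp⟩
    | insert v s hv ih =>
      obtain ⟨c', h1, h2⟩ := ih
      -- First advance to the end of the turn and then to `p v`, so that the number of routings is a
      -- natural number.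
      obtain ⟨c'', h3, h4, -⟩ := exists_linEquiv_route c' v (D.deg v - pos c' v + p v)
      refine ⟨c'', h1.trans h3, fun w hw => ?_⟩
      rw [h4]
      split_ifs with h
      · have := pos_lt c' v
        rw [h, show pos c' v + (D.deg v - pos c' v + p v) = D.deg v + p v by omega,
          Nat.add_mod_left, Nat.mod_eq_of_lt (hp v)]
      · exact h2 w (Finset.mem_of_mem_insert_of_ne hw h)
  obtain ⟨c', h1, h2⟩ := key Finset.univ
  exact ⟨c', h1, fun v => h2 v (Finset.mem_univ v)⟩

theorem exists_linEquiv_potential (c : D.toRibbonGraph.DRC) (z : Fin D.n → ℕ) :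
    ∃ c', c.LinEquiv c' ∧ (∀ v, pos c' v = pos c v) ∧
      potential c' = potential c + lap D.mult *ᵥ fun v => (z v : ℤ) := by
  have key : ∀ s : Finset (Fin D.n), ∃ c', c.LinEquiv c' ∧ (∀ v, pos c' v = pos c v) ∧
      potential c' = potential c + lap D.mult *ᵥ ∑ v ∈ s, z v • Pi.single v 1 := by
    intro s
    induction s using Finset.induction_on with
    | empty => exact ⟨c, .refl, by simp⟩
    | insert v s hv ih =>
      obtain ⟨c', h1, h2, h3⟩ := ih
      have hp := pos_lt c' v
      -- These are `z v` full turns, after which the rotor is where it was.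
      obtain ⟨c'', h4, h5, h6⟩ := exists_linEquiv_route c' v (D.deg v * z v)
      refine ⟨c'', h1.trans h4, fun w => ?_, ?_⟩
      · rw [h5, Nat.add_mul_mod_self_left, Nat.mod_eq_of_lt hp]
        split_ifs with h
        · rw [h, h2]
        · exact h2 w
      · rw [h6, h3, Nat.add_mul_div_left _ _ (by omega), Nat.div_eq_of_lt hp, zero_add,
          Finset.sum_insert hv, mulVec_add, add_assoc, add_comm (lap D.mult *ᵥ _)]
  obtain ⟨c', h1, h2, h3⟩ := key Finset.univ
  refine ⟨c', h1, h2, h3.trans ?_⟩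
  congr 2
  funext v
  simp [Finset.sum_apply, Pi.single_apply]

theorem mult_pos_of_edge {u v : Fin D.n}
    (h : ∃ e : D.Edge, D.toRibbonGraph.tail e = u ∧ D.toRibbonGraph.head e = v) :
    0 < D.mult v u := by
  obtain ⟨⟨w, i⟩, h1, h2⟩ := h
  obtain rfl : w = u := h1
  obtain rfl : (D.outHeads w).get i = v := h2
  rw [mult, Nat.cast_pos, List.count_pos_iff]
  exact List.get_mem _ _

/-- Two configurations are linearly equivalent if and only if their potentials differ by an
element of the image of the Laplacian. -/
theorem linEquiv_iff (hD : D.toRibbonGraph.StronglyConnected) (c c' : D.toRibbonGraph.DRC) :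
    c.LinEquiv c' ↔ ∃ z, lap D.mult *ᵥ z = potential c' - potential c := by
  refine ⟨potential_eq_of_linEquiv, ?_⟩
  rintro ⟨z, hz⟩
  -- Once the rotors agree with those of `c'`, the remaining difference is in the chips alone.
  obtain ⟨c₁, h1, h2⟩ := exists_linEquiv_pos c (pos c') (pos_lt c')
  obtain ⟨z₁, hz₁⟩ := potential_eq_of_linEquiv h1
  obtain ⟨p, hp, hpos⟩ := exists_pos_lap_mulVec_eq_zero D.mult_nonneg
    fun u v => Relation.ReflTransGen.mono (fun _ _ => mult_pos_of_edge) u v (hD u v)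
  -- Routings cannot be undone directly. Adding a multiple of the positive kernel vector makes all
  -- numbers of turns nonnegative and leaves the effect unchanged.
  obtain ⟨N, hN⟩ : ∃ N : ℤ, ∀ v, 0 ≤ z v - z₁ v + N * p v := by
    refine ⟨∑ v, |z v - z₁ v|, fun v => ?_⟩
    have h3 := Finset.single_le_sum (f := fun v => |z v - z₁ v|) (fun v _ => abs_nonneg _)
      (Finset.mem_univ v)
    have h4 := neg_abs_le (z v - z₁ v)
    have h5 := hpos v
    have h6 := abs_nonneg (z v - z₁ v)
    nlinarith
  obtain ⟨c₂, h3, h4, h5⟩ := exists_linEquiv_potential c₁ fun v => (z v - z₁ v + N * p v).toNat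
  have h6 : potential c₂ = potential c' := by
    rw [h5, show (fun v => (((z v - z₁ v + N * p v).toNat : ℕ) : ℤ)) = z - z₁ + N • p from
      funext fun v => by simpa using hN v, mulVec_add, mulVec_sub, mulVec_smul, hp, hz, hz₁]
    simp
  have h7 : ∀ v, pos c₂ v = pos c' v := fun v => (h4 v).trans (h2 v)
  -- With equal rotors the flow terms agree, so equal potentials mean equal chips.
  have h8 : c₂ = c' := by
    refine RibbonGraph.DRC.ext (funext fun v => ?_) (rotor_ext h7)
    have := congrFun h6 v
    simp only [potential, h7] at this
    linarith
  rw [← h8]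
  exact h1.trans h3

end CompactRibbonGraph

/-! ### The decision algorithm and its running time -/

namespace PolyTime

open Polynomial
open Enc

/-! ### Reading the numbers of the input word. -/

section Parse

/-- One step of the parser, which reads the input backwards. A group of numbers ends with a
semicolon or a bar. -/
def parseStep (a : InputSymbol) (s : List (List ℤ)) : List (List ℤ) :=
  if a = .semicolon ∨ a = .bar then [] :: s
  else (if a = .comma then 0 :: s.headD []
    else (if a = .minus then -(s.headD []).headD 0
      else 2 * (s.headD []).headD 0 + if a = .bit true then 1 else 0) :: (s.headD []).tail) :: s.tail

/-- The groups of numbers in the input. -/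
def parse (w : List InputSymbol) : List (List ℤ) := w.foldr parseStep []

variable {γ : Type} [Enc γ]

/-- The tree of a symbol is also the tree of a list of units, whose length identifies the symbol. -/
theorem PT.decide_symbolEq {f : γ → InputSymbol} (hf : PT f) (a : InputSymbol) :
    PT fun c => decide (f c = a) := by
  let idx : InputSymbol → ℕ
    | .bit false => 0
    | .bit true => 1
    | .minus => 2
    | .comma => 3
    | .semicolon => 4
    | .bar => 5
  have hidx : Function.Injective idx := by
    intro a b
    rcases a with (_ | _) | _ | _ | _ | _ <;> rcases b with (_ | _) | _ | _ | _ | _ <;> simp [idx]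
  have h : PT fun a : InputSymbol => List.replicate (idx a) () :=
    PT.of_enc_eq_id fun a => by rcases a with (_ | _) | _ | _ | _ | _ <;> rfl
  have h := PT.comp h hf
  have h' : PT fun c => decide ((List.replicate (idx (f c)) ()).length = idx a) := by fun_prop
  exact h'.of_eq fun c => by simp [hidx.eq_iff]

theorem esize_parseStep_le (a : InputSymbol) (s : List (List ℤ)) :
    esize (parseStep a s) ≤ esize s + 40 := by
  have h0 : esize (0 : ℤ) = 3 := by rw [esize_int]; rfl
  have h1 : ∀ z b : ℤ, b = 0 ∨ b = 1 → esize (2 * z + b) ≤ esize z + 12 := by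
    intro z b hb
    have h : (2 * z + b).natAbs ≤ Nat.bit true z.natAbs := by
      rw [Nat.bit_val]
      simp
      omega
    have h := (Nat.size_le_size h).trans (size_bit_le _ _)
    rw [esize_int, esize_int]
    omega
  have h2 : ∀ z : ℤ, esize (-z) = esize z := by
    intro z
    rw [esize_int, esize_int, Int.natAbs_neg]
  have key : ∀ (b : ℤ), b = 0 ∨ b = 1 → ∀ z, esize (if a = .minus then -z else 2 * z + b) ≤
      esize z + 12 := by
    intro b hb z
    have := h2 z
    have := h1 z b hb
    split_ifs <;> omega
  have hb : (if a = .bit true then (1 : ℤ) else 0) = 0 ∨ (if a = .bit true then (1 : ℤ) else 0) = 1 := by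
    split_ifs <;> simp
  have key := key _ hb
  unfold parseStep
  rcases s with _ | ⟨_ | ⟨z, g⟩, s⟩
  · have := key 0
    simp only [List.headD_nil, List.tail_nil]
    split_ifs at * <;> simp only [esize_cons, esize_nil] at * <;> omega
  · have := key 0
    simp only [List.headD_cons, List.headD_nil, List.tail_cons, List.tail_nil]
    split_ifs at * <;> simp only [esize_cons, esize_nil] at * <;> omega
  · have := key z
    simp only [List.headD_cons, List.tail_cons]
    split_ifs at * <;> simp only [esize_cons, esize_nil] at * <;> omega

theorem PT.or_prop {P Q : γ → Prop} [DecidablePred P] [DecidablePred Q]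
    (hP : PT fun c => decide (P c)) (hQ : PT fun c => decide (Q c)) :
    PT fun c => decide (P c ∨ Q c) :=
  (PT.or hP hQ).of_eq fun c => by simp

@[fun_prop]
theorem PT.parse {w : γ → List InputSymbol} (hw : PT w) : PT fun c => parse (w c) := by
  refine PT.foldr_of_le_add (l := w) (init := fun _ => []) (step := fun _ => parseStep) ?_
    (by fun_prop) hw ⟨40, fun c a s => by simpa using esize_parseStep_le a s⟩
  have h : PT fun p : γ × List (List ℤ) × InputSymbol => p.2.2 := by fun_prop
  have h₁ := h.decide_symbolEq .semicolon
  have h₂ := h.decide_symbolEq .bar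
  have h₃ := h.decide_symbolEq .comma
  have h₄ := h.decide_symbolEq .minus
  have h₅ := h.decide_symbolEq (.bit true)
  have h₆ := h₁.or_prop h₂
  unfold parseStep
  fun_prop

end Parse

/-! ### Matrices as lists of rows, and size bounds for the recursion. -/

section Tables

variable {α β γ : Type} [Enc α] [Enc β] [Enc γ]

/-- The entries of a matrix. -/
def ent (M : List (List ℤ)) (i j : ℕ) : ℤ := (M.getD i []).getD j 0

@[fun_prop]
theorem PT.ent {M : γ → List (List ℤ)} {i j : γ → ℕ} (hM : PT M) (hi : PT i) (hj : PT j) :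
    PT fun c => ent (M c) (i c) (j c) := by
  unfold PolyTime.ent
  fun_prop

/-- The matrix with the given entries. -/
def table (r : List ℕ) (f : ℕ → ℕ → ℤ) : List (List ℤ) := r.map fun i => r.map (f i)

@[fun_prop]
theorem PT.table {r : γ → List ℕ} {f : γ → ℕ → ℕ → ℤ}
    (hf : PT fun p : γ × ℕ × ℕ => f p.1 p.2.1 p.2.2) (hr : PT r) :
    PT fun c => table (r c) (f c) := by
  refine PT.map (f := fun c i => (r c).map (f c i)) ?_ hr
  refine PT.map (l := fun p : γ × ℕ => r p.1) (f := fun p => f p.1 p.2) ?_ (by fun_prop)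
  exact PT.comp (f := fun p : γ × ℕ × ℕ => f p.1 p.2.1 p.2.2)
    (g := fun p : (γ × ℕ) × ℕ => (p.1.1, p.1.2, p.2)) hf (by fun_prop)

/-- The sum of the values of a function on a list. -/
def sumOver (r : List ℕ) (f : ℕ → ℤ) : ℤ := (r.map f).sum

@[fun_prop]
theorem PT.sumOver {r : γ → List ℕ} {f : γ → ℕ → ℤ} (hf : PT fun p : γ × ℕ => f p.1 p.2)
    (hr : PT r) : PT fun c => sumOver (r c) (f c) :=
  PT.listSum (PT.map hf hr)

theorem esize_list_le {l : List α} {K : ℕ} (h : ∀ a ∈ l, esize a ≤ K) :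
    esize l ≤ l.length * (K + 1) + 1 := by
  induction l with
  | nil => simp [esize_nil]
  | cons a l ih =>
    have h1 := h a List.mem_cons_self
    have h2 := ih fun b hb => h b (List.mem_cons_of_mem _ hb)
    rw [esize_cons, List.length_cons, add_mul, one_mul]
    omega

theorem abs_sumOver_le {r : List ℕ} {f : ℕ → ℤ} {M : ℤ} (h : ∀ i ∈ r, |f i| ≤ M) :
    |sumOver r f| ≤ r.length * M := by
  induction r with
  | nil => simp [PolyTime.sumOver]
  | cons i r ih =>
    have h1 := h i List.mem_cons_self
    have h2 := ih fun j hj => h j (List.mem_cons_of_mem _ hj)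
    have h3 : sumOver (i :: r) f = f i + sumOver r f := by simp [PolyTime.sumOver]
    rw [h3, List.length_cons]
    push_cast
    have := abs_add_le (f i) (sumOver r f)
    linarith

theorem esize_table_le {r : List ℕ} {f : ℕ → ℕ → ℤ} {K : ℕ} (h : ∀ i j, |f i j| ≤ 2 ^ K) :
    esize (table r f) ≤ r.length * (r.length * (6 * K + 10) + 2) + 1 := by
  refine (esize_list_le (K := r.length * (6 * K + 10) + 1) fun l hl => ?_).trans (by
    simp [PolyTime.table])
  obtain ⟨i, -, rfl⟩ := List.mem_map.1 hl
  refine (esize_list_le (K := 6 * K + 9) fun z hz => ?_).trans (by simp)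
  obtain ⟨j, -, rfl⟩ := List.mem_map.1 hz
  have := esize_int_le (z := f i j) (k := K + 1) ((h i j).trans_lt (by
    rw [pow_succ]
    have : (0 : ℤ) < 2 ^ K := by positivity
    linarith))
  omega

theorem abs_ent_table_le {r : List ℕ} {f : ℕ → ℕ → ℤ} {M : ℤ} (hM : 0 ≤ M)
    (h : ∀ i j, |f i j| ≤ M) (i j : ℕ) : |ent (table r f) i j| ≤ M := by
  have key : ∀ (l : List ℤ), (∀ z ∈ l, |z| ≤ M) → |l.getD j 0| ≤ M := by
    intro l hl
    rcases lt_or_ge j l.length with hj | hj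
    · rw [List.getD_eq_getElem _ _ hj]
      exact hl _ (List.getElem_mem hj)
    · rw [List.getD_eq_default _ _ hj]
      simpa using hM
  refine key _ fun z hz => ?_
  rcases lt_or_ge i (table r f).length with hi | hi
  · rw [List.getD_eq_getElem _ _ hi] at hz
    simp only [PolyTime.table, List.getElem_map, List.mem_map] at hz
    obtain ⟨k, -, rfl⟩ := hz
    exact h _ _
  · rw [List.getD_eq_default _ _ hi] at hz
    simp at hz

theorem esize_getD_le (l : List α) (i : ℕ) (d : α) : esize (l.getD i d) ≤ esize l + esize d := by
  rcases lt_or_ge i l.length with hi | hi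
  · rw [List.getD_eq_getElem _ _ hi]
    have := esize_le_of_mem (List.getElem_mem hi)
    omega
  · rw [List.getD_eq_default _ _ hi]
    omega

theorem abs_ent_le (M : List (List ℤ)) (i j : ℕ) : |ent M i j| ≤ 2 ^ (esize M + 4) := by
  have h1 := esize_getD_le (M.getD i []) j 0
  have h2 := esize_getD_le M i []
  have h3 : esize (0 : ℤ) = 3 := by rw [esize_int]; rfl
  rw [esize_nil] at h2
  refine (abs_lt_two_pow_esize _).le.trans (pow_le_pow_right₀ (by norm_num) ?_)
  simp only [PolyTime.ent]
  omega

/-- The entries of a product of matrices. -/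
def mulEnt (r : List ℕ) (A N : List (List ℤ)) (i j : ℕ) : ℤ :=
  sumOver r fun k => ent A i k * ent N k j

/-- The trace of a product of matrices. -/
def traceMul (r : List ℕ) (A N : List (List ℤ)) : ℤ := sumOver r fun i => mulEnt r A N i i

/-- One step of the Faddeev–LeVerrier algorithm, which also keeps the data of the last step. -/
def faddeevStep (x : List ℕ × List (List ℤ)) (s : List (List ℤ) × List (List ℤ) × ℤ) (k : ℕ) :
    List (List ℤ) × List (List ℤ) × ℤ :=
  (table x.1 fun i j => (k + 1) * mulEnt x.1 x.2 s.1 i j -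
      if i = j then traceMul x.1 x.2 s.1 else 0,
    table x.1 fun i j => (k + 1) * ent s.1 i j, traceMul x.1 x.2 s.1)

/-- The Faddeev–LeVerrier algorithm. -/
def faddeevLoop (x : List ℕ × List (List ℤ)) : List (List ℤ) × List (List ℤ) × ℤ :=
  x.1.foldl (faddeevStep x) (table x.1 fun i j => if i = j then 1 else 0, [], 1)

@[fun_prop]
theorem PT.mulEnt {r : γ → List ℕ} {A N : γ → List (List ℤ)} {i j : γ → ℕ} (hr : PT r) (hA : PT A)
    (hN : PT N) (hi : PT i) (hj : PT j) : PT fun c => mulEnt (r c) (A c) (N c) (i c) (j c) := by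
  unfold PolyTime.mulEnt
  fun_prop

@[fun_prop]
theorem PT.traceMul {r : γ → List ℕ} {A N : γ → List (List ℤ)} (hr : PT r) (hA : PT A)
    (hN : PT N) : PT fun c => traceMul (r c) (A c) (N c) := by
  unfold PolyTime.traceMul
  fun_prop

/-- With `S = esize x + 4`, the dimension, the entries of the matrix and the factors `k + 1` are all
at most `2 ^ S`. A step multiplies the bound for the entries by at most `2 ^ (4 * S)`, and there are
at most `S` steps, so `4 * S * S` bits suffice. The constant 24 comes from six nodes per bit. -/
theorem esize_foldl_faddeevStep_le (x : List ℕ × List (List ℤ)) (l : List ℕ) (hl : l <+: x.1) :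
    esize (l.foldl (faddeevStep x) (table x.1 fun i j => if i = j then 1 else 0, [], 1)) ≤
      2 * ((esize x + 4) * ((esize x + 4) *
        (24 * (esize x + 4) * (esize x + 4) + 10) + 2) + 1) +
        24 * (esize x + 4) * (esize x + 4) + 12 := by
  obtain ⟨S, hS⟩ : ∃ S, esize x + 4 = S := ⟨_, rfl⟩
  have hS1 : 1 ≤ S := by omega
  rw [esize_prod] at hS
  have hlen : x.1.length ≤ S := by
    have := length_lt_esize x.1
    omega
  have hlen2 : (x.1.length : ℤ) ≤ 2 ^ S := by exact_mod_cast hlen.trans Nat.lt_two_pow_self.le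
  have hk : ∀ k ∈ x.1, ((k : ℤ) + 1) ≤ 2 ^ S := by
    intro k hk
    have h1 := esize_le_of_mem hk
    have h2 := lt_two_pow_esize k
    have h3 : 2 ^ esize k ≤ 2 ^ S := Nat.pow_le_pow_right (by norm_num) (by omega)
    exact_mod_cast h2.trans_le h3
  have hA : ∀ i j, |ent x.2 i j| ≤ 2 ^ S := fun i j =>
    (abs_ent_le _ _ _).trans (pow_le_pow_right₀ (by norm_num) (by omega))
  -- Here `t` counts the steps done, so the bound for the entries is `2 ^ (4 * S * t)`.
  have key : ∀ l : List ℕ, l ⊆ x.1 → ∀ t s, t + l.length ≤ x.1.length →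
      (∀ i j, |ent s.1 i j| ≤ 2 ^ (4 * S * t)) →
      esize s.1 ≤ S * (S * (24 * S * S + 10) + 2) + 1 →
      esize s.2.1 ≤ S * (S * (24 * S * S + 10) + 2) + 1 →
      |s.2.2| ≤ 2 ^ (4 * S * S) →
      esize (l.foldl (faddeevStep x) s) ≤ 2 * (S * (S * (24 * S * S + 10) + 2) + 1) +
        24 * S * S + 12 := by
    intro l
    induction l with
    | nil =>
      intro _ t s _ _ h2 h3 h4
      have := esize_int_le (z := s.2.2) (k := 4 * S * S + 1) (h4.trans_lt (by
        rw [pow_succ]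
        have : (0 : ℤ) < 2 ^ (4 * S * S) := by positivity
        linarith))
      have h5 : 4 * S * S * 6 = 24 * S * S := by ring
      rw [List.foldl_nil, esize_prod, esize_prod]
      omega
    | cons k l ih =>
      intro hsub t s ht h1 h2 h3 h4
      have hkr := hk k (hsub List.mem_cons_self)
      rw [List.length_cons] at ht
      set M : ℤ := 2 ^ (4 * S * t) with hM
      have hM0 : 0 < M := by positivity
      have hP0 : (1 : ℤ) ≤ 2 ^ S := one_le_pow₀ (by norm_num)
      have hP2 : (2 : ℤ) ≤ 2 ^ S := by
        calc (2 : ℤ) = 2 ^ 1 := by norm_num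
          _ ≤ 2 ^ S := pow_le_pow_right₀ (by norm_num) hS1
      set P : ℤ := 2 ^ S with hP
      have hmul : ∀ i j, |mulEnt x.1 x.2 s.1 i j| ≤ P * (P * M) := by
        intro i j
        refine (abs_sumOver_le (M := P * M) fun k _ => ?_).trans ?_
        · rw [abs_mul]
          exact mul_le_mul (hA i k) (h1 k j) (abs_nonneg _) (by positivity)
        · exact mul_le_mul_of_nonneg_right hlen2 (by positivity)
      have htr : |traceMul x.1 x.2 s.1| ≤ P * (P * (P * M)) := by
        refine (abs_sumOver_le (M := P * (P * M)) fun i _ => hmul i i).trans ?_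
        exact mul_le_mul_of_nonneg_right hlen2 (by positivity)
      -- Three factors `P` bound each of the two terms of the new entry: the length of the inner
      -- sum, an entry of the matrix, and either `k + 1` or the length of the trace. The fourth
      -- absorbs the factor 2 from adding the terms.
      have hPM : P * (P * (P * (P * M))) = 2 ^ (4 * S * (t + 1)) := by
        rw [hP, hM, ← pow_add, ← pow_add, ← pow_add, ← pow_add]
        congr 1
        ring
      have hk0 : |((k : ℤ) + 1)| ≤ P := by
        rw [abs_of_nonneg (by positivity)]
        exact hkr
      have hN : ∀ i j : ℕ, |((k : ℤ) + 1) * mulEnt x.1 x.2 s.1 i j -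
          if i = j then traceMul x.1 x.2 s.1 else 0| ≤ 2 ^ (4 * S * (t + 1)) := by
        intro i j
        have h5 : |((k : ℤ) + 1) * mulEnt x.1 x.2 s.1 i j| ≤ P * (P * (P * M)) := by
          rw [abs_mul]
          exact mul_le_mul hk0 (hmul i j) (abs_nonneg _) (by positivity)
        have h6 : |(if i = j then traceMul x.1 x.2 s.1 else 0 : ℤ)| ≤ P * (P * (P * M)) := by
          split_ifs
          · exact htr
          · rw [abs_zero]
            positivity
        have h7 := abs_sub (((k : ℤ) + 1) * mulEnt x.1 x.2 s.1 i j)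
          (if i = j then traceMul x.1 x.2 s.1 else 0)
        have h8 : 2 * (P * (P * (P * M))) ≤ P * (P * (P * (P * M))) :=
          mul_le_mul_of_nonneg_right hP2 (by positivity)
        rw [← hPM]
        linarith
      have hB : ∀ i j : ℕ, |((k : ℤ) + 1) * ent s.1 i j| ≤ 2 ^ (4 * S * (t + 1)) := by
        intro i j
        have h5 : |((k : ℤ) + 1) * ent s.1 i j| ≤ P * M := by
          rw [abs_mul]
          exact mul_le_mul hk0 (h1 i j) (abs_nonneg _) (by positivity)
        have h6 : P * M ≤ P * (P * (P * (P * M))) := by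
          have : ∀ z : ℤ, 0 ≤ z → z ≤ P * z := fun z hz => le_mul_of_one_le_left hz hP0
          exact (this _ (by positivity)).trans ((this _ (by positivity)).trans
            (this _ (by positivity)))
        rw [← hPM]
        linarith
      have hT : ∀ f : ℕ → ℕ → ℤ, (∀ i j, |f i j| ≤ 2 ^ (4 * S * (t + 1))) →
          esize (table x.1 f) ≤ S * (S * (24 * S * S + 10) + 2) + 1 := by
        intro f hf
        refine (esize_table_le hf).trans ?_
        have h5 : 6 * (4 * S * (t + 1)) ≤ 24 * S * S := by
          calc 6 * (4 * S * (t + 1)) = 24 * S * (t + 1) := by ring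
            _ ≤ 24 * S * S := Nat.mul_le_mul_left _ (by omega)
        gcongr
      refine ih (fun a ha => hsub (List.mem_cons_of_mem _ ha)) (t + 1) (faddeevStep x s k)
        (by omega) ?_ (hT _ hN) (hT _ hB) ?_
      · exact abs_ent_table_le (by positivity) hN
      · refine htr.trans ?_
        have h5 : P * (P * (P * M)) ≤ P * (P * (P * (P * M))) :=
          le_mul_of_one_le_left (by positivity) hP0
        refine (h5.trans hPM.le).trans (pow_le_pow_right₀ (by norm_num) ?_)
        exact Nat.mul_le_mul_left _ (by omega)
  have h0 : ∀ i j : ℕ, |(if i = j then (1 : ℤ) else 0)| ≤ 2 ^ 0 := by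
    intro i j
    split_ifs <;> simp
  have hS' : esize x + 4 = S := by rw [esize_prod]; omega
  rw [hS']
  refine key l hl.subset 0 _ (by simpa using hl.length_le) ?_ ?_ ?_ ?_
  · rw [mul_zero]
    exact abs_ent_table_le (by norm_num) h0
  · refine (esize_table_le h0).trans ?_
    have : 6 * 0 + 10 ≤ 24 * S * S + 10 := by omega
    gcongr
  · rw [esize_nil]
    omega
  · simpa using one_le_pow₀ (by norm_num : (1 : ℤ) ≤ 2)

@[fun_prop]
theorem PT.faddeevLoop {x : γ → List ℕ × List (List ℤ)} (hx : PT x) :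
    PT fun c => faddeevLoop (x c) := by
  refine PT.comp (f := PolyTime.faddeevLoop) ?_ hx
  refine PT.foldl (l := fun x : List ℕ × List (List ℤ) => x.1)
    (init := fun x => (PolyTime.table x.1 fun i j => if i = j then 1 else 0, [], 1))
    (step := faddeevStep) ?_ ?_ (by fun_prop) ⟨2 * ((X + 4) * ((X + 4) *
        (24 * (X + 4) * (X + 4) + 10) + 2) + 1) + 24 * (X + 4) * (X + 4) + 12, fun x l hl => ?_⟩
  · unfold faddeevStep
    fun_prop
  · fun_prop
  · have := esize_foldl_faddeevStep_le x l hl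
    simpa using this

end Tables

end PolyTime

namespace PolyTime

open Polynomial
open Enc

/-! ### Merging congruences in one unknown. -/

section Congruences

variable {γ : Type} [Enc γ]

/-- The remainder of `x` modulo `d`, as a natural number. -/
def modNat (x : ℤ) (d : ℕ) : ℕ := if d = 0 then 0 else (x % d).toNat

@[fun_prop]
theorem PT.modNat {x : γ → ℤ} {d : γ → ℕ} (hx : PT x) (hd : PT d) :
    PT fun c => modNat (x c) (d c) := by
  unfold PolyTime.modNat
  fun_prop

/-- The default 0 for `d = 0` makes this unconditional, so the size bounds need no positive modulus.
-/
theorem modNat_le (x : ℤ) (d : ℕ) : modNat x d ≤ d := by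
  unfold modNat
  split_ifs with h
  · exact Nat.zero_le _
  · have := Int.emod_lt_of_pos x (show (0 : ℤ) < d by omega)
    omega

/-- One step of the Euclidean algorithm for the coefficients of a pair of congruences
`d ∣ c + k * g`, each given by `(g, c)`. -/
def euclidStep (d : ℕ) (s : (ℕ × ℕ) × (ℕ × ℕ)) : (ℕ × ℕ) × (ℕ × ℕ) :=
  if s.2.1 = 0 then s
  else (s.2, (s.1.1 % s.2.1, modNat ((s.1.2 : ℤ) - ((s.1.1 / s.2.1 : ℕ) : ℤ) * (s.2.2 : ℤ)) d))

/-- The Euclidean algorithm for the coefficients of a pair of congruences. -/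
def euclid (d : ℕ) (s : (ℕ × ℕ) × (ℕ × ℕ)) : (ℕ × ℕ) × (ℕ × ℕ) :=
  (false :: (s.1.1.bits ++ s.2.1.bits)).foldl (fun s _ => euclidStep d s) s

@[fun_prop]
theorem PT.euclidStep {d : γ → ℕ} {s : γ → (ℕ × ℕ) × (ℕ × ℕ)} (hd : PT d) (hs : PT s) :
    PT fun c => euclidStep (d c) (s c) := by
  unfold PolyTime.euclidStep
  fun_prop

/-- The second pair moves to the front, and the new coefficient is no larger than the old first one.
Only the new constant term, at most `d`, needs extra room. -/
theorem esize_euclidStep_le (d : ℕ) (s : (ℕ × ℕ) × (ℕ × ℕ)) :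
    esize (euclidStep d s) ≤ esize s + esize d := by
  unfold euclidStep
  split_ifs with h
  · omega
  · have h1 := esize_nat_mono (Nat.mod_le s.1.1 s.2.1)
    have h2 := esize_nat_mono
      (modNat_le ((s.1.2 : ℤ) - ((s.1.1 / s.2.1 : ℕ) : ℤ) * (s.2.2 : ℤ)) d)
    simp only [esize_prod]
    omega

@[fun_prop]
theorem PT.euclid {d : γ → ℕ} {s : γ → (ℕ × ℕ) × (ℕ × ℕ)} (hd : PT d) (hs : PT s) :
    PT fun c => euclid (d c) (s c) := by
  refine PT.foldl_of_le_add (l := fun c => false :: ((s c).1.1.bits ++ (s c).2.1.bits)) (init := s)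
    (step := fun c s _ => PolyTime.euclidStep (d c) s) (by fun_prop) hs (by fun_prop) ?_
  obtain ⟨q, hq⟩ := hd.esize_le
  refine ⟨q, fun c s a => (esize_euclidStep_le _ _).trans ?_⟩
  have := (hq c).trans (eval_mono q (show esize c ≤ esize c + esize a by omega))
  omega

/-- All the entries are at most `d`. -/
def EntriesLE (d : ℕ) (s : (ℕ × ℕ) × (ℕ × ℕ)) : Prop :=
  (s.1.1 ≤ d ∧ s.1.2 ≤ d) ∧ s.2.1 ≤ d ∧ s.2.2 ≤ d

theorem EntriesLE.euclidStep {d : ℕ} {s : (ℕ × ℕ) × (ℕ × ℕ)} (h : EntriesLE d s) :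
    EntriesLE d (euclidStep d s) := by
  unfold PolyTime.euclidStep
  split_ifs
  · exact h
  · exact ⟨h.2, (Nat.mod_le _ _).trans h.1.1, modNat_le _ _⟩

theorem EntriesLE.euclid {d : ℕ} {s : (ℕ × ℕ) × (ℕ × ℕ)} (h : EntriesLE d s) :
    EntriesLE d (euclid d s) := by
  unfold PolyTime.euclid
  generalize false :: (s.1.1.bits ++ s.2.1.bits) = l
  induction l generalizing s with
  | nil => exact h
  | cons a l ih => exact ih h.euclidStep

/-- Adds the congruence `d ∣ p.2 + k * p.1` to a system that is equivalent to a condition and the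
congruence `d ∣ t.2.2 + k * t.2.1`. -/
def congStep (d : ℕ) (t : Bool × ℕ × ℕ) (p : ℤ × ℤ) : Bool × ℕ × ℕ :=
  (t.1 && decide ((euclid d (t.2, (modNat p.1 d, modNat p.2 d))).2.2 % d = 0),
    (euclid d (t.2, (modNat p.1 d, modNat p.2 d))).1)

/-- Solvability of a system of congruences `d ∣ p.2 + k * p.1` in the unknown `k`. -/
def congSolvable (d : ℕ) (ps : List (ℤ × ℤ)) : Bool :=
  (ps.foldl (congStep d) (true, d, 0)).1 &&
    decide ((ps.foldl (congStep d) (true, d, 0)).2.2 %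
      (ps.foldl (congStep d) (true, d, 0)).2.1 = 0)

@[fun_prop]
theorem PT.congStep {d : γ → ℕ} {t : γ → Bool × ℕ × ℕ} {p : γ → ℤ × ℤ} (hd : PT d) (ht : PT t)
    (hp : PT p) : PT fun c => congStep (d c) (t c) (p c) := by
  unfold PolyTime.congStep
  fun_prop

/-- Since no number exceeds `d`, the nested folds cannot accumulate growth; this is the size bound
required by `PT.foldl`. -/
theorem foldl_congStep_le (d : ℕ) (ps : List (ℤ × ℤ)) (t : Bool × ℕ × ℕ)
    (h : t.2.1 ≤ d ∧ t.2.2 ≤ d) :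
    (ps.foldl (congStep d) t).2.1 ≤ d ∧ (ps.foldl (congStep d) t).2.2 ≤ d := by
  induction ps generalizing t with
  | nil => exact h
  | cons p ps ih =>
    refine ih _ (EntriesLE.euclid (d := d) (s := (t.2, (modNat p.1 d, modNat p.2 d))) ?_).1
    exact ⟨h, modNat_le _ _, modNat_le _ _⟩

@[fun_prop]
theorem PT.congSolvable {d : γ → ℕ} {ps : γ → List (ℤ × ℤ)} (hd : PT d) (hp : PT ps) :
    PT fun c => congSolvable (d c) (ps c) := by
  have h : PT fun c => (ps c).foldl (PolyTime.congStep (d c)) (true, d c, 0) := by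
    refine PT.foldl (l := ps) (init := fun c => (true, d c, 0))
      (step := fun c => PolyTime.congStep (d c)) (by fun_prop) (by fun_prop) hp ?_
    obtain ⟨q, hq⟩ := hd.esize_le
    refine ⟨2 * q + 5, fun c l _ => ?_⟩
    have h1 := foldl_congStep_le (d c) l (true, d c, 0) ⟨le_rfl, Nat.zero_le _⟩
    have h2 := esize_nat_mono h1.1
    have h3 := esize_nat_mono h1.2
    have h4 := hq c
    have h5 := esize_bool_le (l.foldl (PolyTime.congStep (d c)) (true, d c, 0)).1
    simp only [esize_prod, eval_add, eval_mul, eval_ofNat]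
    omega
  unfold PolyTime.congSolvable
  fun_prop

end Congruences

/-! ### The decision procedure on parsed inputs. -/

section Main

variable {γ : Type} [Enc γ]

/-- Groups the elements of a list of even length into pairs. -/
def pairUp (l : List ℤ) : List (ℤ × ℤ) :=
  (l.foldr (fun a (s : List ℤ × List (ℤ × ℤ)) =>
    if s.1.isEmpty = true then ([a], s.2) else ([], (a, s.1.headD 0) :: s.2)) ([], [])).2

@[fun_prop]
theorem PT.pairUp {l : γ → List ℤ} (hl : PT l) : PT fun c => pairUp (l c) := by
  refine PT.snd (PT.foldr_of_le_add (l := l) (init := fun _ => ([], [])) (step := fun _ a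
    (s : List ℤ × List (ℤ × ℤ)) => if s.1.isEmpty = true then ([a], s.2) else
      ([], (a, s.1.headD 0) :: s.2)) (PT.cond (by fun_prop) (by fun_prop) (by fun_prop))
      (by fun_prop) hl ⟨X + 3, fun c a s => ?_⟩)
  rcases s with ⟨_ | ⟨b, m⟩, s⟩ <;>
    simp [esize_prod, esize_cons, esize_nil] <;> omega

theorem pairUp_flatMap {α : Type} (l : List α) (f g : α → ℤ) :
    pairUp (l.flatMap fun x => [f x, g x]) = l.map fun x => (f x, g x) := by
  have key : (l.flatMap fun x => [f x, g x]).foldr (fun a (s : List ℤ × List (ℤ × ℤ)) =>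
      if s.1.isEmpty = true then ([a], s.2) else ([], (a, s.1.headD 0) :: s.2)) ([], []) =
      ([], l.map fun x => (f x, g x)) := by
    induction l with
    | nil => rfl
    | cons x l ih => rw [List.flatMap_cons, List.foldr_append, ih]; rfl
  rw [pairUp, key]

/-- For a list of runs, the number of edges to `v` among the first `j` edges. -/
def cnt (l : List (ℤ × ℤ)) (j v : ℕ) : ℕ :=
  (l.foldl (fun (s : ℕ × ℕ) p => (s.1 - p.2.toNat, s.2 + if p.1 = (v : ℤ) then
    (if p.2.toNat ≤ s.1 then p.2.toNat else s.1) else 0)) (j, 0)).2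

@[fun_prop]
theorem PT.cnt {l : γ → List (ℤ × ℤ)} {j v : γ → ℕ} (hl : PT l) (hj : PT j) (hv : PT v) :
    PT fun c => cnt (l c) (j c) (v c) := by
  refine PT.snd (PT.foldl_of_le_add (l := l) (init := fun c => (j c, 0)) (step := fun c
    (s : ℕ × ℕ) p => (s.1 - p.2.toNat, s.2 + if p.1 = (v c : ℤ) then
    (if p.2.toNat ≤ s.1 then p.2.toNat else s.1) else 0)) (by fun_prop) (by fun_prop) hl
      ⟨X + 6, fun c s p => ?_⟩)
  have h1 := esize_nat_mono (Nat.sub_le s.1 p.2.toNat)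
  have h2 := esize_add_le s.2 (if p.1 = (v c : ℤ) then
    (if p.2.toNat ≤ s.1 then p.2.toNat else s.1) else 0)
  have h3 : (if p.1 = (v c : ℤ) then (if p.2.toNat ≤ s.1 then p.2.toNat else s.1) else 0) ≤
      p.2.natAbs := by
    split_ifs <;> omega
  have h4 := Nat.size_le_size h3
  have h5 := esize_nat (if p.1 = (v c : ℤ) then
    (if p.2.toNat ≤ s.1 then p.2.toNat else s.1) else 0)
  have h6 := esize_int p.2
  simp only [esize_prod, eval_add, eval_X, eval_ofNat]
  omega

/-- The effect on the chips at `v` of sending a chip from `u` along each of the first `j`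
out-edges, given the runs of `u`. -/
def flowOf (l : List (ℤ × ℤ)) (u j v : ℕ) : ℤ := cnt l j v - if v = u then (j : ℤ) else 0

@[fun_prop]
theorem PT.flowOf {l : γ → List (ℤ × ℤ)} {u j v : γ → ℕ} (hl : PT l) (hu : PT u) (hj : PT j)
    (hv : PT v) : PT fun c => flowOf (l c) (u c) (j c) (v c) := by
  unfold PolyTime.flowOf
  fun_prop

/-- The runs of the vertex `u`. -/
def runsOf (G : List (List ℤ)) (u : ℕ) : List (ℤ × ℤ) := pairUp (G.getD u [])

/-- The number of out-edges of the vertex `u`. -/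
def degOf (G : List (List ℤ)) (u : ℕ) : ℕ := ((runsOf G u).map fun p : ℤ × ℤ => p.2).sum.toNat

/-- The entries of the matrix of the linear system. -/
def matOf (G : List (List ℤ)) (v u : ℕ) : ℤ :=
  flowOf (runsOf G u) u (degOf G u) v + if v = 0 then 1 else 0

/-- The potential of the configuration `c` at `v`. -/
def potentialOf (r : List ℕ) (G : List (List ℤ)) (c : List (ℤ × ℤ)) (v : ℕ) : ℤ :=
  (c.getD v (0, 0)).1 -
    sumOver r fun u => flowOf (runsOf G u) u ((c.getD u (0, 0)).2.toNat + 1) v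

@[fun_prop]
theorem PT.runsOf {G : γ → List (List ℤ)} {u : γ → ℕ} (hG : PT G) (hu : PT u) :
    PT fun c => runsOf (G c) (u c) := by
  unfold PolyTime.runsOf
  fun_prop

@[fun_prop]
theorem PT.degOf {G : γ → List (List ℤ)} {u : γ → ℕ} (hG : PT G) (hu : PT u) :
    PT fun c => degOf (G c) (u c) := by
  unfold PolyTime.degOf
  fun_prop

@[fun_prop]
theorem PT.matOf {G : γ → List (List ℤ)} {v u : γ → ℕ} (hG : PT G) (hv : PT v) (hu : PT u) :
    PT fun c => matOf (G c) (v c) (u c) := by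
  unfold PolyTime.matOf
  fun_prop

@[fun_prop]
theorem PT.potentialOf {r : γ → List ℕ} {G : γ → List (List ℤ)} {c : γ → List (ℤ × ℤ)} {v : γ → ℕ}
    (hr : PT r) (hG : PT G) (hc : PT c) (hv : PT v) :
    PT fun x => potentialOf (r x) (G x) (c x) (v x) := by
  unfold PolyTime.potentialOf
  fun_prop

/-- The decision algorithm for the linear system with the matrix `A` and the right-hand side
`y`, where `F` comes from the Faddeev–LeVerrier algorithm. -/
def systemSolvable (r : List ℕ) (F : List (List ℤ) × List (List ℤ) × ℤ) (y : List ℤ) : Bool :=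
  decide ((sumOver r fun i => y.getD i 0) = 0) &&
    congSolvable F.2.2.natAbs
      (r.map fun i => (ent F.2.1 i 0, sumOver r fun j => ent F.2.1 i j * y.getD j 0))

@[fun_prop]
theorem PT.systemSolvable {r : γ → List ℕ} {F : γ → List (List ℤ) × List (List ℤ) × ℤ}
    {y : γ → List ℤ} (hr : PT r) (hF : PT F) (hy : PT y) :
    PT fun c => systemSolvable (r c) (F c) (y c) := by
  unfold PolyTime.systemSolvable
  fun_prop

/-- The decision algorithm for the groups of numbers in the input: the runs of the vertices, an
empty group, and the two configurations. -/
def decideGroups (G : List (List ℤ)) : Bool :=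
  -- Three groups do not belong to vertices. Only the length matters here, so dropping three at the
  -- front gives the number of vertices.
  systemSolvable (List.range G.tail.tail.tail.length)
    (faddeevLoop (List.range G.tail.tail.tail.length,
      table (List.range G.tail.tail.tail.length) (matOf G)))
    ((List.range G.tail.tail.tail.length).map fun v =>
      potentialOf (List.range G.tail.tail.tail.length) G (pairUp (G.reverse.headD [])) v -
        potentialOf (List.range G.tail.tail.tail.length) G (pairUp (G.reverse.tail.headD [])) v)

@[fun_prop]
theorem PT.decideGroups {G : γ → List (List ℤ)} (hG : PT G) : PT fun c => decideGroups (G c) := by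
  unfold PolyTime.decideGroups
  fun_prop

end Main

end PolyTime

/-! ### Correctness of the algorithm -/

namespace PolyTime

/-! ### Correctness of the congruence solver. -/

section Euclid

theorem natCast_modNat (x : ℤ) {d : ℕ} (hd : 0 < d) : (modNat x d : ℤ) = x % d := by
  have := Int.emod_nonneg x (show (d : ℤ) ≠ 0 by omega)
  rw [modNat, if_neg hd.ne', Int.toNat_of_nonneg this]

/-- `k` solves both congruences. -/
def Solves (d : ℕ) (k : ℤ) (s : (ℕ × ℕ) × (ℕ × ℕ)) : Prop :=
  (d : ℤ) ∣ s.1.2 + k * s.1.1 ∧ (d : ℤ) ∣ s.2.2 + k * s.2.1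

/-- A multiple of one congruence is subtracted from the other, and reducing the constant term modulo
`d` does not matter. -/
theorem solves_euclidStep {d : ℕ} (hd : 0 < d) (k : ℤ) (s : (ℕ × ℕ) × (ℕ × ℕ)) :
    Solves d k (euclidStep d s) ↔ Solves d k s := by
  unfold euclidStep
  split_ifs with h
  · rfl
  · obtain ⟨⟨g, c⟩, q, w⟩ := s
    simp only [Solves, natCast_modNat _ hd]
    rw [and_comm]
    refine and_congr_left fun h2 => ?_
    rw [Int.natCast_mod, Int.natCast_div, Int.emod_def, Int.emod_def]
    set x : ℤ := (g : ℤ) / q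
    rw [show (c : ℤ) - x * w - d * ((c - x * w) / d) + k * (g - q * x) =
      (c + k * g) - (x * (w + k * q) + d * ((c - x * w) / d)) by ring]
    exact dvd_sub_left (dvd_add (h2.mul_left x) (dvd_mul_right _ _))

theorem gcd_euclidStep (d : ℕ) (s : (ℕ × ℕ) × (ℕ × ℕ)) :
    (euclidStep d s).1.1.gcd (euclidStep d s).2.1 = s.1.1.gcd s.2.1 := by
  unfold euclidStep
  split_ifs with h
  · rfl
  · rw [Nat.gcd_comm s.1.1, Nat.gcd_rec s.2.1 s.1.1, Nat.gcd_comm]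

theorem euclidStep_lt (d : ℕ) (s : (ℕ × ℕ) × (ℕ × ℕ)) (h : s.2.1 ≠ 0) :
    (euclidStep d s).2.1 < (euclidStep d s).1.1 := by
  rw [euclidStep, if_neg h]
  exact Nat.mod_lt _ (Nat.pos_of_ne_zero h)

/-- When the second coefficient is the smaller one, twice the remainder is at most the first
coefficient, so each step at least halves the product of the coefficients. -/
theorem foldl_euclidStep {α : Type} (d : ℕ) (l : List α) (s : (ℕ × ℕ) × (ℕ × ℕ))
    (h : s.2.1 = 0 ∨ s.2.1 < s.1.1 ∧ s.1.1 * s.2.1 < 2 ^ l.length) :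
    (l.foldl (fun s _ => euclidStep d s) s).2.1 = 0 := by
  induction l generalizing s with
  | nil =>
    rcases h with h | ⟨h1, h2⟩
    · exact h
    · have h2 : s.1.1 * s.2.1 = 0 := by simpa using h2
      rcases Nat.mul_eq_zero.1 h2 with h | h
      · omega
      · exact h
  | cons a l ih =>
    refine ih _ ?_
    by_cases h0 : s.2.1 = 0
    · left
      change (euclidStep d s).2.1 = 0
      rwa [euclidStep, if_pos h0]
    · obtain ⟨h1, h2⟩ := h.resolve_left h0
      refine .inr ⟨euclidStep_lt d s h0, ?_⟩
      change (euclidStep d s).1.1 * (euclidStep d s).2.1 < _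
      rw [euclidStep, if_neg h0]
      dsimp only
      rw [List.length_cons, pow_succ] at h2
      have h3 : 2 * (s.1.1 % s.2.1) ≤ s.1.1 := by
        have := Nat.mod_add_div s.1.1 s.2.1
        have := Nat.mod_lt s.1.1 (Nat.pos_of_ne_zero h0)
        have : s.2.1 * 1 ≤ s.2.1 * (s.1.1 / s.2.1) :=
          Nat.mul_le_mul_left _ (Nat.div_pos h1.le (Nat.pos_of_ne_zero h0))
        omega
      nlinarith [Nat.mul_le_mul_left s.2.1 h3]

theorem euclid_spec {d : ℕ} (hd : 0 < d) (s : (ℕ × ℕ) × (ℕ × ℕ)) :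
    (∀ k, Solves d k (euclid d s) ↔ Solves d k s) ∧ (euclid d s).1.1 = s.1.1.gcd s.2.1 ∧
      (euclid d s).2.1 = 0 := by
  have h0 : (euclid d s).2.1 = 0 := by
    -- The leading `false` pays for one preliminary step, after which the second coefficient is zero
    -- or smaller than the first.
    rw [euclid, List.foldl_cons]
    refine foldl_euclidStep _ _ _ ?_
    by_cases h0 : s.2.1 = 0
    · left
      rwa [euclidStep, if_pos h0]
    · refine .inr ⟨euclidStep_lt d s h0, ?_⟩
      rw [euclidStep, if_neg h0, List.length_append, Nat.size_eq_bits_len,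
        Nat.size_eq_bits_len, pow_add, mul_comm]
      exact Nat.mul_lt_mul'' ((Nat.mod_le _ _).trans_lt (Nat.lt_size_self _)) (Nat.lt_size_self _)
  have key : ∀ l : List Bool, ∀ s,
      (∀ k, Solves d k (l.foldl (fun s _ => euclidStep d s) s) ↔ Solves d k s) ∧
      (l.foldl (fun s _ => euclidStep d s) s).1.1.gcd
        (l.foldl (fun s _ => euclidStep d s) s).2.1 = s.1.1.gcd s.2.1 := by
    intro l
    induction l with
    | nil => exact fun s => ⟨fun _ => Iff.rfl, rfl⟩
    | cons a l ih =>
      intro s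
      exact ⟨fun k => ((ih _).1 k).trans (solves_euclidStep hd k s),
        ((ih _).2).trans (gcd_euclidStep d s)⟩
  obtain ⟨h1, h2⟩ := key (false :: (s.1.1.bits ++ s.2.1.bits)) s
  refine ⟨h1, ?_, h0⟩
  change (euclid d s).1.1.gcd (euclid d s).2.1 = _ at h2
  rwa [h0, Nat.gcd_zero_right] at h2

/-- Euclid's algorithm turns two congruences into one whose coefficient is the gcd and one with
coefficient 0. The latter is a plain divisibility, recorded in the truth value. The coefficient
remains a divisor of `d`. -/
theorem foldl_congStep {d : ℕ} (hd : 0 < d) (ps : List (ℤ × ℤ)) (t : Bool × ℕ × ℕ)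
    (ht : t.2.1 ∣ d) :
    (ps.foldl (congStep d) t).2.1 ∣ d ∧ ∀ k : ℤ,
      ((ps.foldl (congStep d) t).1 = true ∧
        (d : ℤ) ∣ (ps.foldl (congStep d) t).2.2 + k * (ps.foldl (congStep d) t).2.1) ↔
      (t.1 = true ∧ (d : ℤ) ∣ t.2.2 + k * t.2.1) ∧ ∀ p ∈ ps, (d : ℤ) ∣ p.2 + k * p.1 := by
  induction ps generalizing t with
  | nil => exact ⟨ht, fun k => by simp⟩
  | cons p ps ih =>
    obtain ⟨h1, h2, h3⟩ := euclid_spec hd (t.2, (modNat p.1 d, modNat p.2 d))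
    obtain ⟨h4, h5⟩ := ih (congStep d t p) (by
      change (euclid d (t.2, (modNat p.1 d, modNat p.2 d))).1.1 ∣ d
      rw [h2]
      exact (Nat.gcd_dvd_left _ _).trans ht)
    refine ⟨h4, fun k => (h5 k).trans ?_⟩
    have h1 := h1 k
    rw [Solves, h3] at h1
    have hmod : (d : ℤ) ∣ (modNat p.2 d : ℤ) + k * (modNat p.1 d : ℤ) ↔
        (d : ℤ) ∣ p.2 + k * p.1 := by
      rw [natCast_modNat _ hd, natCast_modNat _ hd, Int.emod_def, Int.emod_def,
        show p.2 - d * (p.2 / d) + k * (p.1 - d * (p.1 / d)) =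
          p.2 + k * p.1 - d * (p.2 / d + k * (p.1 / d)) by ring]
      exact dvd_sub_left (dvd_mul_right _ _)
    simp only [Solves, Nat.cast_zero, mul_zero, add_zero, hmod, Int.natCast_dvd_natCast] at h1
    simp only [congStep, Bool.and_eq_true, decide_eq_true_iff, ← Nat.dvd_iff_mod_eq_zero,
      List.forall_mem_cons]
    tauto

/-- The fold starts with the vacuous congruence `d ∣ 0 + k * d`. For `g ∣ d`, the remaining
congruence `d ∣ c + k * g` has a solution exactly if `g ∣ c`: then `k = -(c / g)` makes the
right-hand side zero. -/
theorem congSolvable_iff {d : ℕ} (hd : 0 < d) (ps : List (ℤ × ℤ)) :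
    congSolvable d ps = true ↔ ∃ k : ℤ, ∀ p ∈ ps, (d : ℤ) ∣ p.2 + k * p.1 := by
  obtain ⟨h1, h2⟩ := foldl_congStep hd ps (true, d, 0) dvd_rfl
  have h3 : ∀ k : ℤ, (∀ p ∈ ps, (d : ℤ) ∣ p.2 + k * p.1) ↔ _ := fun k =>
    ((h2 k).trans (and_iff_right ⟨rfl, by simp⟩)).symm
  simp only [h3, exists_and_left]
  rw [congSolvable, Bool.and_eq_true, decide_eq_true_iff, ← Nat.dvd_iff_mod_eq_zero]
  refine and_congr_right fun _ => ⟨?_, ?_⟩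
  · rintro ⟨m, hm⟩
    refine ⟨-m, ?_⟩
    rw [hm]
    push_cast
    rw [show ∀ x : ℤ, x * m + -m * x = 0 from fun x => by ring]
    exact dvd_zero _
  · rintro ⟨k, hk⟩
    have h4 := (Int.natCast_dvd_natCast.2 h1).trans hk
    exact Int.natCast_dvd_natCast.1 ((dvd_add_left (dvd_mul_left _ _)).1 h4)

end Euclid

/-! ### Correctness of the matrix computation. -/

section Tables

open Matrix LaplacianSystem

theorem getD_map_range (n : ℕ) {β : Type} (f : ℕ → β) (d : β) {i : ℕ} (hi : i < n) :
    ((List.range n).map f).getD i d = f i := by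
  rw [List.getD_eq_getElem _ _ (by simpa using hi)]
  simp

theorem ent_table (n : ℕ) (f : ℕ → ℕ → ℤ) (i j : Fin n) :
    ent (table (List.range n) f) i j = f i j := by
  rw [ent, table, getD_map_range _ _ _ i.2, getD_map_range _ _ _ j.2]

theorem sumOver_range (n : ℕ) (f : ℕ → ℤ) : sumOver (List.range n) f = ∑ i : Fin n, f i := by
  rw [Fin.sum_univ_eq_sum_range, sumOver, ← List.sum_toFinset _ List.nodup_range,
    List.toFinset_range]

variable {n : ℕ} {T : List (List ℤ)} {A : Matrix (Fin n) (Fin n) ℤ} (hT : ∀ i j : Fin n, ent T i j = A i j)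
include hT

theorem mulEnt_range {S : List (List ℤ)} {N : Matrix (Fin n) (Fin n) ℤ}
    (hS : ∀ i j : Fin n, ent S i j = N i j) (i j : Fin n) :
    mulEnt (List.range n) T S i j = (A * N) i j := by
  rw [mulEnt, sumOver_range, mul_apply]
  simp only [hT, hS]

theorem traceMul_range {S : List (List ℤ)} {N : Matrix (Fin n) (Fin n) ℤ}
    (hS : ∀ i j : Fin n, ent S i j = N i j) :
    traceMul (List.range n) T S = trace (A * N) := by
  rw [traceMul, sumOver_range, trace]
  simp only [mulEnt_range hT hS, diag_apply]

/-- After `n` steps the inverse is read off from the retained data of step `n - 1`; the first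
component serves only to continue the recursion. -/
theorem foldl_faddeevStep (k : ℕ) :
    let s := (List.range k).foldl (faddeevStep (List.range n, T))
      (table (List.range n) fun i j => if i = j then 1 else 0, [], 1)
    (∀ i j : Fin n, ent s.1 i j = faddeev A k i j) ∧ ∀ m, k = m + 1 →
      (∀ i j : Fin n, ent s.2.1 i j = ((m + 1 : ℕ) • faddeev A m) i j) ∧
        s.2.2 = trace (A * faddeev A m) := by
  induction k with
  | zero =>
    refine ⟨fun i j => ?_, fun m hm => by omega⟩
    rw [List.range_zero, List.foldl_nil, ent_table, faddeev, one_apply]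
    simp only [Fin.ext_iff]
  | succ k ih =>
    intro s
    obtain ⟨h, -⟩ := ih
    have hs : s = faddeevStep (List.range n, T) ((List.range k).foldl
      (faddeevStep (List.range n, T))
      (table (List.range n) fun i j => if i = j then 1 else 0, [], 1)) k := by
      simp only [s, List.range_succ, List.foldl_append, List.foldl_cons, List.foldl_nil]
    rw [hs, faddeevStep]
    refine ⟨fun i j => ?_, fun m hm => ?_⟩
    · rw [ent_table, mulEnt_range hT h, traceMul_range hT h, faddeev]
      simp only [Matrix.sub_apply, Matrix.smul_apply, one_apply, Fin.ext_iff, smul_eq_mul, mul_ite, mul_one,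
        mul_zero, Nat.cast_add, Nat.cast_one]
    · obtain rfl : m = k := by omega
      refine ⟨fun i j => ?_, traceMul_range hT h⟩
      rw [ent_table, h]
      simp

theorem systemSolvable_iff (hA : A.det ≠ 0) {y : List ℤ} {y' : Fin n → ℤ}
    (hy : ∀ i : Fin n, y.getD i 0 = y' i) :
    ∃ (B : Matrix (Fin n) (Fin n) ℤ) (D : ℤ), A * B = D • 1 ∧ D ≠ 0 ∧
      (systemSolvable (List.range n) (faddeevLoop (List.range n, T)) y = true ↔
        ∑ v, y' v = 0 ∧ ∃ k : ℤ, ∀ v, D ∣ (B *ᵥ y') v +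
          k * (B *ᵥ fun i => if (i : ℕ) = 0 then 1 else 0) v) := by
  rcases n with _ | n
  -- Without vertices the loop returns its initial value, whose last component 1 is a valid modulus.
  · refine ⟨1, 1, Subsingleton.elim _ _, one_ne_zero, ?_⟩
    have h : systemSolvable (List.range 0) (faddeevLoop (List.range 0, T)) y = true := by
      have := (congSolvable_iff one_pos []).2 ⟨0, by simp⟩
      simp [systemSolvable, sumOver, faddeevLoop, this]
    simpa using h
  · obtain ⟨-, h⟩ := foldl_faddeevStep hT (n + 1)
    obtain ⟨h1, h2⟩ := h n rfl
    change ∀ i j : Fin (n + 1), ent (faddeevLoop (List.range (n + 1), T)).2.1 i j = _ at h1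
    change (faddeevLoop (List.range (n + 1), T)).2.2 = _ at h2
    have hD := trace_mul_faddeev_ne_zero A hA (k := n) (by simp)
    have hB := mul_faddeev A (k := n) (by simp)
    rw [Nat.cast_smul_eq_nsmul] at hB
    refine ⟨_, _, hB, hD, ?_⟩
    have hpos : 0 < (trace (A * faddeev A n)).natAbs := Int.natAbs_pos.2 hD
    rw [systemSolvable, Bool.and_eq_true, decide_eq_true_iff, h2, congSolvable_iff hpos,
      sumOver_range]
    simp only [hy, List.forall_mem_map, List.mem_range, Int.natCast_natAbs, abs_dvd]
    refine and_congr_right fun _ => exists_congr fun k => ?_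
    have key : ∀ v : Fin (n + 1), (sumOver (List.range (n + 1)) fun j =>
        ent (faddeevLoop (List.range (n + 1), T)).2.1 v j * y.getD j 0) =
        (((n + 1 : ℕ) • faddeev A n) *ᵥ y') v := by
      intro v
      rw [sumOver_range, mulVec, dotProduct]
      simp only [h1, hy]
    -- The product of the matrix with the indicator of the vertex 0 is its column 0.
    have key2 : ∀ v : Fin (n + 1), ent (faddeevLoop (List.range (n + 1), T)).2.1 v 0 =
        (((n + 1 : ℕ) • faddeev A n) *ᵥ fun i => if (i : ℕ) = 0 then 1 else 0) v := by
      intro v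
      have := h1 v 0
      rw [mulVec, dotProduct]
      simpa [← Fin.ext_iff (b := (0 : Fin (n + 1)))] using this
    constructor
    · intro h v
      rw [← key, ← key2]
      exact h v v.2
    · intro h v hv
      have := h ⟨v, hv⟩
      rwa [← key, ← key2] at this

end Tables

end PolyTime

namespace PolyTime

open InputSymbol CompactRibbonGraph

/-! ### Correctness of the parser. -/

section Parse

/-- Read backwards, the terminating comma comes first and opens the number 0. The digits then follow
from the most significant one on, as in Horner's scheme. -/
theorem foldr_encodeNat (m : ℕ) (g : List ℤ) (t : List (List ℤ)) :
    (encodeNat m).foldr parseStep (g :: t) = ((m : ℤ) :: g) :: t := by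
  rw [encodeNat, List.foldr_append]
  change (m.bits.map bit).foldr parseStep ((0 :: g) :: t) = _
  induction m using Nat.binaryRec' with
  | zero => rfl
  | bit b n h ih =>
    rw [Nat.bits_append_bit _ _ h, List.map_cons, List.foldr_cons, ih, Nat.bit_val]
    cases b <;> simp [parseStep]

theorem foldr_encodeInt (z : ℤ) (g : List ℤ) (t : List (List ℤ)) :
    (encodeInt z).foldr parseStep (g :: t) = (z :: g) :: t := by
  rw [encodeInt, List.foldr_append, foldr_encodeNat]
  split_ifs with h
  · simp [parseStep, abs_of_neg h]
  · simp [abs_of_nonneg (not_lt.1 h)]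

theorem foldr_flatMap {α : Type} (l : List α) (f : α → List InputSymbol) (g : α → List ℤ)
    (hf : ∀ a h t, (f a).foldr parseStep (h :: t) = (g a ++ h) :: t) (h : List ℤ)
    (t : List (List ℤ)) :
    (l.flatMap f).foldr parseStep (h :: t) = (l.flatMap g ++ h) :: t := by
  induction l with
  | nil => rfl
  | cons a l ih => rw [List.flatMap_cons, List.foldr_append, ih, hf, List.flatMap_cons,
      List.append_assoc]

/-- The numbers that describe the runs of `u`. -/
def runGroup (D : CompactRibbonGraph) (u : Fin D.n) : List ℤ :=
  (D.runs u).flatMap fun p => [((p.1 : ℕ) : ℤ), (p.2 : ℤ)]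

/-- The numbers that describe a configuration. -/
def configGroup {D : CompactRibbonGraph} (c : D.toRibbonGraph.DRC) : List ℤ :=
  (List.finRange D.n).flatMap fun u => [c.chips u, (pos c u : ℤ)]

/-- A group is opened by the symbol that ends it in the word. No number stands between the last
semicolon and the bar, whence the empty group. -/
theorem foldr_encodeGraph (D : CompactRibbonGraph) (s : List (List ℤ)) :
    (encodeGraph D).foldr parseStep s = (List.finRange D.n).map (runGroup D) ++ [] :: s := by
  rw [encodeGraph, List.foldr_append]
  change List.foldr parseStep ([] :: s) _ = _
  generalize [] :: s = s
  induction List.finRange D.n with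
  | nil => rfl
  | cons u l ih =>
    rw [List.flatMap_cons, List.foldr_append, ih, List.foldr_append, List.map_cons,
      List.cons_append]
    change List.foldr parseStep ([] :: _) _ = _
    rw [foldr_flatMap _ _ (fun p => [((p.1 : ℕ) : ℤ), (p.2 : ℤ)]), List.append_nil]
    · rfl
    · intro p h t
      rw [List.foldr_append, foldr_encodeNat, foldr_encodeNat]
      rfl

theorem foldr_encodeDRC {D : CompactRibbonGraph} (c : D.toRibbonGraph.DRC) (s : List (List ℤ)) :
    (encodeDRC c).foldr parseStep s = configGroup c :: s := by
  rw [encodeDRC, List.foldr_append]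
  change List.foldr parseStep ([] :: s) _ = _
  rw [foldr_flatMap _ _ (fun u => [c.chips u, (pos c u : ℤ)]), List.append_nil]
  · rfl
  · intro u h t
    rw [List.foldr_append, foldr_encodeNat, foldr_encodeInt]
    rfl

theorem parse_encodeInput (I : LinEquivInput) :
    parse (encodeInput I) = (List.finRange I.graph.n).map (runGroup I.graph) ++
      [[], configGroup I.config₁, configGroup I.config₂] := by
  rw [parse, encodeInput, List.foldr_append, List.foldr_append, foldr_encodeDRC, foldr_encodeDRC,
    foldr_encodeGraph]

end Parse

/-! ### Degrees and flows computed from compact runs. -/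

section Graph

/-- A run uses up the minimum of its multiplicity and the number of edges still to be taken, so
multiplicities in binary are never expanded. -/
theorem foldl_cnt {n : ℕ} (l : List (Fin n × ℕ)) (v : Fin n) (j a : ℕ) :
    ((l.map fun p => (((p.1 : ℕ) : ℤ), (p.2 : ℤ))).foldl (fun (s : ℕ × ℕ) p =>
      (s.1 - p.2.toNat, s.2 + if p.1 = ((v : ℕ) : ℤ) then
        (if p.2.toNat ≤ s.1 then p.2.toNat else s.1) else 0)) (j, a)).2 =
      a + ((l.flatMap fun p => List.replicate p.2 p.1).take j).count v := by
  induction l generalizing j a with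
  | nil => simp
  | cons p l ih =>
    rw [List.map_cons, List.foldl_cons, ih, List.flatMap_cons, List.take_append,
      List.count_append, List.take_replicate, List.count_replicate, List.length_replicate]
    simp only [Int.toNat_natCast, Nat.cast_inj, ← Fin.ext_iff, beq_iff_eq, ← min_def]
    rw [min_comm, add_assoc]

variable (D : CompactRibbonGraph) {G : List (List ℤ)}
  (hG : ∀ u : Fin D.n, G.getD u [] = runGroup D u)
include hG

theorem runsOf_eq (u : Fin D.n) :
    runsOf G u = (D.runs u).map fun p => (((p.1 : ℕ) : ℤ), (p.2 : ℤ)) := by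
  rw [runsOf, hG, runGroup, pairUp_flatMap]

theorem flowOf_eq (u : Fin D.n) (j : ℕ) (v : Fin D.n) :
    flowOf (runsOf G u) u j v = D.flow u j v := by
  rw [flowOf, cnt, runsOf_eq D hG, foldl_cnt, flow, outHeads, zero_add]
  simp only [Fin.ext_iff]

theorem degOf_eq (u : Fin D.n) : degOf G u = D.deg u := by
  rw [degOf, runsOf_eq D hG, deg, outHeads]
  induction D.runs u with
  | nil => rfl
  | cons p l ih =>
    rw [List.flatMap_cons, List.length_append, ← ih]
    have : 0 ≤ ((l.map fun p => (((p.1 : ℕ) : ℤ), (p.2 : ℤ))).map fun p => p.2).sum := by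
      refine List.sum_nonneg fun x hx => ?_
      simp only [List.map_map, List.mem_map] at hx
      obtain ⟨p, -, rfl⟩ := hx
      exact Int.natCast_nonneg _
    simp only [List.map_cons, List.sum_cons, List.length_replicate]
    omega

end Graph

end PolyTime

namespace PolyTime

open InputSymbol CompactRibbonGraph Matrix LaplacianSystem

theorem getD_map_finRange {n : ℕ} {β : Type} (f : Fin n → β) (d : β) (i : Fin n) (l : List β) :
    ((List.finRange n).map f ++ l).getD i d = f i := by
  rw [List.getD_append _ _ _ _ (by simp), List.getD_eq_getElem _ _ (by simp)]
  simp

theorem potentialOf_eq (D : CompactRibbonGraph) {G : List (List ℤ)}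
    (hG : ∀ u : Fin D.n, G.getD u [] = runGroup D u) (c : D.toRibbonGraph.DRC) (v : Fin D.n) :
    potentialOf (List.range D.n) G (pairUp (configGroup c)) v = potential c v := by
  have h : ∀ u : Fin D.n, (pairUp (configGroup c)).getD u (0, 0) = (c.chips u, (pos c u : ℤ)) := by
    intro u
    rw [configGroup, pairUp_flatMap, ← List.append_nil (List.map _ _), getD_map_finRange]
  rw [potentialOf, sumOver_range, potential]
  simp only [h, Int.toNat_natCast, flowOf_eq D hG]

theorem decideGroups_iff (I : LinEquivInput) :
    decideGroups (parse (encodeInput I)) = true ↔ I.config₁.LinEquiv I.config₂ := by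
  obtain ⟨D, -, hD, c₁, c₂⟩ := I
  dsimp only at *
  rw [parse_encodeInput, linEquiv_iff hD]
  dsimp only
  obtain ⟨G, hG⟩ : ∃ G, (List.finRange D.n).map (runGroup D) ++
      [[], configGroup c₁, configGroup c₂] = G := ⟨_, rfl⟩
  have hn : G.tail.tail.tail.length = D.n := by
    simp [← hG]
  have h1 : G.reverse.headD [] = configGroup c₂ := by
    simp [← hG]
  have h2 : G.reverse.tail.headD [] = configGroup c₁ := by
    simp [← hG]
  have hruns : ∀ u : Fin D.n, G.getD u [] = runGroup D u := by
    intro u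
    rw [← hG, getD_map_finRange]
  rw [hG, decideGroups, hn, h1, h2]
  let e : Fin D.n → ℤ := fun i => if (i : ℕ) = 0 then 1 else 0
  have he : Nonempty (Fin D.n) → ∑ i, e i = 1 := by
    rintro ⟨u⟩
    rw [Finset.sum_eq_single_of_mem ⟨0, u.pos⟩ (Finset.mem_univ _)]
    · simp [e]
    · intro i _ hi
      exact if_neg fun h => hi (Fin.ext h)
  have hc : ∀ u v : Fin D.n, Relation.ReflTransGen (fun a b => 0 < D.mult b a) u v :=
    fun u v => Relation.ReflTransGen.mono (fun _ _ => mult_pos_of_edge) u v (hD u v)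
  have hT : ∀ i j : Fin D.n, ent (table (List.range D.n) (matOf G)) i j =
      (lap D.mult + vecMulVec e 1 : Matrix (Fin D.n) (Fin D.n) ℤ) i j := by
    intro i j
    rw [ent_table, matOf, flowOf_eq D hruns, degOf_eq D hruns, ← lap_mult, Matrix.add_apply,
      vecMulVec_apply]
    simp [e]
  obtain ⟨B, d, hB, hd, h⟩ := systemSolvable_iff hT
    (det_lap_add_vecMulVec_ne_zero D.mult_nonneg hc he)
    (y := (List.range D.n).map fun v =>
      potentialOf (List.range D.n) G (pairUp (configGroup c₂)) v -
        potentialOf (List.range D.n) G (pairUp (configGroup c₁)) v)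
    (y' := potential c₂ - potential c₁) (fun i => by
      rw [getD_map_range _ _ _ i.2, potentialOf_eq D hruns, potentialOf_eq D hruns]
      rfl)
  rw [h, exists_lap_mulVec_eq_iff D.mult_nonneg hc he hB hd]

end PolyTime

theorem mainTheorem5 :
    DecidableInPolyTime InputSymbol.encodeInput
      (fun I : LinEquivInput => I.config₁.LinEquiv I.config₂) := by
  -- An input has the same tree as its word, so `InputSymbol.encodeInput` acts as the identity on
  -- trees.
  let _ : PolyTime.Enc LinEquivInput := ⟨fun I => PolyTime.Enc.enc (InputSymbol.encodeInput I)⟩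
  have h : PolyTime.PT fun I => InputSymbol.encodeInput I := .of_enc_eq_id fun _ => rfl
  exact ⟨_, PolyTime.decideGroups_iff,
    PolyTime.PT.tm2ComputableInPolyTime (e := InputSymbol.encodeInput) (fun _ => rfl)
      h.parse.decideGroups⟩
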